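/- There are absolute constants $K_0>0$ and $c>0$ and a randomized polynomial-time algorithm with the following property. The input consists of integers $n,m$ with $n>K_0$ and $0\le m\le 2^n$, a vector $y\in[0,1]^n$, vectors $a_1,\dots,a_m\in\mathbb{R}^n$ and numbers $\lambda_1,\dots,\lambda_m\ge 0$ with $$\sum_{j=1}^m e^{-\lambda_j^2/K_0}<\frac n{16},$$ all entries being rational and given in binary. The algorithm always halts in time polynomial in the number of bits of the input (in particular polynomial in $n$, $m$ and the bit length of the entries), and with probability at least $\frac12$ over its random bits it outputs a (rational) vector $y'\in[0,1]^n$ such that $$|\langle y'-y,a_j\rangle|\le \lambda_j\sqrt{W_j(y)}+\frac1{n^2}\|a_j\|\quad\text{for all } j=1,\dots,m,\qquad \#\{i: y'_i\in\{0,1\}\}\ge c\,n,$$ where $W_j(y)=\sum_{i=1}^n a_{ji}^2\min\{y_i,1-y_i\}^2$ and $\|\cdot\|$ is the Euclidean norm. Here time is measured on a random access machine with fair coin flips whose memory cells hold rational numbers in lowest terms, at logarithmic (bit-length) cost: an arithmetic operation costs the square of the total bit length of its operands, and a memory access costs the bit length of the address and of the datum. Moreover, with the same constants $K_0$ and $c$,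 for arbitrary real data $y,a_j,\lambda_j$ satisfying these conditions a vector $y'\in[0,1]^n$ with the two displayed properties exists. -/

import Mathlib

namespace PartialRounding

/-! ## The rounding problem -/

/-- `W(y) = ∑ᵢ aᵢ² · min {yᵢ, 1 - yᵢ}²` for one constraint vector `a`. -/
noncomputable def W {n : ℕ} (a y : Fin n → ℝ) : ℝ :=
  ∑ i, a i ^ 2 * min (y i) (1 - y i) ^ 2

/-- The requirements on the data: `n > K₀`, `m ≤ 2 ^ n`, `y ∈ [0,1]^n`, `λ ≥ 0` and
`∑ⱼ exp (-λⱼ² / K₀) < n / 16`. -/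
structure Admissible (K₀ : ℝ) {n m : ℕ} (y : Fin n → ℝ) (a : Fin m → Fin n → ℝ)
    (lam : Fin m → ℝ) : Prop where
  dim_large : K₀ < n
  card_le : m ≤ 2 ^ n
  mem_cube : ∀ i, y i ∈ Set.Icc (0 : ℝ) 1
  lam_nonneg : ∀ j, 0 ≤ lam j
  sum_lt : ∑ j, Real.exp (-(lam j) ^ 2 / K₀) < n / 16

/-- `y'` is a partial rounding of `y` in which at least `c * n` coordinates are integral.
`‖WithLp.toLp 2 (a j)‖` is the Euclidean norm of `a j`. -/
structure IsPartialRounding (c : ℝ) {n m : ℕ} (y : Fin n → ℝ) (a : Fin m → Fin n → ℝ)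
    (lam : Fin m → ℝ) (y' : Fin n → ℝ) : Prop where
  mem_cube : ∀ i, y' i ∈ Set.Icc (0 : ℝ) 1
  error_le : ∀ j, |(y' - y) ⬝ᵥ a j| ≤
    lam j * √(W (a j) y) + 1 / (n : ℝ) ^ 2 * ‖WithLp.toLp 2 (a j)‖
  integral : c * n ≤ Nat.card {i : Fin n // y' i = 0 ∨ y' i = 1}

/-! ## Randomized programs and their running time

A random access machine with structured control flow, whose memory consists of arrays of rational
numbers in lowest terms, charged by bit length: each arithmetic operation costs the square
of the total bit length of its operands, each access to memory the bit length of the address and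
of the datum. Up to polynomial factors this is Turing machine time. -/

/-- The bit length of a rational number (sign, numerator, denominator). -/
def bitLength (q : ℚ) : ℕ := 1 + q.num.natAbs.size + q.den.size

/-- `μ b k` is the content of cell `k` of array `b`. -/
abbrev Memory : Type := ℕ → ℕ → ℚ

/-- The binary operations; `le` is the comparison, with value `1` or `0`. -/
inductive Op : Type
  | add | sub | mul | div | le

def Op.eval : Op → ℚ → ℚ → ℚ
  | .add, u, v => u + v
  | .sub, u, v => u - v
  | .mul, u, v => u * v
  | .div, u, v => u / v
  | .le, u, v => if u ≤ v then 1 else 0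

/-- Expressions; `read b e` is the content of cell `⌊e⌋₊` of array `b`. -/
inductive Expr : Type
  | const (q : ℚ)
  | read (b : ℕ) (e : Expr)
  | floor (e : Expr)
  | op (o : Op) (e₁ e₂ : Expr)

namespace Expr

def eval (μ : Memory) : Expr → ℚ
  | const q => q
  | read b e => μ b ⌊e.eval μ⌋₊
  | floor e => (⌊e.eval μ⌋ : ℤ)
  | op o e₁ e₂ => o.eval (e₁.eval μ) (e₂.eval μ)

/-- The time to evaluate an expression. -/
def cost (μ : Memory) : Expr → ℕ
  | const q => bitLength q
  | read b e => e.cost μ + bitLength (e.eval μ) + bitLength (μ b ⌊e.eval μ⌋₊)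
  | floor e => e.cost μ + bitLength (e.eval μ) ^ 2
  | op _ e₁ e₂ => e₁.cost μ + e₂.cost μ + (bitLength (e₁.eval μ) + bitLength (e₂.eval μ)) ^ 2

end Expr

/-- Programs. `assign b i e` writes the value of `e` to cell `⌊i⌋₊` of array `b`, and `flip b i`
writes a fresh random bit there. Tests (`ite`, `loop`) ask whether a value is nonzero. -/
inductive Program : Type
  | skip
  | assign (b : ℕ) (i e : Expr)
  | flip (b : ℕ) (i : Expr)
  | seq (P Q : Program)
  | ite (e : Expr) (P Q : Program)
  | loop (e : Expr) (P : Program)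

/-- A state: the memory and the number of random bits used so far. -/
structure State : Type where
  mem : Memory
  used : ℕ

/-- The state after writing `v` to cell `k` of array `b`. -/
def State.write (s : State) (b k : ℕ) (v : ℚ) : State :=
  { s with mem := Function.update s.mem b (Function.update (s.mem b) k v) }

/-- `Exec ω P s s' t`: with the sequence `ω` of random bits, the program `P` started in
state `s` halts in state `s'` after time exactly `t`. -/
inductive Exec (ω : ℕ → Bool) : Program → State → State → ℕ → Prop
  | skip (s : State) : Exec ω .skip s s 1
  | assign (b : ℕ) (i e : Expr) (s : State) :
      Exec ω (.assign b i e) s (s.write b ⌊i.eval s.mem⌋₊ (e.eval s.mem))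
        (i.cost s.mem + e.cost s.mem + bitLength (i.eval s.mem) + bitLength (e.eval s.mem))
  | flip (b : ℕ) (i : Expr) (s : State) :
      Exec ω (.flip b i) s
        { s.write b ⌊i.eval s.mem⌋₊ (if ω s.used then 1 else 0) with used := s.used + 1 }
        (i.cost s.mem + bitLength (i.eval s.mem) + 1)
  | seq {P Q : Program} {s₁ s₂ s₃ : State} {t₁ t₂ : ℕ} :
      Exec ω P s₁ s₂ t₁ → Exec ω Q s₂ s₃ t₂ → Exec ω (.seq P Q) s₁ s₃ (t₁ + t₂)
  | ite_true {e : Expr} {P Q : Program} {s s' : State} {t : ℕ} :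
      e.eval s.mem ≠ 0 → Exec ω P s s' t → Exec ω (.ite e P Q) s s' (e.cost s.mem + 1 + t)
  | ite_false {e : Expr} {P Q : Program} {s s' : State} {t : ℕ} :
      e.eval s.mem = 0 → Exec ω Q s s' t → Exec ω (.ite e P Q) s s' (e.cost s.mem + 1 + t)
  | loop_done {e : Expr} {P : Program} {s : State} :
      e.eval s.mem = 0 → Exec ω (.loop e P) s s (e.cost s.mem + 1)
  | loop_step {e : Expr} {P : Program} {s₁ s₂ s₃ : State} {t₁ t₂ : ℕ} :
      e.eval s₁.mem ≠ 0 → Exec ω P s₁ s₂ t₁ → Exec ω (.loop e P) s₂ s₃ t₂ →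
      Exec ω (.loop e P) s₁ s₃ (e.cost s₁.mem + 1 + t₁ + t₂)

/-- The run of a program is determined by its random bits and the initial state. -/
theorem Exec.deterministic {ω : ℕ → Bool} {P : Program} {s s₁ : State} {t₁ : ℕ}
    (h₁ : Exec ω P s s₁ t₁) : ∀ {s₂ : State} {t₂ : ℕ}, Exec ω P s s₂ t₂ → s₁ = s₂ ∧ t₁ = t₂ := by
  induction h₁ with
  | skip s => intro _ _ h; cases h; exact ⟨rfl, rfl⟩
  | assign b i e s => intro _ _ h; cases h; exact ⟨rfl, rfl⟩
  | flip b i s => intro _ _ h; cases h; exact ⟨rfl, rfl⟩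
  | seq _ _ ihP ihQ =>
    intro _ _ h
    cases h with
    | seq hP hQ =>
      obtain ⟨rfl, rfl⟩ := ihP hP
      obtain ⟨rfl, rfl⟩ := ihQ hQ
      exact ⟨rfl, rfl⟩
  | ite_true he _ ih =>
    intro _ _ h
    cases h with
    | ite_true _ hP => obtain ⟨rfl, rfl⟩ := ih hP; exact ⟨rfl, rfl⟩
    | ite_false he' _ => exact absurd he' he
  | ite_false he _ ih =>
    intro _ _ h
    cases h with
    | ite_true he' _ => exact absurd he he'
    | ite_false _ hP => obtain ⟨rfl, rfl⟩ := ih hP; exact ⟨rfl, rfl⟩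
  | loop_done he =>
    intro _ _ h
    cases h with
    | loop_done _ => exact ⟨rfl, rfl⟩
    | loop_step he' _ _ => exact absurd he he'
  | loop_step he _ _ ihP ihL =>
    intro _ _ h
    cases h with
    | loop_done he' => exact absurd he' he
    | loop_step _ hP hL =>
      obtain ⟨rfl, rfl⟩ := ihP hP
      obtain ⟨rfl, rfl⟩ := ihL hL
      exact ⟨rfl, rfl⟩

/-! ## Rational instances as inputs of programs -/

/-- The number of bits of a rational instance. -/
def inputSize {n m : ℕ} (y : Fin n → ℚ) (a : Fin m → Fin n → ℚ) (lam : Fin m → ℚ) : ℕ :=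
  bitLength n + bitLength m + ∑ i, bitLength (y i) + ∑ j, ∑ i, bitLength (a j i) +
    ∑ j, bitLength (lam j)

/-- The initial memory: array `0` holds `n` and `m`, array `1` holds `y`, array `2` holds the
matrix with rows `aⱼ` row by row (the entry `a j i` in cell `i + n * j`), array `3` holds `λ`;
all other cells are zero. -/
def inputMemory {n m : ℕ} (y : Fin n → ℚ) (a : Fin m → Fin n → ℚ) (lam : Fin m → ℚ) : Memory
  | 0, 0 => n
  | 0, 1 => m
  | 1, k => if h : k < n then y ⟨k, h⟩ else 0
  | 2, k => if h : k < m * n then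
      a (finProdFinEquiv.symm ⟨k, h⟩).1 (finProdFinEquiv.symm ⟨k, h⟩).2 else 0
  | 3, k => if h : k < m then lam ⟨k, h⟩ else 0
  | _, _ => 0

/-- With random bits `ω`, the program `P` on input `(y, a, λ)` halts within time `T`. -/
def HaltsWithin (P : Program) (ω : ℕ → Bool) (T : ℕ) {n m : ℕ} (y : Fin n → ℚ)
    (a : Fin m → Fin n → ℚ) (lam : Fin m → ℚ) : Prop :=
  ∃ (s : State) (t : ℕ), Exec ω P ⟨inputMemory y a lam, 0⟩ s t ∧ t ≤ T

/-- With random bits `ω`, the program `P` on input `(y, a, λ)` halts, and the vector in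
cells `0, …, n - 1` of array `4` is a partial rounding of `y`. -/
def FindsRounding (c : ℝ) (P : Program) (ω : ℕ → Bool) {n m : ℕ} (y : Fin n → ℚ)
    (a : Fin m → Fin n → ℚ) (lam : Fin m → ℚ) : Prop :=
  ∃ (s : State) (t : ℕ), Exec ω P ⟨inputMemory y a lam, 0⟩ s t ∧
    IsPartialRounding c (fun i => (y i : ℝ)) (fun j i => (a j i : ℝ)) (fun j => (lam j : ℝ))
      (fun i => (s.mem 4 i : ℝ))

/-- The probability of an event for `N` independent fair random bits. The sequence is continued by
`false`; a program that runs for time at most `N` never reads that part, since every random bit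
takes at least one unit of time. -/
noncomputable def coinProb (N : ℕ) (A : (ℕ → Bool) → Prop) : ℝ :=
  Nat.card {r : Fin N → Bool // A (fun k => if h : k < N then r ⟨k, h⟩ else false)} / 2 ^ N

end PartialRounding

namespace PartialRounding

/-! ## Bit lengths -/

/-! Writing `y' = y - σ · offset y · x` with `x ∈ [-1,1]^n` and a sign `σ` turns the rounding
problem into a discrepancy problem for the rows `b_j = scaled y a j`, whose squared norms are
`W_j(y)`; a coordinate becomes integral when `x_i = σ`. The point `x` is the end of a random walk of
Lovett–Meka type that starts at 0 and makes `4 n^10` steps of scale `1/n^5`, so it runs for total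
time 4. A coordinate closer than `1/n^4` to ±1 is frozen, a row with `|⟨b_j, x⟩| > λ_j ‖b_j‖` is
tight, and each step follows a random sign vector that is, almost, projected away from the frozen
coordinates and the tight rows.

Many coordinates freeze by an energy argument. On average a step adds to `‖x‖²` at least `n^(-10)`
times the number `n - frozen - tight` of unconstrained dimensions (`norm_walkStep_average`). The
walk is subgaussian, so at each time the expected number of tight rows is at most `n/8`
(`mean_tight_le`). Since `‖x‖² ≤ n` and frozen coordinates stay frozen, at least `5n/8` coordinates
are frozen at the end on average, hence at least `n/4` with probability at least `1/2`
(`half_le_mean_frozen`). Taking for `σ` the majority sign of the frozen coordinates makes half of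
them integral. The errors are controlled deterministically, for every outcome of the random bits
(`abs_dotProduct_walk_le`, `isPartialRounding_roundedPoint`).

The projection is replaced by many gradient steps for a quadratic form built from the tight rows
(`descend_iterate_le`). This uses rational arithmetic only, and the resulting map is a self-adjoint
contraction that fixes every vector supported on the free coordinates and orthogonal to the tight
rows, which is all that the probabilistic part needs. The current point influences the next
direction only through the sets of frozen coordinates and tight rows, so denominators do not
accumulate along the walk: all its points lie on one grid of polynomial bit length (`onGrid_walk`).
The program consists of nested loops around one array operation (`exec_mapSum`), and its time bound
holds for every bit sequence (`exec_roundingProgram`). For real data the same walk has positive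
success probability, which gives existence. -/

theorem bitLength_pos (q : ℚ) : 1 ≤ bitLength q := by unfold bitLength; omega

theorem size_mul_le (a b : ℕ) : (a * b).size ≤ a.size + b.size := by
  rw [Nat.size_le, pow_add]
  exact Nat.mul_lt_mul'' (Nat.lt_size_self a) (Nat.lt_size_self b)

theorem size_add_le (a b : ℕ) : (a + b).size ≤ max a.size b.size + 1 := by
  rw [Nat.size_le, pow_succ]
  have h₁ := (Nat.lt_size_self a).trans_le
    (Nat.pow_le_pow_right two_pos (le_max_left a.size b.size))
  have h₂ := (Nat.lt_size_self b).trans_le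
    (Nat.pow_le_pow_right two_pos (le_max_right a.size b.size))
  omega

/-- Passing to lowest terms only shrinks numerator and denominator, so the length can be read off
from any representing fraction. -/
theorem bitLength_divInt_le (p q : ℤ) (hq : q ≠ 0) :
    bitLength (p / q : ℚ) ≤ 1 + p.natAbs.size + q.natAbs.size := by
  have hq' : (q : ℚ) ≠ 0 := by exact_mod_cast hq
  unfold bitLength
  have h1 : ((p / q : ℚ).den : ℤ) ∣ q := by
    have := Rat.den_dvd p q
    rwa [Rat.divInt_eq_div] at this
  have h2 : (p / q : ℚ).num.natAbs ≤ p.natAbs := by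
    rcases eq_or_ne p 0 with rfl | hp
    · simp
    · have := Rat.num_dvd p hq
      rw [Rat.divInt_eq_div] at this
      exact Nat.le_of_dvd (Int.natAbs_pos.mpr hp) (Int.natAbs_dvd_natAbs.mpr this)
  have h3 : (p / q : ℚ).den ≤ q.natAbs :=
    Nat.le_of_dvd (Int.natAbs_pos.mpr hq) (Int.natCast_dvd.mp h1)
  have := Nat.size_le_size h2
  have := Nat.size_le_size h3
  omega

theorem bitLength_eval_le (o : Op) (u v : ℚ) :
    bitLength (o.eval u v) ≤ 2 * (bitLength u + bitLength v) := by
  have hu : u = (u.num : ℚ) / (u.den : ℤ) := by simpa using (Rat.num_div_den u).symm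
  have hv : v = (v.num : ℚ) / (v.den : ℤ) := by simpa using (Rat.num_div_den v).symm
  have hu0 : (u.den : ℚ) ≠ 0 := by exact_mod_cast u.den_nz
  have hv0 : (v.den : ℚ) ≠ 0 := by exact_mod_cast v.den_nz
  have hden : ((u.den * v.den : ℕ) : ℤ) ≠ 0 := by
    exact_mod_cast Nat.mul_ne_zero u.den_nz v.den_nz
  have hsd := size_mul_le u.den v.den
  have hs1 := size_mul_le u.num.natAbs v.den
  have hs2 := size_mul_le v.num.natAbs u.den
  have hs3 := size_mul_le u.num.natAbs v.num.natAbs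
  have hs4 := size_mul_le u.den v.num.natAbs
  have hs := size_add_le (u.num.natAbs * v.den) (v.num.natAbs * u.den)
  have hadd : ∀ w : ℤ, w.natAbs = v.num.natAbs →
      bitLength (((u.num * v.den + w * u.den : ℤ) : ℚ) / ((u.den * v.den : ℕ) : ℤ)) ≤
        2 * (bitLength u + bitLength v) := by
    intro w hw
    refine (bitLength_divInt_le _ _ hden).trans ?_
    have h1 : (u.num * v.den + w * u.den).natAbs ≤
        u.num.natAbs * v.den + v.num.natAbs * u.den := by
      refine (Int.natAbs_add_le _ _).trans ?_
      simp [Int.natAbs_mul, hw]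
    have := Nat.size_le_size h1
    rw [Int.natAbs_natCast]
    unfold bitLength
    omega
  cases o with
  | add =>
    have : Op.add.eval u v =
        ((u.num * v.den + v.num * u.den : ℤ) : ℚ) / ((u.den * v.den : ℕ) : ℤ) := by
      conv_lhs => rw [hu, hv]
      simp only [Op.eval]; push_cast; field_simp
    rw [this]; exact hadd _ rfl
  | sub =>
    have : Op.sub.eval u v =
        ((u.num * v.den + (-v.num) * u.den : ℤ) : ℚ) / ((u.den * v.den : ℕ) : ℤ) := by
      conv_lhs => rw [hu, hv]
      simp only [Op.eval]; push_cast; field_simp; ring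
    rw [this]; exact hadd _ (Int.natAbs_neg _)
  | mul =>
    have : Op.mul.eval u v = ((u.num * v.num : ℤ) : ℚ) / ((u.den * v.den : ℕ) : ℤ) := by
      conv_lhs => rw [hu, hv]
      simp only [Op.eval]; push_cast; field_simp
    rw [this]
    refine (bitLength_divInt_le _ _ hden).trans ?_
    rw [Int.natAbs_natCast, Int.natAbs_mul]
    unfold bitLength
    omega
  | div =>
    rcases eq_or_ne v 0 with rfl | h0
    -- Division by zero returns 0.
    · simp [Op.eval, bitLength]
    · have h0' : (v.num : ℚ) ≠ 0 := by exact_mod_cast Rat.num_ne_zero.mpr h0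
      have : Op.div.eval u v = ((u.num * v.den : ℤ) : ℚ) / ((u.den * v.num : ℤ) : ℚ) := by
        conv_lhs => rw [hu, hv]
        simp only [Op.eval]; push_cast; field_simp
      rw [this]
      refine (bitLength_divInt_le _ _ ?_).trans ?_
      · exact mul_ne_zero (by exact_mod_cast u.den_nz) (Rat.num_ne_zero.mpr h0)
      · rw [Int.natAbs_mul, Int.natAbs_mul, Int.natAbs_natCast, Int.natAbs_natCast]
        unfold bitLength
        omega
  | le =>
    have := bitLength_pos u
    have := bitLength_pos v
    have h1 : Nat.size 1 = 1 := by simp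
    simp only [Op.eval]
    split_ifs <;> simp [bitLength, h1] <;> omega

theorem bitLength_floor_le (q : ℚ) : bitLength (⌊q⌋ : ℤ) ≤ bitLength q + 1 := by
  have h : (⌊q⌋ : ℤ).natAbs ≤ q.num.natAbs := by
    have hd : (1 : ℚ) ≤ q.den := by exact_mod_cast q.den_pos
    have hq : q * q.den = q.num := Rat.mul_den_eq_num q
    rcases le_or_gt 0 q with h0 | h0
    · have h1 : (⌊q⌋ : ℚ) ≤ q.num := (Int.floor_le q).trans (by nlinarith)
      have h1' : ⌊q⌋ ≤ q.num := by exact_mod_cast h1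
      have h2 : 0 ≤ ⌊q⌋ := Int.floor_nonneg.mpr h0
      omega
    · have h1 : q.num ≤ ⌊q⌋ := Int.le_floor.mpr (by nlinarith)
      have h2 : ⌊q⌋ < 0 := by
        rw [Int.floor_lt]; exact_mod_cast h0
      omega
  have := Nat.size_le_size h
  unfold bitLength
  rw [Rat.num_intCast, Rat.den_intCast]
  have h1 : Nat.size 1 = 1 := by simp
  omega

/-! ## Evaluation time of expressions -/

/-- Every memory cell holds a number of at most `B` bits. -/
def BitBounded (B : ℕ) (μ : Memory) : Prop := ∀ b k, bitLength (μ b k) ≤ B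

theorem BitBounded.pos {B : ℕ} {μ : Memory} (h : BitBounded B μ) : 1 ≤ B :=
  (bitLength_pos _).trans (h 0 0)

/-- A factor for the values and the costs of an expression in bounded memory. -/
def Expr.weight : Expr → ℕ
  | const q => bitLength q
  | read _ e => 2 * e.weight + 1
  | floor e => e.weight ^ 2 + e.weight + 1
  | op _ e₁ e₂ => (e₁.weight + e₂.weight) ^ 2 + 2 * (e₁.weight + e₂.weight)

/-- An operation at most doubles the total length of its operands, so a fixed expression enlarges
lengths by a factor that depends on neither the memory nor `B`. Costs square lengths, whence `B ^ 2`
in `cost_le`. -/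
theorem Expr.bitLength_eval_le {B : ℕ} {μ : Memory} (hμ : BitBounded B μ) (e : Expr) :
    bitLength (e.eval μ) ≤ e.weight * B := by
  have hB := hμ.pos
  induction e with
  | const q => exact Nat.le_mul_of_pos_right _ hB
  | read b e ih => exact (hμ _ _).trans (Nat.le_mul_of_pos_left _ (by simp [weight]))
  | floor e ih =>
    simp only [weight, eval]
    refine (bitLength_floor_le _).trans ?_
    nlinarith [Nat.zero_le (e.weight ^ 2 * B)]
  | op o e₁ e₂ ih₁ ih₂ =>
    simp only [weight, eval]
    refine (PartialRounding.bitLength_eval_le _ _ _).trans ?_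
    nlinarith [Nat.zero_le ((e₁.weight + e₂.weight) ^ 2 * B)]

theorem Expr.cost_le {B : ℕ} {μ : Memory} (hμ : BitBounded B μ) (e : Expr) :
    e.cost μ ≤ e.weight * B ^ 2 := by
  have hB := hμ.pos
  have hB2 : B ≤ B ^ 2 := Nat.le_self_pow two_ne_zero B
  induction e with
  | const q => exact Nat.le_mul_of_pos_right _ (by positivity)
  | read b e ih =>
    simp only [weight, cost]
    have h1 := e.bitLength_eval_le hμ
    have h2 := hμ b ⌊e.eval μ⌋₊
    nlinarith [Nat.mul_le_mul_left e.weight hB2]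
  | floor e ih =>
    simp only [weight, cost]
    have h1 := Nat.pow_le_pow_left (e.bitLength_eval_le hμ) 2
    rw [mul_pow] at h1
    nlinarith [Nat.zero_le (B ^ 2)]
  | op o e₁ e₂ ih₁ ih₂ =>
    simp only [weight, cost]
    have h1 := Nat.pow_le_pow_left
      (add_le_add (e₁.bitLength_eval_le hμ) (e₂.bitLength_eval_le hμ)) 2
    rw [← add_mul, mul_pow] at h1
    nlinarith [Nat.zero_le ((e₁.weight + e₂.weight) * B ^ 2)]

/-! ## Assignments and counting loops -/

theorem BitBounded.write {B : ℕ} {s : State} (h : BitBounded B s.mem) {v : ℚ}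
    (hv : bitLength v ≤ B) (b k : ℕ) : BitBounded B (s.write b k v).mem := by
  intro b' k'
  rcases eq_or_ne b' b with rfl | hb
  · rcases eq_or_ne k' k with rfl | hk
    · simpa [State.write] using hv
    · simpa [State.write, hk] using h b' k'
  · simpa [State.write, hb] using h b' k'

theorem State.write_mem_of_ne (s : State) {b b' : ℕ} (h : b' ≠ b) (k : ℕ) (v : ℚ) :
    (s.write b k v).mem b' = s.mem b' := by
  simp [State.write, Function.update_of_ne h]

theorem State.write_mem_self (s : State) (b k : ℕ) (v : ℚ) :
    (s.write b k v).mem b = Function.update (s.mem b) k v := by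
  simp [State.write]

/-- The expression for cell `0` of array `b`. -/
def cell (b : ℕ) : Expr := .read b (.const 0)

@[simp] theorem eval_cell (b : ℕ) (μ : Memory) : (cell b).eval μ = μ b 0 := by
  simp [cell, Expr.eval]

theorem exec_assign {ω : ℕ → Bool} {B : ℕ} {s : State} (hB : BitBounded B s.mem) (b : ℕ)
    (i e : Expr) {k : ℕ} {v : ℚ} (hi : i.eval s.mem = k) (he : e.eval s.mem = v) :
    ∃ t, Exec ω (.assign b i e) s (s.write b k v) t ∧
      t ≤ 2 * (i.weight + e.weight) * B ^ 2 := by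
  have h := Exec.assign (ω := ω) b i e s
  rw [hi, he, Nat.floor_natCast] at h
  refine ⟨_, h, ?_⟩
  have hB2 : B ≤ B ^ 2 := Nat.le_self_pow two_ne_zero B
  have h1 := i.cost_le hB
  have h2 := e.cost_le hB
  have h3 := i.bitLength_eval_le hB
  have h4 := e.bitLength_eval_le hB
  rw [hi] at h3
  rw [he] at h4
  nlinarith [Nat.mul_le_mul_left i.weight hB2, Nat.mul_le_mul_left e.weight hB2]

/-- `for c = 0, …, N - 1 do P`, with the counter in cell `0` of array `c`. -/
def forLoop (c : ℕ) (N : Expr) (P : Program) : Program :=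
  .seq (.assign c (.const 0) (.const 0))
    (.loop (.op .le (.op .add (cell c) (.const 1)) N)
      (.seq P (.assign c (.const 0) (.op .add (cell c) (.const 1)))))

/-- A factor for the time of the control of a loop. -/
def loopWeight (N : Expr) : ℕ :=
  (Expr.op .le (.op .add (cell 0) (.const 1)) N).weight +
    2 * ((Expr.const 0).weight + (Expr.op .add (cell 0) (.const 1)).weight) +
    4 * (Expr.const 0).weight + 1

/-- The invariant rule for counting loops, with time. By `hwrite` the invariant ignores the counter
cell, which the loop control overwrites. The counter reaches the value `N` itself, so `hN` includes
it. -/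
theorem exec_forLoop {ω : ℕ → Bool} {B N τ c : ℕ} {bound : Expr} {P : Program}
    (Inv : ℕ → State → Prop)
    (hbdd : ∀ i s, Inv i s → BitBounded B s.mem)
    (hbound : ∀ i s, Inv i s → bound.eval s.mem = N)
    (hN : ∀ i ≤ N, bitLength (i : ℚ) ≤ B)
    (hwrite : ∀ i s v, bitLength v ≤ B → Inv i s → Inv i (s.write c 0 v))
    (hbody : ∀ i < N, ∀ s, Inv i s → s.mem c 0 = i →
      ∃ s' t, Exec ω P s s' t ∧ t ≤ τ ∧ s'.mem c 0 = i ∧ Inv (i + 1) s')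
    {s : State} (hs : Inv 0 s) :
    ∃ s' t, Exec ω (forLoop c bound P) s s' t ∧ t ≤ (N + 1) * (τ + loopWeight bound * B ^ 2) ∧
      Inv N s' := by
  set cond : Expr := .op .le (.op .add (cell c) (.const 1)) bound
  -- Weights do not see array numbers, so a single `loopWeight` serves all counters.
  have hcw : cond.weight = (Expr.op .le (.op .add (cell 0) (.const 1)) bound).weight := rfl
  set inc : Expr := .op .add (cell c) (.const 1)
  have hiw : inc.weight = (Expr.op .add (cell 0) (.const 1)).weight := rfl
  have hB := (hbdd 0 s hs).pos
  have hB2 : 1 ≤ B ^ 2 := Nat.one_le_pow _ _ hB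
  -- Induction on the number `d` of remaining rounds.
  have loop : ∀ d i, i + d = N → ∀ s, Inv i s → s.mem c 0 = i →
      ∃ s' t, Exec ω (.loop cond (.seq P (.assign c (.const 0) inc))) s s' t ∧
        t ≤ d * (τ + (cond.weight + 1 + 2 * ((Expr.const 0).weight + inc.weight)) * B ^ 2) +
          (cond.weight + 1) * B ^ 2 ∧ Inv N s' := by
    intro d
    induction d with
    | zero =>
      intro i hi s hI hc
      have he : cond.eval s.mem = 0 := by
        have hlt : ¬ ((i : ℚ) + 1 ≤ N) := by rw [← hi]; simp
        simp [cond, Expr.eval, Op.eval, hc, hbound i s hI, hlt]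
      refine ⟨s, _, Exec.loop_done he, ?_, ?_⟩
      · have := cond.cost_le (hbdd i s hI)
        nlinarith
      · rw [← hi]; exact hI
    | succ d ih =>
      intro i hi s hI hc
      have hiN : i < N := by omega
      have he : cond.eval s.mem ≠ 0 := by
        have hle : (i : ℚ) + 1 ≤ N := by exact_mod_cast hiN
        simp [cond, Expr.eval, Op.eval, hc, hbound i s hI, hle]
      obtain ⟨s₁, t₁, h₁, ht₁, hc₁, hI₁⟩ := hbody i hiN s hI hc
      obtain ⟨t₂, h₂, ht₂⟩ := exec_assign (ω := ω) (hbdd _ _ hI₁) c (.const 0) inc (k := 0)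
        (v := ((i + 1 : ℕ) : ℚ)) (by simp [Expr.eval])
        (by simp [inc, Expr.eval, Op.eval, hc₁])
      have hI₂ := hwrite _ _ _ (hN (i + 1) (by omega)) hI₁
      obtain ⟨s₃, t₃, h₃, ht₃, hI₃⟩ := ih (i + 1) (by omega) _ hI₂
        (by rw [State.write_mem_self]; simp)
      refine ⟨s₃, _, Exec.loop_step he (Exec.seq h₁ h₂) h₃, ?_, hI₃⟩
      have := cond.cost_le (hbdd i s hI)
      nlinarith
  obtain ⟨t₀, h₀, ht₀⟩ := exec_assign (ω := ω) (hbdd _ _ hs) c (.const 0) (.const 0) (k := 0)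
    (v := ((0 : ℕ) : ℚ)) (by simp [Expr.eval]) (by simp [Expr.eval])
  obtain ⟨s', t, h, ht, hI⟩ := loop N 0 (by omega) _ (hwrite 0 s _ (hN 0 (by omega)) hs)
    (by rw [State.write_mem_self]; simp)
  refine ⟨s', _, Exec.seq h₀ h, ?_, hI⟩
  have hw : loopWeight bound =
      cond.weight + 2 * ((Expr.const 0).weight + inc.weight) + 4 * (Expr.const 0).weight + 1 := rfl
  rw [hw]
  calc t₀ + t ≤ 4 * (Expr.const 0).weight * B ^ 2 +
        (N * (τ + (cond.weight + 1 + 2 * ((Expr.const 0).weight + inc.weight)) * B ^ 2) +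
          (cond.weight + 1) * B ^ 2) := by
        refine add_le_add (ht₀.trans (le_of_eq (by ring))) ht
    _ ≤ _ := by
        zify
        have e1 : (0:ℤ) ≤ N := by positivity
        have e2 : (0:ℤ) ≤ τ := by positivity
        have e3 : (0:ℤ) ≤ (Expr.const 0).weight := by positivity
        have e4 : (0:ℤ) ≤ inc.weight := by positivity
        have e5 : (0:ℤ) ≤ (N : ℤ) * (Expr.const 0).weight * B ^ 2 := by positivity
        have e6 : (0:ℤ) ≤ (inc.weight : ℤ) * B ^ 2 := by positivity
        have e7 : (0:ℤ) ≤ ((Expr.const 0).weight : ℤ) * B ^ 2 := by positivity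
        nlinarith

/-! ## Filling an array with sums -/

/-- `for j < N do { r := 0; for i < M do r := r + e; out[j] := f }`. The cells `0` of the arrays
`20`, `21`, `22` hold `i`, `r`, `j`. -/
def mapSum (out : ℕ) (N M e f : Expr) : Program :=
  forLoop 22 N (.seq (.assign 21 (.const 0) (.const 0))
    (.seq (forLoop 20 M (.assign 21 (.const 0) (.op .add (cell 21) e)))
      (.assign out (cell 22) f)))

/-- The two memories agree outside `out` and the scratch arrays of `mapSum`. -/
def Agree (out : ℕ) (μ μ' : Memory) : Prop :=
  ∀ b, b ≠ 20 → b ≠ 21 → b ≠ 22 → b ≠ out → μ' b = μ b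

theorem Agree.refl (out : ℕ) (μ : Memory) : Agree out μ μ := fun _ _ _ _ _ => rfl

theorem Agree.write {out : ℕ} {μ : Memory} {s : State} (h : Agree out μ s.mem) {b : ℕ}
    (hb : b = 20 ∨ b = 21 ∨ b = 22 ∨ b = out) (k : ℕ) (v : ℚ) :
    Agree out μ (s.write b k v).mem := by
  intro b' h1 h2 h3 h4
  rw [State.write_mem_of_ne, h b' h1 h2 h3 h4]
  rintro rfl
  tauto

/-- A factor for the time of `mapSum`. -/
def mapSumWeight (N M e f : Expr) : ℕ :=
  4 * (Expr.const 0).weight + 2 * ((cell 22).weight + f.weight) + loopWeight N + loopWeight M +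
    2 * ((Expr.const 0).weight + (Expr.op .add (cell 21) e).weight)

/-- Apart from the coin flips, the rounding program works on arrays by this operation alone; `M = 0`
gives a plain map. The hypothesis in `hf` that cell `j` of `out` still has its old value allows
updates in place, while the summand `e` may rely only on arrays outside `out`. Partial sums are
stored too, so `hvB` bounds each of them. -/
theorem exec_mapSum {ω : ℕ → Bool} {out : ℕ} {bN bM e f : Expr} {s : State} {B N M : ℕ}
    (v : ℕ → ℕ → ℚ) (w : ℕ → ℚ) (h20 : out ≠ 20) (h21 : out ≠ 21) (h22 : out ≠ 22)
    (hB : BitBounded B s.mem)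
    (hN : ∀ μ, Agree out s.mem μ → bN.eval μ = N)
    (hM : ∀ μ, Agree out s.mem μ → bM.eval μ = M)
    (he : ∀ μ, Agree out s.mem μ → ∀ j < N, ∀ i < M, μ 22 0 = j → μ 20 0 = i →
      e.eval μ = v j i)
    (hf : ∀ μ, Agree out s.mem μ → ∀ j < N, μ 22 0 = j →
      μ 21 0 = ∑ i ∈ Finset.range M, v j i → μ out j = s.mem out j → f.eval μ = w j)
    (hNB : ∀ i ≤ N, bitLength (i : ℚ) ≤ B) (hMB : ∀ i ≤ M, bitLength (i : ℚ) ≤ B)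
    (hvB : ∀ j < N, ∀ i ≤ M, bitLength (∑ i ∈ Finset.range i, v j i) ≤ B)
    (hwB : ∀ j < N, bitLength (w j) ≤ B) :
    ∃ s' t, Exec ω (mapSum out bN bM e f) s s' t ∧
      t ≤ 2 * (N + 1) * (M + 1) * (mapSumWeight bN bM e f * B ^ 2) ∧
      s'.used = s.used ∧ BitBounded B s'.mem ∧ Agree out s.mem s'.mem ∧
      (s'.mem out = fun k => if k < N then w k else s.mem out k) := by
  have h0B : bitLength (0 : ℚ) ≤ B := by simpa using hNB 0 (Nat.zero_le _)
  set we := (Expr.op .add (cell 21) e).weight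
  set z := (Expr.const 0).weight
  have hz : 1 ≤ z := bitLength_pos 0
  have inner : ∀ j < N, ∀ s₁ : State, s₁.used = s.used → BitBounded B s₁.mem →
      Agree out s.mem s₁.mem → s₁.mem 22 0 = j → s₁.mem 21 0 = 0 →
      ∃ s' t, Exec ω (forLoop 20 bM (.assign 21 (.const 0) (.op .add (cell 21) e))) s₁ s' t ∧
        t ≤ (M + 1) * (2 * (z + we) * B ^ 2 + loopWeight bM * B ^ 2) ∧
        (s'.used = s.used ∧ BitBounded B s'.mem ∧ Agree out s.mem s'.mem ∧ s'.mem 22 0 = j ∧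
          s'.mem out = s₁.mem out ∧ s'.mem 21 0 = ∑ i ∈ Finset.range M, v j i) := by
    intro j hj s₁ hu hb ha hjs hzs
    refine exec_forLoop (fun i s' => s'.used = s.used ∧ BitBounded B s'.mem ∧
        Agree out s.mem s'.mem ∧ s'.mem 22 0 = j ∧ s'.mem out = s₁.mem out ∧
        s'.mem 21 0 = ∑ i ∈ Finset.range i, v j i) (fun _ _ h => h.2.1)
        (fun _ _ h => hM _ h.2.2.1) hMB ?_ ?_ ⟨hu, hb, ha, hjs, rfl, by simpa using hzs⟩
    · rintro i s' x hx ⟨h1, h2, h3, h4, h5, h6⟩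
      refine ⟨h1, h2.write hx _ _, h3.write (by simp) _ _, ?_, ?_, ?_⟩
      · rw [State.write_mem_of_ne _ (by norm_num), h4]
      · rw [State.write_mem_of_ne _ h20, h5]
      · rw [State.write_mem_of_ne _ (by norm_num), h6]
    · rintro i hi s' ⟨h1, h2, h3, h4, h5, h6⟩ hc
      obtain ⟨t, ht, htB⟩ := exec_assign (ω := ω) h2 21 (.const 0) (.op .add (cell 21) e) (k := 0)
        (v := ∑ i ∈ Finset.range (i + 1), v j i) (by simp [Expr.eval])
        (by rw [Finset.sum_range_succ, ← he _ h3 j hj i hi h4 hc, ← h6]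
            simp [Expr.eval, Op.eval])
      refine ⟨_, t, ht, htB, ?_, h1, h2.write (hvB j hj _ hi) _ _, h3.write (by simp) _ _,
        ?_, ?_, ?_⟩
      · rw [State.write_mem_of_ne _ (by norm_num), hc]
      · rw [State.write_mem_of_ne _ (by norm_num), h4]
      · rw [State.write_mem_of_ne _ h21, h5]
      · rw [State.write_mem_self]; simp
  set τ := 4 * z * B ^ 2 + (M + 1) * (2 * (z + we) * B ^ 2 + loopWeight bM * B ^ 2) +
    2 * ((cell 22).weight + f.weight) * B ^ 2 with hτ
  obtain ⟨s', t, ht, htB, hI⟩ : ∃ s' t, Exec ω (mapSum out bN bM e f) s s' t ∧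
      t ≤ (N + 1) * (τ + loopWeight bN * B ^ 2) ∧
      s'.used = s.used ∧ BitBounded B s'.mem ∧ Agree out s.mem s'.mem ∧
        s'.mem out = fun k => if k < N then w k else s.mem out k := by
    refine exec_forLoop (fun j s' => s'.used = s.used ∧ BitBounded B s'.mem ∧
      Agree out s.mem s'.mem ∧ s'.mem out = fun k => if k < j then w k else s.mem out k)
      (fun _ _ h => h.2.1) (fun _ _ h => hN _ h.2.2.1) hNB ?_ ?_
      ⟨rfl, hB, Agree.refl _ _, by simp⟩
    · rintro j s' x hx ⟨h1, h2, h3, h4⟩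
      refine ⟨h1, h2.write hx _ _, h3.write (by simp) _ _, ?_⟩
      rw [State.write_mem_of_ne _ h22, h4]
    · rintro j hj s' ⟨h1, h2, h3, h4⟩ hc
      obtain ⟨t₁, ht₁, htB₁⟩ := exec_assign (ω := ω) h2 21 (.const 0) (.const 0) (k := 0)
        (v := 0) (by simp [Expr.eval]) (by simp [Expr.eval])
      obtain ⟨s₂, t₂, ht₂, htB₂, g1, g2, g3, g4, g5, g6⟩ := inner j hj (s'.write 21 0 0) h1
        (h2.write h0B _ _) (h3.write (by simp) _ _)
        (by rw [State.write_mem_of_ne _ (by norm_num), hc]) (by rw [State.write_mem_self]; simp)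
      rw [State.write_mem_of_ne _ h21] at g5
      obtain ⟨t₃, ht₃, htB₃⟩ := exec_assign (ω := ω) g2 out (cell 22) f (k := j) (v := w j)
        (by simp [g4]) (hf _ g3 j hj g4 g6 (by rw [g5, h4]; simp))
      refine ⟨_, _, Exec.seq ht₁ (Exec.seq ht₂ ht₃), ?_, ?_, g1, g2.write (hwB j hj) _ _,
        g3.write (by simp) _ _, ?_⟩
      · have htB₁ : t₁ ≤ 4 * z * B ^ 2 := htB₁.trans (le_of_eq (by ring))
        rw [hτ]
        omega
      · rw [State.write_mem_of_ne _ h22.symm, g4]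
      · rw [State.write_mem_self, g5, h4]
        ext k
        rcases lt_trichotomy k j with h | h | h
        · rw [Function.update_of_ne h.ne]; simp [h, Nat.lt_succ_of_lt h]
        · subst h; simp
        · rw [Function.update_of_ne h.ne']; simp [not_lt.mpr h.le, show ¬ k < j + 1 by omega]
  refine ⟨s', t, ht, htB.trans ?_, hI⟩
  unfold mapSumWeight
  rw [hτ]
  zify
  have e1 : (0 : ℤ) ≤ (M : ℤ) * z * B ^ 2 := by positivity
  have e2 : (0 : ℤ) ≤ (M : ℤ) * we * B ^ 2 := by positivity
  have e3 : (0 : ℤ) ≤ (M : ℤ) * loopWeight bM * B ^ 2 := by positivity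
  have e4 : (0 : ℤ) ≤ (M : ℤ) * loopWeight bN * B ^ 2 := by positivity
  have e5 : (0 : ℤ) ≤ (M : ℤ) * (cell 22).weight * B ^ 2 := by positivity
  have e6 : (0 : ℤ) ≤ (M : ℤ) * f.weight * B ^ 2 := by positivity
  have e7 : (0 : ℤ) ≤ (z : ℤ) * B ^ 2 := by positivity
  have e8 : (0 : ℤ) ≤ (we : ℤ) * B ^ 2 := by positivity
  have e9 : (0 : ℤ) ≤ (loopWeight bM : ℤ) * B ^ 2 := by positivity
  have e10 : (0 : ℤ) ≤ (loopWeight bN : ℤ) * B ^ 2 := by positivity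
  have e11 : (0 : ℤ) ≤ ((cell 22).weight : ℤ) * B ^ 2 := by positivity
  have e12 : (0 : ℤ) ≤ (f.weight : ℤ) * B ^ 2 := by positivity
  rw [mul_comm (2 : ℤ) ((N : ℤ) + 1), mul_assoc ((N : ℤ) + 1), mul_assoc ((N : ℤ) + 1)]
  refine mul_le_mul_of_nonneg_left ?_ (by positivity)
  nlinarith

/-! ## The random walk -/

set_option linter.unusedSectionVars false

section Walk

variable {𝕜 : Type*} [Field 𝕜] [LinearOrder 𝕜] [IsStrictOrderedRing 𝕜] {n m : ℕ}

/-- The signed distance of `y` to a nearest integer. -/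
def offset (y : 𝕜) : 𝕜 := if y ≤ 1 / 2 then y else y - 1

/-- The rows `aⱼ`, scaled by the distances of the coordinates of `y` to the integers. -/
def scaled (y : Fin n → 𝕜) (a : Fin m → Fin n → 𝕜) : Fin m → Fin n → 𝕜 :=
  fun j i => a j i * offset (y i)

/-- A gradient step for the quadratic form `∑ⱼ cⱼ ⟨dⱼ, u⟩²`. -/
def descend (c : Fin m → 𝕜) (d : Fin m → Fin n → 𝕜) (u : Fin n → 𝕜) : Fin n → 𝕜 :=
  fun i => u i - ∑ j, c j * (d j ⬝ᵥ u) * d j i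

/-- The indicator of the coordinates which still move. -/
def free (x : Fin n → 𝕜) : Fin n → 𝕜 := fun i => if |x i| ≤ 1 - 1 / (n : 𝕜) ^ 4 then 1 else 0

/-- The coefficients of the quadratic form that penalizes moves along tight rows. -/
def coef (b : Fin m → Fin n → 𝕜) (lam : Fin m → 𝕜) (x : Fin n → 𝕜) : Fin m → 𝕜 :=
  fun j => if lam j ^ 2 * (b j ⬝ᵥ b j) < (b j ⬝ᵥ x) ^ 2 then 1 / ((m + 1) * (b j ⬝ᵥ b j)) else 0

/-- The rows restricted to the free coordinates. -/
def freeRows (b : Fin m → Fin n → 𝕜) (x : Fin n → 𝕜) : Fin m → Fin n → 𝕜 :=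
  fun j i => free x i * b j i

/-- The direction of the move from `x` that is obtained from the sign vector `r`: almost the
projection of `r` to the free coordinates and to the complement of the tight rows. -/
def direction (b : Fin m → Fin n → 𝕜) (lam : Fin m → 𝕜) (x r : Fin n → 𝕜) : Fin n → 𝕜 :=
  (descend (coef b lam x) (freeRows b x))^[(m + 1) * n ^ 17] (fun i => free x i * r i)

/-- A step of the walk. -/
def walkStep (b : Fin m → Fin n → 𝕜) (lam : Fin m → 𝕜) (x r : Fin n → 𝕜) : Fin n → 𝕜 :=
  fun i => x i + 1 / (n : 𝕜) ^ 5 * direction b lam x r i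

/-- The sign `1` or `-1` given by a bit. -/
def bitSign (t : Bool) : 𝕜 := if t then 1 else -1

/-- The walk that is driven by the bits `ω`. -/
def walk (b : Fin m → Fin n → 𝕜) (lam : Fin m → 𝕜) (ω : ℕ → Bool) : ℕ → Fin n → 𝕜
  | 0 => 0
  | s + 1 => walkStep b lam (walk b lam ω s) (fun i => bitSign (ω (s * n + i)))

/-- The walk with the coordinates that do not move any more rounded to `1` or `-1`. -/
def snap (x : Fin n → 𝕜) : Fin n → 𝕜 :=
  fun i => free x i * x i + (1 - free x i) * (if 0 ≤ x i then 1 else -1)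

/-- The majority sign of the coordinates that do not move any more. -/
def orientation (x : Fin n → 𝕜) : 𝕜 :=
  if 0 ≤ ∑ i, (1 - free x i) * (if 0 ≤ x i then 1 else -1) then 1 else -1

/-- The rounding of `y` obtained from the final point `x` of the walk. -/
def roundedPoint (y x : Fin n → 𝕜) : Fin n → 𝕜 :=
  fun i => y i - orientation x * offset (y i) * snap x i

/-! ### Gradient steps -/

theorem dotProduct_sub_descend (c : Fin m → 𝕜) (d : Fin m → Fin n → 𝕜) (u v : Fin n → 𝕜) :
    v ⬝ᵥ descend c d u = v ⬝ᵥ u - ∑ j, c j * (d j ⬝ᵥ u) * (d j ⬝ᵥ v) := by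
  have : descend c d u = u - ∑ j, (c j * (d j ⬝ᵥ u)) • d j := by
    ext i; simp [descend, Finset.sum_apply]
  rw [this, dotProduct_sub, dotProduct_sum]
  simp [dotProduct_comm v]

/-- A step is the symmetric matrix `I - ∑ⱼ cⱼ dⱼ dⱼᵀ`. Moving its powers across the inner product
makes each functional of the direction a linear functional of the random signs. -/
theorem dotProduct_descend_comm (c : Fin m → 𝕜) (d : Fin m → Fin n → 𝕜) (u v : Fin n → 𝕜) :
    v ⬝ᵥ descend c d u = descend c d v ⬝ᵥ u := by
  rw [dotProduct_comm (descend c d v), dotProduct_sub_descend, dotProduct_sub_descend,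
    dotProduct_comm]
  simp only [mul_right_comm]

theorem dotProduct_descend_iterate (c : Fin m → 𝕜) (d : Fin m → Fin n → 𝕜) (k : ℕ)
    (u v : Fin n → 𝕜) : v ⬝ᵥ (descend c d)^[k] u = (descend c d)^[k] v ⬝ᵥ u := by
  induction k generalizing u v with
  | zero => rfl
  | succ k ih => rw [Function.iterate_succ_apply, ih, Function.iterate_succ_apply',
      dotProduct_descend_comm]

/-- The quadratic form decreases at rate at least `1 / k`, and the norm does not grow. -/
theorem descend_iterate_le (c : Fin m → 𝕜) (d : Fin m → Fin n → 𝕜) (hc : ∀ j, 0 ≤ c j)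
    (hcd : ∀ u, ∑ j, c j * (d j ⬝ᵥ u) ^ 2 ≤ u ⬝ᵥ u) (u : Fin n → 𝕜) (k : ℕ) :
    k * ∑ j, c j * (d j ⬝ᵥ (descend c d)^[k] u) ^ 2 +
      (descend c d)^[k] u ⬝ᵥ (descend c d)^[k] u ≤ u ⬝ᵥ u := by
  induction k with
  | zero => simp
  | succ k ih =>
    rw [Function.iterate_succ_apply']
    set w := (descend c d)^[k] u
    -- With `A = ∑ⱼ cⱼ dⱼ dⱼᵀ` and `Q(u) = ⟨u, A u⟩` one has `z = A w`. Hence `⟨w, z⟩ = Q(w)` and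
    -- `Q(w - z) = Q(w) - 2‖z‖² + Q(z)`, where `Q(z) ≤ ‖z‖²` by `hcd`.
    set z := w - descend c d w with hz
    have hv : ∀ v, v ⬝ᵥ z = ∑ j, c j * (d j ⬝ᵥ w) * (d j ⬝ᵥ v) := by
      intro v
      rw [hz, dotProduct_sub, dotProduct_sub_descend]; ring
    have hw : descend c d w = w - z := by rw [hz]; simp
    clear_value z
    have hQ0 : 0 ≤ ∑ j, c j * (d j ⬝ᵥ (w - z)) ^ 2 :=
      Finset.sum_nonneg fun j _ => mul_nonneg (hc j) (sq_nonneg _)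
    have hQ : ∑ j, c j * (d j ⬝ᵥ (w - z)) ^ 2 =
        ∑ j, c j * (d j ⬝ᵥ w) ^ 2 - 2 * (z ⬝ᵥ z) + ∑ j, c j * (d j ⬝ᵥ z) ^ 2 := by
      rw [hv z, Finset.mul_sum, ← Finset.sum_sub_distrib, ← Finset.sum_add_distrib]
      refine Finset.sum_congr rfl fun j _ => ?_
      rw [dotProduct_sub]; ring
    have hzz := hcd z
    have hz0 : 0 ≤ z ⬝ᵥ z := by
      simp only [dotProduct]; exact Finset.sum_nonneg fun i _ => mul_self_nonneg _
    have hwz : w ⬝ᵥ z = ∑ j, c j * (d j ⬝ᵥ w) ^ 2 := by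
      rw [hv]; exact Finset.sum_congr rfl fun j _ => by ring
    have hn : (w - z) ⬝ᵥ (w - z) = w ⬝ᵥ w - 2 * ∑ j, c j * (d j ⬝ᵥ w) ^ 2 + z ⬝ᵥ z := by
      rw [← hwz, sub_dotProduct, dotProduct_sub, dotProduct_sub, dotProduct_comm z w]; ring
    rw [hw, hn]
    push_cast
    have hk : (0 : 𝕜) ≤ k := Nat.cast_nonneg k
    have h1 : ∑ j, c j * (d j ⬝ᵥ (w - z)) ^ 2 ≤ ∑ j, c j * (d j ⬝ᵥ w) ^ 2 := by linarith
    -- The drop of `Q` by at least `‖z‖²` pays for the `+‖z‖²` in `hn`; of the `-2 Q(w)` there, one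
    -- copy pays for the additional copy of `Q(w - z)`.
    nlinarith [mul_le_mul_of_nonneg_left h1 hk]

theorem dotProduct_sq_le (u v : Fin n → 𝕜) : (u ⬝ᵥ v) ^ 2 ≤ (u ⬝ᵥ u) * (v ⬝ᵥ v) := by
  have := Finset.sum_mul_sq_le_sq_mul_sq Finset.univ u v
  simpa [dotProduct, sq] using this

theorem dotProduct_self_nonneg' (u : Fin n → 𝕜) : 0 ≤ u ⬝ᵥ u :=
  Finset.sum_nonneg fun _ _ => mul_self_nonneg _

theorem sq_le_dotProduct_self (u : Fin n → 𝕜) (i : Fin n) : u i ^ 2 ≤ u ⬝ᵥ u := by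
  rw [sq]
  exact Finset.single_le_sum (f := fun i => u i * u i) (fun _ _ => mul_self_nonneg _)
    (Finset.mem_univ i)

/-! ### A single step -/

theorem free_eq_or (x : Fin n → 𝕜) (i : Fin n) : free x i = 0 ∨ free x i = 1 := by
  unfold free; split_ifs <;> simp

theorem free_mul_dotProduct_le (x u : Fin n → 𝕜) :
    (fun i => free x i * u i) ⬝ᵥ (fun i => free x i * u i) ≤ u ⬝ᵥ u := by
  refine Finset.sum_le_sum fun i _ => ?_
  rcases free_eq_or x i with h | h <;> simp [h, mul_self_nonneg]

theorem free_mul_dotProduct (x u v : Fin n → 𝕜) :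
    (fun i => free x i * u i) ⬝ᵥ v = u ⬝ᵥ fun i => free x i * v i := by
  simp only [dotProduct]
  exact Finset.sum_congr rfl fun i _ => by ring

theorem coef_nonneg (b : Fin m → Fin n → 𝕜) (lam : Fin m → 𝕜) (x : Fin n → 𝕜) (j : Fin m) :
    0 ≤ coef b lam x j := by
  unfold coef
  have := dotProduct_self_nonneg' (b j)
  split_ifs <;> positivity

theorem coef_mul_le (b : Fin m → Fin n → 𝕜) (lam : Fin m → 𝕜) (x : Fin n → 𝕜) (j : Fin m) :
    coef b lam x j * (b j ⬝ᵥ b j) ≤ 1 / (m + 1) := by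
  have h0 := dotProduct_self_nonneg' (b j)
  unfold coef
  split_ifs
  · rcases h0.eq_or_lt with h | h
    · rw [← h]; simp; positivity
    · rw [one_div_mul_eq_div, div_le_div_iff₀ (by positivity) (by positivity)]
      exact le_of_eq (by ring)
  · rw [zero_mul]; positivity

/-- By Cauchy–Schwarz and the factor `1 / (m + 1)` in `coef`, each row contributes at most `‖u‖² /
(m + 1)`. Thus unit gradient steps are admissible without any knowledge of the operator norm. -/
theorem sum_coef_le (b : Fin m → Fin n → 𝕜) (lam : Fin m → 𝕜) (x u : Fin n → 𝕜) :
    ∑ j, coef b lam x j * (freeRows b x j ⬝ᵥ u) ^ 2 ≤ u ⬝ᵥ u := by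
  have hu := dotProduct_self_nonneg' u
  calc ∑ j, coef b lam x j * (freeRows b x j ⬝ᵥ u) ^ 2
      ≤ ∑ _j : Fin m, 1 / (m + 1 : 𝕜) * (u ⬝ᵥ u) := by
        refine Finset.sum_le_sum fun j _ => ?_
        calc _ ≤ coef b lam x j * ((b j ⬝ᵥ b j) * (u ⬝ᵥ u)) := by
              refine mul_le_mul_of_nonneg_left ?_ (coef_nonneg b lam x j)
              exact (dotProduct_sq_le _ _).trans
                (mul_le_mul_of_nonneg_right (free_mul_dotProduct_le x (b j)) hu)
          _ ≤ _ := by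
              rw [← mul_assoc]
              exact mul_le_mul_of_nonneg_right (coef_mul_le b lam x j) hu
    _ = m / (m + 1 : 𝕜) * (u ⬝ᵥ u) := by simp; ring
    _ ≤ u ⬝ᵥ u := mul_le_of_le_one_left hu (div_le_one_of_le₀ (by simp) (by positivity))

/-- The gradient is a combination of rows restricted to the free coordinates, so the iteration never
leaves that coordinate subspace. -/
theorem free_mul_iterate (b : Fin m → Fin n → 𝕜) (lam : Fin m → 𝕜) (x u : Fin n → 𝕜)
    (hu : ∀ i, free x i * u i = u i) (k : ℕ) (i : Fin n) :
    free x i * (descend (coef b lam x) (freeRows b x))^[k] u i =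
      (descend (coef b lam x) (freeRows b x))^[k] u i := by
  induction k with
  | zero => exact hu i
  | succ k ih =>
    rw [Function.iterate_succ_apply']
    simp only [descend, freeRows, mul_sub, ih]
    rcases free_eq_or x i with h | h <;> simp [h]

theorem free_mul_direction (b : Fin m → Fin n → 𝕜) (lam : Fin m → 𝕜) (x r : Fin n → 𝕜)
    (i : Fin n) : free x i * direction b lam x r i = direction b lam x r i := by
  refine free_mul_iterate b lam x _ (fun i => ?_) _ i
  rcases free_eq_or x i with h | h <;> simp [h]

theorem iterate_dotProduct_self_le (b : Fin m → Fin n → 𝕜) (lam : Fin m → 𝕜)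
    (x u : Fin n → 𝕜) (k : ℕ) :
    (descend (coef b lam x) (freeRows b x))^[k] u ⬝ᵥ
      (descend (coef b lam x) (freeRows b x))^[k] u ≤ u ⬝ᵥ u := by
  have h := descend_iterate_le _ _ (coef_nonneg b lam x) (sum_coef_le b lam x) u k
  have : 0 ≤ (k : 𝕜) * ∑ j, coef b lam x j *
      (freeRows b x j ⬝ᵥ (descend (coef b lam x) (freeRows b x))^[k] u) ^ 2 :=
    mul_nonneg (Nat.cast_nonneg k)
      (Finset.sum_nonneg fun j _ => mul_nonneg (coef_nonneg b lam x j) (sq_nonneg _))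
  linarith

theorem sign_dotProduct_self {r : Fin n → 𝕜} (hr : ∀ i, r i ^ 2 = 1) : r ⬝ᵥ r = n := by
  simp only [dotProduct, ← sq, hr]; simp

theorem direction_dotProduct_self_le (b : Fin m → Fin n → 𝕜) (lam : Fin m → 𝕜)
    (x : Fin n → 𝕜) {r : Fin n → 𝕜} (hr : ∀ i, r i ^ 2 = 1) :
    direction b lam x r ⬝ᵥ direction b lam x r ≤ n :=
  (iterate_dotProduct_self_le b lam x _ _).trans
    ((free_mul_dotProduct_le x r).trans (sign_dotProduct_self hr).le)

theorem dotProduct_direction_sq_le (b : Fin m → Fin n → 𝕜) (lam : Fin m → 𝕜)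
    (x : Fin n → 𝕜) {r : Fin n → 𝕜} (hr : ∀ i, r i ^ 2 = 1) (j : Fin m) :
    (b j ⬝ᵥ direction b lam x r) ^ 2 ≤ (b j ⬝ᵥ b j) * n :=
  (dotProduct_sq_le _ _).trans (mul_le_mul_of_nonneg_left
    (direction_dotProduct_self_le b lam x hr) (dotProduct_self_nonneg' _))

/-- The walk hardly moves along the tight rows. -/
theorem dotProduct_direction_sq_le_of_tight (hn : 0 < n) (b : Fin m → Fin n → 𝕜)
    (lam : Fin m → 𝕜) (x : Fin n → 𝕜) {r : Fin n → 𝕜} (hr : ∀ i, r i ^ 2 = 1) (j : Fin m)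
    (hj : lam j ^ 2 * (b j ⬝ᵥ b j) < (b j ⬝ᵥ x) ^ 2) :
    (b j ⬝ᵥ direction b lam x r) ^ 2 ≤ (b j ⬝ᵥ b j) / (n : 𝕜) ^ 16 := by
  have hn' : (0 : 𝕜) < n := by exact_mod_cast hn
  -- A zero row is never tight.
  have hb0 : 0 < b j ⬝ᵥ b j := by
    refine (dotProduct_self_nonneg' (b j)).lt_of_ne fun h => ?_
    have := dotProduct_sq_le (b j) x
    rw [← h] at this hj
    simp only [mul_zero, zero_mul] at this hj
    linarith
  have hdot : b j ⬝ᵥ direction b lam x r = freeRows b x j ⬝ᵥ direction b lam x r := by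
    unfold freeRows
    rw [free_mul_dotProduct]
    congr 1
    ext i
    rw [free_mul_direction]
  have h := descend_iterate_le _ _ (coef_nonneg b lam x) (sum_coef_le b lam x)
    (fun i => free x i * r i) ((m + 1) * n ^ 17)
  change _ * ∑ j, coef b lam x j * (freeRows b x j ⬝ᵥ direction b lam x r) ^ 2 +
    direction b lam x r ⬝ᵥ direction b lam x r ≤ _ at h
  have h1 := dotProduct_self_nonneg' (direction b lam x r)
  have h2 := (free_mul_dotProduct_le x r).trans (sign_dotProduct_self hr).le
  have h3 : coef b lam x j * (b j ⬝ᵥ direction b lam x r) ^ 2 ≤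
      ∑ j, coef b lam x j * (freeRows b x j ⬝ᵥ direction b lam x r) ^ 2 := by
    rw [hdot]
    exact Finset.single_le_sum (f := fun j => coef b lam x j *
      (freeRows b x j ⬝ᵥ direction b lam x r) ^ 2)
      (fun j _ => mul_nonneg (coef_nonneg b lam x j) (sq_nonneg _)) (Finset.mem_univ j)
  -- One term of the form is kept. The factor `m + 1` of the number of iterations cancels the one in
  -- `coef`, and `‖r‖² = n` uses up one of the 17 powers of `n`.
  have h4 : ((m + 1) * n ^ 17 : 𝕜) * (coef b lam x j * (b j ⬝ᵥ direction b lam x r) ^ 2) ≤ n := by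
    have := mul_le_mul_of_nonneg_left h3 (by positivity : (0 : 𝕜) ≤ (m + 1) * n ^ 17)
    push_cast at h
    linarith
  have h5 : coef b lam x j = 1 / ((m + 1) * (b j ⬝ᵥ b j)) := by simp [coef, hj]
  rw [h5] at h4
  rw [le_div_iff₀ (by positivity)]
  have h6 : ((m + 1) * n ^ 17 : 𝕜) * (1 / ((m + 1) * (b j ⬝ᵥ b j)) *
      (b j ⬝ᵥ direction b lam x r) ^ 2) =
      (b j ⬝ᵥ direction b lam x r) ^ 2 * n ^ 16 / (b j ⬝ᵥ b j) * n := by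
    field_simp
  rw [h6] at h4
  have h7 : (b j ⬝ᵥ direction b lam x r) ^ 2 * n ^ 16 / (b j ⬝ᵥ b j) ≤ 1 := by
    by_contra! hcon
    nlinarith
  rwa [div_le_one hb0] at h7

theorem abs_direction_le (b : Fin m → Fin n → 𝕜) (lam : Fin m → 𝕜)
    (x : Fin n → 𝕜) {r : Fin n → 𝕜} (hr : ∀ i, r i ^ 2 = 1) (i : Fin n) :
    |direction b lam x r i| ≤ n := by
  have hn : (1 : 𝕜) ≤ n := by exact_mod_cast i.pos
  refine abs_le_of_sq_le_sq ?_ (by positivity)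
  have := (sq_le_dotProduct_self _ i).trans (direction_dotProduct_self_le b lam x hr)
  nlinarith

theorem walkStep_apply_of_not_free (b : Fin m → Fin n → 𝕜) (lam : Fin m → 𝕜)
    (x r : Fin n → 𝕜) {i : Fin n} (hi : free x i = 0) : walkStep b lam x r i = x i := by
  have := free_mul_direction b lam x r i
  rw [hi, zero_mul] at this
  simp [walkStep, ← this]

/-- A free coordinate is at distance at least `1/n^4` from ±1 and moves by at most `n · n^(-5)`.
Hence the walk stays in the cube without truncation. -/
theorem abs_walkStep_le (b : Fin m → Fin n → 𝕜) (lam : Fin m → 𝕜) {x r : Fin n → 𝕜}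
    (hx : ∀ i, |x i| ≤ 1) (hr : ∀ i, r i ^ 2 = 1) (i : Fin n) : |walkStep b lam x r i| ≤ 1 := by
  have hn : (0 : 𝕜) < n := by exact_mod_cast i.pos
  by_cases hi : |x i| ≤ 1 - 1 / (n : 𝕜) ^ 4
  · have h := abs_direction_le b lam x hr i
    have h1 : |1 / (n : 𝕜) ^ 5 * direction b lam x r i| ≤ 1 / (n : 𝕜) ^ 4 := by
      rw [abs_mul, abs_of_nonneg (by positivity)]
      calc _ ≤ 1 / (n : 𝕜) ^ 5 * n := mul_le_mul_of_nonneg_left h (by positivity)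
        _ = _ := by field_simp
    have := abs_add_le (x i) (1 / (n : 𝕜) ^ 5 * direction b lam x r i)
    unfold walkStep
    linarith
  · rw [walkStep_apply_of_not_free b lam x r (if_neg hi)]
    exact hx i

theorem bitSign_sq (t : Bool) : (bitSign t : 𝕜) ^ 2 = 1 := by cases t <;> simp [bitSign]

theorem abs_walk_le (b : Fin m → Fin n → 𝕜) (lam : Fin m → 𝕜) (ω : ℕ → Bool) (s : ℕ)
    (i : Fin n) : |walk b lam ω s i| ≤ 1 := by
  induction s generalizing i with
  | zero => simp [walk]
  | succ s ih => exact abs_walkStep_le b lam ih (fun _ => bitSign_sq _) i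

end Walk

/-! ### Errors -/

section Real

variable {n m : ℕ}

/-- In units of `‖bⱼ‖`: a row that is not tight is within `λⱼ`, and one step changes it by at most
`n / n^5 = 1/n^4`, the overshoot. A tight row drifts by at most `n^(-5) · n^(-8)` per step. The
bound survives both kinds of steps, even if a row becomes tight repeatedly. -/
theorem abs_dotProduct_walk_le (hn : 0 < n) (b : Fin m → Fin n → ℝ) (lam : Fin m → ℝ)
    (hlam : ∀ j, 0 ≤ lam j) (ω : ℕ → Bool) (s : ℕ) (j : Fin m) :
    |b j ⬝ᵥ walk b lam ω s| ≤ √(b j ⬝ᵥ b j) * (lam j + 1 / n ^ 4 + s / n ^ 13) := by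
  have hn' : (1 : ℝ) ≤ n := by exact_mod_cast hn
  have hb := dotProduct_self_nonneg' (b j)
  induction s with
  | zero =>
    have := hlam j
    simp only [walk, dotProduct_zero, abs_zero]
    positivity
  | succ s ih =>
    set x := walk b lam ω s with hx
    set r : Fin n → ℝ := fun i => bitSign (ω (s * n + i))
    have hr : ∀ i, r i ^ 2 = 1 := fun i => bitSign_sq _
    have hstep : b j ⬝ᵥ walk b lam ω (s + 1) =
        b j ⬝ᵥ x + 1 / n ^ 5 * (b j ⬝ᵥ direction b lam x r) := by
      have : walk b lam ω (s + 1) = x + (1 / n ^ 5 : ℝ) • direction b lam x r := by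
        ext i; rfl
      rw [this, dotProduct_add, dotProduct_smul, smul_eq_mul]
    rw [hstep]
    refine (abs_add_le _ _).trans ?_
    rw [abs_mul, abs_of_nonneg (by positivity : (0 : ℝ) ≤ 1 / n ^ 5)]
    by_cases hj : lam j ^ 2 * (b j ⬝ᵥ b j) < (b j ⬝ᵥ x) ^ 2
    · have h := Real.abs_le_sqrt (dotProduct_direction_sq_le_of_tight hn b lam x hr j hj)
      rw [Real.sqrt_div hb, show (n : ℝ) ^ 16 = (n ^ 8) ^ 2 by ring,
        Real.sqrt_sq (by positivity)] at h
      calc _ ≤ √(b j ⬝ᵥ b j) * (lam j + 1 / n ^ 4 + s / n ^ 13) +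
            1 / n ^ 5 * (√(b j ⬝ᵥ b j) / n ^ 8) := by gcongr
        _ = _ := by push_cast; field_simp; ring
    · have h := Real.abs_le_sqrt (dotProduct_direction_sq_le b lam x hr j)
      have h1 : |b j ⬝ᵥ x| ≤ √(b j ⬝ᵥ b j) * lam j := by
        refine (Real.abs_le_sqrt (not_lt.mp hj)).trans (le_of_eq ?_)
        rw [Real.sqrt_mul (sq_nonneg _), Real.sqrt_sq (hlam j), mul_comm]
      have h2 : √((b j ⬝ᵥ b j) * n) ≤ √(b j ⬝ᵥ b j) * n := by
        rw [Real.sqrt_mul hb]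
        gcongr
        rw [Real.sqrt_le_left (by positivity)]
        nlinarith
      calc _ ≤ √(b j ⬝ᵥ b j) * lam j + 1 / n ^ 5 * (√(b j ⬝ᵥ b j) * n) := by
            gcongr; exact h.trans h2
        _ = √(b j ⬝ᵥ b j) * (lam j + 1 / n ^ 4 + 0) := by field_simp; ring
        _ ≤ _ := by gcongr; positivity

/-! ### Rounding the end point of the walk -/

theorem abs_offset_eq {y : ℝ} (hy : y ∈ Set.Icc (0 : ℝ) 1) : |offset y| = min y (1 - y) := by
  obtain ⟨h0, h1⟩ := hy
  unfold offset
  split_ifs with h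
  · rw [abs_of_nonneg h0, min_eq_left (by linarith)]
  · rw [abs_of_nonpos (by linarith), min_eq_right (by linarith)]; ring

theorem scaled_dotProduct_self {y : Fin n → ℝ} (hy : ∀ i, y i ∈ Set.Icc (0 : ℝ) 1)
    (a : Fin m → Fin n → ℝ) (j : Fin m) : scaled y a j ⬝ᵥ scaled y a j = W (a j) y := by
  simp only [dotProduct, W, scaled]
  refine Finset.sum_congr rfl fun i _ => ?_
  rw [← abs_offset_eq (hy i), sq_abs]; ring

/-- The minimum is at most `1/2`; this factor absorbs the constant 2 in the final error bound. -/
theorem sqrt_W_le {y : Fin n → ℝ} (hy : ∀ i, y i ∈ Set.Icc (0 : ℝ) 1) (a : Fin n → ℝ) :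
    √(W a y) ≤ 1 / 2 * ‖WithLp.toLp 2 a‖ := by
  rw [EuclideanSpace.norm_eq, Real.sqrt_le_left (by positivity), mul_pow,
    Real.sq_sqrt (by positivity), Finset.mul_sum]
  refine Finset.sum_le_sum fun i _ => ?_
  have h := hy i
  have h2 : min (y i) (1 - y i) ^ 2 ≤ (1 / 2) ^ 2 := by
    refine pow_le_pow_left₀ (le_min h.1 (by linarith [h.2])) ?_ 2
    rcases le_total (y i) (1 / 2) with h' | h'
    · exact (min_le_left _ _).trans h'
    · exact (min_le_right _ _).trans (by linarith)
  simp only [Real.norm_eq_abs, sq_abs]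
  nlinarith [sq_nonneg (a i)]

theorem abs_snap_le {x : Fin n → ℝ} (hx : ∀ i, |x i| ≤ 1) (i : Fin n) : |snap x i| ≤ 1 := by
  unfold snap
  rcases free_eq_or x i with h | h <;> rw [h]
  · split_ifs <;> simp
  · simpa using hx i

theorem abs_snap_sub_le {x : Fin n → ℝ} (hx : ∀ i, |x i| ≤ 1) (i : Fin n) :
    |snap x i - x i| ≤ 1 / n ^ 4 := by
  have hxi := abs_le.mp (hx i)
  unfold snap free
  by_cases h : |x i| ≤ 1 - 1 / (n : ℝ) ^ 4
  · rw [if_pos h]; simp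
  · rw [not_le] at h
    simp only [not_le.mpr h, if_false]
    split_ifs with h0
    · rw [abs_of_nonneg h0] at h
      rw [abs_of_nonneg (by linarith)]
      linarith
    · rw [abs_of_neg (not_le.mp h0)] at h
      rw [abs_of_nonpos (by linarith)]
      linarith

theorem orientation_eq_or (x : Fin n → ℝ) : orientation x = 1 ∨ orientation x = -1 := by
  unfold orientation; split_ifs <;> simp

theorem roundedPoint_mem {y x : Fin n → ℝ} (hy : ∀ i, y i ∈ Set.Icc (0 : ℝ) 1)
    (hx : ∀ i, |x i| ≤ 1) (i : Fin n) : roundedPoint y x i ∈ Set.Icc (0 : ℝ) 1 := by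
  have h1 : |orientation x * offset (y i) * snap x i| ≤ min (y i) (1 - y i) := by
    rw [← abs_offset_eq (hy i), abs_mul, abs_mul]
    have h2 : |orientation x| = 1 := by rcases orientation_eq_or x with h | h <;> simp [h]
    rw [h2, one_mul]
    exact mul_le_of_le_one_right (abs_nonneg _) (abs_snap_le hx i)
  have h2 := abs_le.mp (h1.trans (min_le_left _ _))
  have h3 := abs_le.mp (h1.trans (min_le_right _ _))
  unfold roundedPoint
  constructor <;> linarith [h2.2, h3.1]

/-- Moving by the full offset in the right orientation hits the nearest integer. In the opposite
orientation the coordinate would go to `y + offset y`, usually not an integer, which is why a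
majority sign is needed. -/
theorem roundedPoint_integral (y x : Fin n → ℝ) {i : Fin n} (h : snap x i = orientation x) :
    roundedPoint y x i = 0 ∨ roundedPoint y x i = 1 := by
  have h2 : orientation x * orientation x = 1 := by
    rcases orientation_eq_or x with h | h <;> simp [h]
  have : roundedPoint y x i = y i - offset (y i) := by
    unfold roundedPoint
    rw [h, mul_right_comm, h2, one_mul]
  rw [this]
  unfold offset
  split_ifs <;> simp

/-- At least half of the coordinates that do not move any more become integral. -/
theorem sum_not_free_le (y x : Fin n → ℝ) :
    ∑ i, (1 - free x i) ≤
      2 * Nat.card {i : Fin n // roundedPoint y x i = 0 ∨ roundedPoint y x i = 1} := by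
  classical
  -- The factor `1 + σ · sign` is 2 on frozen coordinates of the majority sign and 0 on the other
  -- frozen ones; the majority property makes the `σ · sign` terms sum to something nonnegative.
  have h : ∀ i, (1 - free x i) * (1 + orientation x * (if 0 ≤ x i then 1 else -1)) ≤
      2 * if roundedPoint y x i = 0 ∨ roundedPoint y x i = 1 then 1 else 0 := by
    intro i
    rcases free_eq_or x i with hf | hf
    · by_cases hs : snap x i = orientation x
      · rw [if_pos (roundedPoint_integral y x hs), hf]
        rcases orientation_eq_or x with ho | ho <;> rw [ho] <;> split_ifs <;> norm_num
      · have : orientation x * (if 0 ≤ x i then 1 else -1) = -1 := by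
          have hsn : snap x i = if 0 ≤ x i then 1 else -1 := by simp [snap, hf]
          rw [hsn] at hs
          rcases orientation_eq_or x with ho | ho <;> rw [ho] at hs ⊢ <;>
            split_ifs at hs ⊢ <;> simp at hs ⊢
        rw [this]
        split_ifs <;> simp
    · rw [hf]; split_ifs <;> simp
  have hsum := Finset.sum_le_sum fun i (_ : i ∈ Finset.univ) => h i
  rw [← Finset.mul_sum, Finset.sum_boole] at hsum
  have hcard : Nat.card {i : Fin n // roundedPoint y x i = 0 ∨ roundedPoint y x i = 1} =
      (Finset.univ.filter fun i => roundedPoint y x i = 0 ∨ roundedPoint y x i = 1).card := by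
    rw [Nat.card_eq_fintype_card, Fintype.card_subtype]
  rw [hcard]
  refine le_trans ?_ hsum
  have hexp : ∑ i, (1 - free x i) * (1 + orientation x * (if 0 ≤ x i then 1 else -1)) =
      ∑ i, (1 - free x i) +
        orientation x * ∑ i, (1 - free x i) * (if 0 ≤ x i then 1 else -1) := by
    rw [Finset.mul_sum, ← Finset.sum_add_distrib]
    exact Finset.sum_congr rfl fun i _ => by ring
  rw [hexp]
  have : 0 ≤ orientation x * ∑ i, (1 - free x i) * (if 0 ≤ x i then (1 : ℝ) else -1) := by
    unfold orientation
    split_ifs with h0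
    · simpa using h0
    · linarith
  linarith

/-- Relative to `‖bⱼ‖ = √W_j` the excess over `λⱼ` is `1/n^4` from overshooting, `4 n^10 / n^13`
from drift and at most `1/n^3` from snapping. The total `(1 + 5n)/n^4` is at most `2/n^2`, and `√W_j
≤ ‖aⱼ‖/2`. Of the `n/4` frozen coordinates half become integral, whence the constant `1/8`. -/
theorem isPartialRounding_roundedPoint (hn : 4 ≤ n) {y : Fin n → ℝ} {a : Fin m → Fin n → ℝ}
    {lam : Fin m → ℝ} (hy : ∀ i, y i ∈ Set.Icc (0 : ℝ) 1) (hlam : ∀ j, 0 ≤ lam j)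
    (ω : ℕ → Bool)
    (hcard : (n : ℝ) / 4 ≤ ∑ i, (1 - free (walk (scaled y a) lam ω (4 * n ^ 10)) i)) :
    IsPartialRounding (1 / 8) y a lam
      (roundedPoint y (walk (scaled y a) lam ω (4 * n ^ 10))) := by
  set x := walk (scaled y a) lam ω (4 * n ^ 10) with hx
  have hx1 : ∀ i, |x i| ≤ 1 := abs_walk_le _ _ _ _
  refine ⟨roundedPoint_mem hy hx1, fun j => ?_, ?_⟩
  · have hn' : (4 : ℝ) ≤ n := by exact_mod_cast hn
    set b := scaled y a j with hb
    have hdot : (roundedPoint y x - y) ⬝ᵥ a j =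
        -(orientation x * (b ⬝ᵥ x + b ⬝ᵥ (snap x - x))) := by
      rw [dotProduct_sub]
      simp only [dotProduct, roundedPoint, Pi.sub_apply, hb, scaled]
      rw [add_sub_cancel, Finset.mul_sum, ← Finset.sum_neg_distrib]
      exact Finset.sum_congr rfl fun i _ => by ring
    have h1 : |b ⬝ᵥ x| ≤ √(b ⬝ᵥ b) * (lam j + 1 / n ^ 4 + (4 * n ^ 10 : ℕ) / n ^ 13) :=
      abs_dotProduct_walk_le (show 0 < n by omega) (scaled y a) lam hlam ω (4 * n ^ 10) j
    have h2 : |b ⬝ᵥ (snap x - x)| ≤ √(b ⬝ᵥ b) * (1 / n ^ 3) := by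
      have h3 : (snap x - x) ⬝ᵥ (snap x - x) ≤ (1 / n ^ 3) ^ 2 := by
        calc _ ≤ ∑ _i : Fin n, (1 / (n : ℝ) ^ 4) ^ 2 := by
              refine Finset.sum_le_sum fun i _ => ?_
              rw [← sq]
              exact sq_le_sq' (neg_le_of_abs_le (abs_snap_sub_le hx1 i))
                (le_of_abs_le (abs_snap_sub_le hx1 i))
          _ = n * (1 / (n : ℝ) ^ 4) ^ 2 := by simp
          _ ≤ _ := by
              rw [div_pow, div_pow, one_pow, mul_one_div, div_le_div_iff₀ (by positivity)
                (by positivity)]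
              have : (0 : ℝ) ≤ n ^ 7 := by positivity
              nlinarith
      refine (Real.abs_le_sqrt ((dotProduct_sq_le _ _).trans (mul_le_mul_of_nonneg_left h3
        (dotProduct_self_nonneg' _)))).trans (le_of_eq ?_)
      rw [Real.sqrt_mul (dotProduct_self_nonneg' _), Real.sqrt_sq (by positivity)]
    have hor : |orientation x| = 1 := by rcases orientation_eq_or x with h | h <;> simp [h]
    rw [hdot, abs_neg, abs_mul, hor, one_mul]
    have hW : b ⬝ᵥ b = W (a j) y := scaled_dotProduct_self hy a j
    have hle := sqrt_W_le hy (a j)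
    rw [hW] at h1 h2
    set w := √(W (a j) y)
    have hw : 0 ≤ w := Real.sqrt_nonneg _
    calc |b ⬝ᵥ x + b ⬝ᵥ (snap x - x)|
        ≤ w * (lam j + 1 / n ^ 4 + (4 * n ^ 10 : ℕ) / n ^ 13) + w * (1 / n ^ 3) :=
          (abs_add_le _ _).trans (add_le_add h1 h2)
      _ = lam j * w + w * ((1 + 5 * n) / n ^ 4) := by push_cast; field_simp; ring
      _ ≤ lam j * w + (1 / 2 * ‖WithLp.toLp 2 (a j)‖) * (2 / n ^ 2) := by
          have key : (1 + 5 * n) / (n : ℝ) ^ 4 ≤ 2 / n ^ 2 := by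
            rw [div_le_div_iff₀ (by positivity) (by positivity)]
            have h3 : 1 + 5 * (n : ℝ) ≤ 2 * n ^ 2 := by nlinarith
            calc _ ≤ 2 * (n : ℝ) ^ 2 * n ^ 2 := mul_le_mul_of_nonneg_right h3 (by positivity)
              _ = _ := by ring
          exact add_le_add le_rfl (mul_le_mul hle key (by positivity) (by positivity))
      _ = _ := by ring
  · have := sum_not_free_le y x
    linarith

end Real

/-! ## Averages over random bits -/

/-- The bit sequence that continues `r` by `false`. -/
def extendBits (N : ℕ) (r : Fin N → Bool) : ℕ → Bool :=
  fun k => if h : k < N then r ⟨k, h⟩ else false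

/-- The mean of `f` over `N` independent fair bits. -/
noncomputable def mean (N : ℕ) (f : (ℕ → Bool) → ℝ) : ℝ :=
  (∑ r : Fin N → Bool, f (extendBits N r)) / 2 ^ N

theorem mean_mono {N : ℕ} {f g : (ℕ → Bool) → ℝ} (h : ∀ ω, f ω ≤ g ω) : mean N f ≤ mean N g :=
  div_le_div_of_nonneg_right (Finset.sum_le_sum fun _ _ => h _) (by positivity)

theorem mean_add (N : ℕ) (f g : (ℕ → Bool) → ℝ) :
    mean N (fun ω => f ω + g ω) = mean N f + mean N g := by
  simp [mean, Finset.sum_add_distrib, add_div]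

theorem mean_mul_left (N : ℕ) (c : ℝ) (f : (ℕ → Bool) → ℝ) :
    mean N (fun ω => c * f ω) = c * mean N f := by
  simp [mean, ← Finset.mul_sum, mul_div_assoc]

theorem mean_const (N : ℕ) (c : ℝ) : mean N (fun _ => c) = c := by
  simp [mean]

theorem mean_sum {ι : Type*} (s : Finset ι) (N : ℕ) (f : ι → (ℕ → Bool) → ℝ) :
    mean N (fun ω => ∑ i ∈ s, f i ω) = ∑ i ∈ s, mean N (f i) := by
  simp only [mean]
  rw [Finset.sum_comm, Finset.sum_div]

open Classical in
theorem coinProb_eq_mean (N : ℕ) (A : (ℕ → Bool) → Prop) :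
    coinProb N A = mean N (fun ω => if A ω then 1 else 0) := by
  unfold coinProb mean
  congr 1
  rw [Finset.sum_boole, Nat.card_eq_fintype_card, Fintype.card_subtype]
  rfl

/-- A block of bits that is independent of `F` can be replaced by independent bits. -/
theorem mean_block {N n s : ℕ} (hN : (s + 1) * n ≤ N) (F : (ℕ → Bool) → (Fin n → Bool) → ℝ)
    (hF : ∀ ω ω', (∀ k < s * n, ω k = ω' k) → F ω = F ω') :
    mean N (fun ω => F ω (fun i => ω (s * n + i))) =
      mean N (fun ω => (∑ ρ : Fin n → Bool, F ω ρ) / 2 ^ n) := by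
  have hsn : s * n + n ≤ N := by rw [← Nat.succ_mul]; exact hN
  -- Adding `ρ` modulo 2 to the block is a bijection of the bit sequences that leaves the past
  -- alone; averaging over all `ρ` resamples the block.
  let T : (Fin n → Bool) → (Fin N → Bool) → (Fin N → Bool) := fun ρ r k =>
    xor (r k) (if h : s * n ≤ k ∧ (k : ℕ) - s * n < n then ρ ⟨k - s * n, h.2⟩ else false)
  have hT : ∀ ρ, Function.Involutive (T ρ) := by
    intro ρ r
    ext k
    simp [T]
  have hlow : ∀ ρ r, F (extendBits N (T ρ r)) = F (extendBits N r) := by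
    intro ρ r
    refine hF _ _ fun k hk => ?_
    have h1 : k < N := by omega
    simp [extendBits, h1, T, show ¬ s * n ≤ k by omega]
  have hblock : ∀ ρ r, (fun i : Fin n => extendBits N (T ρ r) (s * n + i)) =
      fun i : Fin n => xor (extendBits N r (s * n + i)) (ρ i) := by
    intro ρ r
    ext i
    have h1 : s * n + i < N := by omega
    simp [extendBits, h1, T]
  have key : (2 : ℝ) ^ n * ∑ r : Fin N → Bool,
      F (extendBits N r) (fun i => extendBits N r (s * n + i)) =
      ∑ r : Fin N → Bool, ∑ ρ : Fin n → Bool, F (extendBits N r) ρ := by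
    calc _ = ∑ _ρ : Fin n → Bool, ∑ r : Fin N → Bool,
          F (extendBits N r) (fun i => extendBits N r (s * n + i)) := by simp
      _ = ∑ ρ : Fin n → Bool, ∑ r : Fin N → Bool,
          F (extendBits N r) (fun i => xor (extendBits N r (s * n + i)) (ρ i)) := by
          refine Finset.sum_congr rfl fun ρ _ => ?_
          rw [← Equiv.sum_comp (hT ρ).toPerm]
          refine Finset.sum_congr rfl fun r _ => ?_
          simp only [Function.Involutive.coe_toPerm]
          rw [hlow, hblock]
      _ = _ := by
          rw [Finset.sum_comm]
          refine Finset.sum_congr rfl fun r _ => ?_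
          have hx : Function.Involutive (fun (ρ : Fin n → Bool) (i : Fin n) =>
              xor (extendBits N r (s * n + i)) (ρ i)) := by
            intro ρ; ext i; simp
          exact Equiv.sum_comp hx.toPerm (fun ρ => F (extendBits N r) ρ)
  unfold mean
  congr 1
  rw [← Finset.sum_div, ← key]
  field_simp

/-! ## Sums of random signs -/

/-- The shift `a` makes the induction work: the first sign is absorbed into it. -/
theorem sum_add_sign_sq (n : ℕ) : ∀ (a : ℝ) (w : Fin n → ℝ),
    ∑ ρ : Fin n → Bool, (a + w ⬝ᵥ fun i => bitSign (ρ i)) ^ 2 = 2 ^ n * (a ^ 2 + w ⬝ᵥ w) := by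
  induction n with
  | zero => intro a w; simp
  | succ n ih =>
    intro a w
    rw [← (Fin.consEquiv fun _ => Bool).sum_comp, Fintype.sum_prod_type]
    have h : ∀ (t : Bool) (ρ : Fin n → Bool),
        a + w ⬝ᵥ (fun i => bitSign ((Fin.consEquiv fun _ => Bool) (t, ρ) i)) =
        (a + w 0 * bitSign t) + (fun i => w i.succ) ⬝ᵥ fun i => bitSign (ρ i) := by
      intro t ρ
      simp [dotProduct, Fin.sum_univ_succ, Fin.consEquiv, add_assoc]
    simp only [h, ih]
    simp [dotProduct, Fin.sum_univ_succ, bitSign]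
    ring

theorem sum_sign_sq {n : ℕ} (w : Fin n → ℝ) :
    ∑ ρ : Fin n → Bool, (w ⬝ᵥ fun i => bitSign (ρ i)) ^ 2 = 2 ^ n * (w ⬝ᵥ w) := by
  simpa using sum_add_sign_sq n 0 w

/-- Comparing the second moments of `1 + ⟨w, r⟩` and of `⟨w, r⟩` isolates the first moment. -/
theorem sum_sign {n : ℕ} (w : Fin n → ℝ) :
    ∑ ρ : Fin n → Bool, (w ⬝ᵥ fun i => bitSign (ρ i)) = 0 := by
  have h1 := sum_add_sign_sq n 1 w
  have h2 := sum_sign_sq w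
  simp only [add_sq, Finset.sum_add_distrib, ← Finset.mul_sum] at h1
  simp at h1
  linarith

/-- Independence factors the exponential moment, and `cosh t ≤ exp (t² / 2)` bounds each factor. -/
theorem sum_exp_sign_le {n : ℕ} (w : Fin n → ℝ) :
    ∑ ρ : Fin n → Bool, Real.exp (w ⬝ᵥ fun i => bitSign (ρ i)) ≤
      2 ^ n * Real.exp (w ⬝ᵥ w / 2) := by
  have h : ∑ ρ : Fin n → Bool, Real.exp (w ⬝ᵥ fun i => bitSign (ρ i)) =
      ∏ i, ∑ t : Bool, Real.exp (w i * bitSign t) := by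
    rw [Finset.prod_univ_sum, Fintype.piFinset_univ]
    exact Finset.sum_congr rfl fun ρ _ => by rw [dotProduct, Real.exp_sum]
  rw [h]
  calc _ ≤ ∏ i, 2 * Real.exp (w i ^ 2 / 2) := by
        refine Finset.prod_le_prod (fun i _ => by positivity) fun i _ => ?_
        have := Real.cosh_le_exp_half_sq (w i)
        rw [Real.cosh_eq] at this
        simp [bitSign]
        linarith
    _ = _ := by
        rw [Finset.prod_mul_distrib, ← Real.exp_sum]
        simp [dotProduct, Finset.sum_div, sq]

/-! ## One step of the walk on average -/

section

variable {n m : ℕ}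

/-- By self-adjointness `w` is the image of `v` under the adjoint of the approximate projection, and
contraction bounds its norm. So a functional of the direction is a Rademacher sum no larger than
that of the unprojected signs. -/
theorem dotProduct_direction (b : Fin m → Fin n → ℝ) (lam : Fin m → ℝ) (x v : Fin n → ℝ) :
    ∃ w : Fin n → ℝ, w ⬝ᵥ w ≤ v ⬝ᵥ v ∧ ∀ r, v ⬝ᵥ direction b lam x r = w ⬝ᵥ r := by
  refine ⟨fun i => free x i *
    (descend (coef b lam x) (freeRows b x))^[(m + 1) * n ^ 17] v i, ?_, fun r => ?_⟩
  · exact (free_mul_dotProduct_le x _).trans (iterate_dotProduct_self_le b lam x v _)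
  · rw [free_mul_dotProduct]
    exact dotProduct_descend_iterate _ _ _ _ _

theorem dotProduct_walkStep (b : Fin m → Fin n → ℝ) (lam : Fin m → ℝ) (x v r : Fin n → ℝ) :
    v ⬝ᵥ walkStep b lam x r = v ⬝ᵥ x + 1 / (n : ℝ) ^ 5 * (v ⬝ᵥ direction b lam x r) := by
  have : walkStep b lam x r = x + (1 / (n : ℝ) ^ 5) • direction b lam x r := rfl
  rw [this, dotProduct_add, dotProduct_smul, smul_eq_mul]

theorem sum_exp_walkStep_le (b : Fin m → Fin n → ℝ) (lam : Fin m → ℝ) (x v : Fin n → ℝ) :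
    (∑ ρ : Fin n → Bool, Real.exp (v ⬝ᵥ walkStep b lam x fun i => bitSign (ρ i))) / 2 ^ n ≤
      Real.exp (v ⬝ᵥ v / 2 / (n : ℝ) ^ 10) * Real.exp (v ⬝ᵥ x) := by
  obtain ⟨w, hw, hwv⟩ := dotProduct_direction b lam x v
  rw [div_le_iff₀ (by positivity)]
  calc _ = ∑ ρ : Fin n → Bool, Real.exp (v ⬝ᵥ x) *
        Real.exp (((1 / (n : ℝ) ^ 5) • w) ⬝ᵥ fun i => bitSign (ρ i)) := by
        refine Finset.sum_congr rfl fun ρ _ => ?_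
        rw [dotProduct_walkStep, hwv, Real.exp_add, smul_dotProduct, smul_eq_mul]
    _ ≤ Real.exp (v ⬝ᵥ x) *
        (2 ^ n * Real.exp (((1 / (n : ℝ) ^ 5) • w) ⬝ᵥ ((1 / (n : ℝ) ^ 5) • w) / 2)) := by
        rw [← Finset.mul_sum]
        exact mul_le_mul_of_nonneg_left (sum_exp_sign_le _) (Real.exp_nonneg _)
    _ ≤ Real.exp (v ⬝ᵥ x) * (2 ^ n * Real.exp (v ⬝ᵥ v / 2 / (n : ℝ) ^ 10)) := by
        have h : ((1 / (n : ℝ) ^ 5) • w) ⬝ᵥ ((1 / (n : ℝ) ^ 5) • w) / 2 ≤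
            v ⬝ᵥ v / 2 / (n : ℝ) ^ 10 := by
          rw [smul_dotProduct, dotProduct_smul, smul_eq_mul, smul_eq_mul]
          calc _ = w ⬝ᵥ w / 2 / (n : ℝ) ^ 10 := by ring
            _ ≤ _ := by gcongr
        have := Real.exp_le_exp.mpr h
        gcongr
    _ = _ := by ring

/-- The number of tight rows. -/
noncomputable def tightCount (b : Fin m → Fin n → ℝ) (lam : Fin m → ℝ) (x : Fin n → ℝ) : ℝ :=
  ∑ j, if lam j ^ 2 * (b j ⬝ᵥ b j) < (b j ⬝ᵥ x) ^ 2 then 1 else 0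

/-- The number of coordinates that do not move any more. -/
noncomputable def frozenCount (x : Fin n → ℝ) : ℝ := ∑ i, (1 - free x i)

/-- Take an orthonormal basis of the common kernel of the frozen coordinates and the tight rows.
Rank–nullity counts it, and Bessel's inequality is the last clause. Gradient steps fix these vectors
exactly, although the projection itself is only approximate. -/
theorem exists_orthonormal_fixed (b : Fin m → Fin n → ℝ) (lam : Fin m → ℝ) (x : Fin n → ℝ) :
    ∃ (d : ℕ) (f : Fin d → Fin n → ℝ), n ≤ d + frozenCount x + tightCount b lam x ∧
      (∀ l i, free x i * f l i = f l i) ∧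
      (∀ l j, coef b lam x j * (freeRows b x j ⬝ᵥ f l) = 0) ∧
      (∀ l, f l ⬝ᵥ f l = 1) ∧ ∀ v, ∑ l, (f l ⬝ᵥ v) ^ 2 ≤ v ⬝ᵥ v := by
  classical
  let I := {i : Fin n // ¬ |x i| ≤ 1 - 1 / (n : ℝ) ^ 4}
  let J := {j : Fin m // lam j ^ 2 * (b j ⬝ᵥ b j) < (b j ⬝ᵥ x) ^ 2}
  let Λ : EuclideanSpace ℝ (Fin n) →ₗ[ℝ] (I ⊕ J → ℝ) := LinearMap.pi (Sum.elim
    (fun i => (EuclideanSpace.proj (𝕜 := ℝ) i.1).toLinearMap)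
    (fun j => (innerSL ℝ (WithLp.toLp 2 (b j.1) : EuclideanSpace ℝ (Fin n))).toLinearMap))
  let K := LinearMap.ker Λ
  let B := stdOrthonormalBasis ℝ K
  have hinner : ∀ u v : EuclideanSpace ℝ (Fin n), inner ℝ u v = u.ofLp ⬝ᵥ v.ofLp := by
    intro u v
    rw [EuclideanSpace.inner_eq_star_dotProduct, dotProduct_comm]
    simp
  have hortho : Orthonormal ℝ (fun l => (B l : EuclideanSpace ℝ (Fin n))) :=
    B.orthonormal.comp_linearIsometry K.subtypeₗᵢ
  have hK : ∀ l, Λ (B l : EuclideanSpace ℝ (Fin n)) = 0 := fun l => (B l).2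
  have hI : ∀ l (i : I), (B l : EuclideanSpace ℝ (Fin n)).ofLp i.1 = 0 := fun l i =>
    congrFun (hK l) (Sum.inl i)
  have hJ : ∀ l (j : J), b j.1 ⬝ᵥ (B l : EuclideanSpace ℝ (Fin n)).ofLp = 0 := by
    intro l j
    have := congrFun (hK l) (Sum.inr j)
    simpa [Λ, hinner] using this
  have hfree : ∀ l i, free x i * (B l : EuclideanSpace ℝ (Fin n)).ofLp i =
      (B l : EuclideanSpace ℝ (Fin n)).ofLp i := by
    intro l i
    by_cases h : |x i| ≤ 1 - 1 / (n : ℝ) ^ 4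
    · rw [free, if_pos h, one_mul]
    · rw [hI l ⟨i, h⟩, mul_zero]
  refine ⟨_, fun l => (B l : EuclideanSpace ℝ (Fin n)).ofLp, ?_, hfree, fun l j => ?_,
    fun l => ?_, fun v => ?_⟩
  · have h1 := LinearMap.finrank_range_add_finrank_ker Λ
    have h2 : Module.finrank ℝ (LinearMap.range Λ) ≤ Fintype.card I + Fintype.card J := by
      refine (Submodule.finrank_le _).trans (le_of_eq ?_)
      simp
    have h3 : frozenCount x = Fintype.card I := by
      rw [Fintype.card_subtype, ← Finset.sum_boole]
      refine Finset.sum_congr rfl fun i _ => ?_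
      unfold free
      split_ifs <;> simp
    have h4 : tightCount b lam x = Fintype.card J := by
      rw [Fintype.card_subtype, ← Finset.sum_boole]; rfl
    rw [h3, h4]
    rw [finrank_euclideanSpace, Fintype.card_fin] at h1
    have h5 : n ≤ Module.finrank ℝ K + Fintype.card I + Fintype.card J := by
      have : Module.finrank ℝ K = Module.finrank ℝ (LinearMap.ker Λ) := rfl
      omega
    exact_mod_cast h5
  · by_cases h : lam j ^ 2 * (b j ⬝ᵥ b j) < (b j ⬝ᵥ x) ^ 2
    · have h1 : freeRows b x j ⬝ᵥ (B l : EuclideanSpace ℝ (Fin n)).ofLp =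
          b j ⬝ᵥ (B l : EuclideanSpace ℝ (Fin n)).ofLp := by
        unfold freeRows
        rw [free_mul_dotProduct]
        congr 1
        ext i
        exact hfree l i
      rw [h1, hJ l ⟨j, h⟩, mul_zero]
    · rw [coef, if_neg h, zero_mul]
  · rw [← hinner, real_inner_self_eq_norm_sq, hortho.1 l]; norm_num
  · have := hortho.sum_inner_products_le (WithLp.toLp 2 v) (s := Finset.univ)
    rw [← real_inner_self_eq_norm_sq, hinner] at this
    simp only [hinner, Real.norm_eq_abs, sq_abs] at this
    exact this

/-- The cross term is a linear form in the signs and averages to 0. By Bessel `‖direction‖²` is at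
least `∑ₗ ⟨fₗ, r⟩²`, since the `fₗ` are fixed, and each of these squares has mean 1. -/
theorem norm_walkStep_average (hn : 0 < n) (b : Fin m → Fin n → ℝ) (lam : Fin m → ℝ)
    (x : Fin n → ℝ) :
    x ⬝ᵥ x + 1 / (n : ℝ) ^ 10 * (n - frozenCount x - tightCount b lam x) ≤
      (∑ ρ : Fin n → Bool, (walkStep b lam x fun i => bitSign (ρ i)) ⬝ᵥ
        (walkStep b lam x fun i => bitSign (ρ i))) / 2 ^ n := by
  have hn' : (0 : ℝ) < n := by exact_mod_cast hn
  obtain ⟨d, f, hd, hf, hc, hnorm, hbessel⟩ := exists_orthonormal_fixed b lam x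
  obtain ⟨w, -, hw⟩ := dotProduct_direction b lam x x
  have hfix : ∀ l r, f l ⬝ᵥ direction b lam x r = f l ⬝ᵥ r := by
    intro l r
    unfold direction
    rw [dotProduct_descend_iterate]
    have h1 : (descend (coef b lam x) (freeRows b x))^[(m + 1) * n ^ 17] (f l) = f l := by
      refine Function.iterate_fixed ?_ _
      ext i
      simp [descend, hc]
    rw [h1, dotProduct_comm, free_mul_dotProduct, dotProduct_comm]
    congr 1
    ext i
    exact hf l i
  have hstep : ∀ ρ : Fin n → Bool, x ⬝ᵥ x +
      2 / (n : ℝ) ^ 5 * (w ⬝ᵥ fun i => bitSign (ρ i)) +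
      1 / (n : ℝ) ^ 10 * ∑ l, (f l ⬝ᵥ fun i => bitSign (ρ i)) ^ 2 ≤
      (walkStep b lam x fun i => bitSign (ρ i)) ⬝ᵥ
        (walkStep b lam x fun i => bitSign (ρ i)) := by
    intro ρ
    set r : Fin n → ℝ := fun i => bitSign (ρ i)
    have h1 := hbessel (direction b lam x r)
    simp only [hfix] at h1
    rw [dotProduct_walkStep, dotProduct_comm (walkStep b lam x r) x, dotProduct_walkStep, hw,
      dotProduct_comm (walkStep b lam x r) (direction b lam x r), dotProduct_walkStep,
      dotProduct_comm (direction b lam x r) x, hw]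
    have h2 := mul_le_mul_of_nonneg_left h1 (by positivity : 0 ≤ 1 / (n : ℝ) ^ 10)
    calc _ ≤ x ⬝ᵥ x + 2 / (n : ℝ) ^ 5 * (w ⬝ᵥ r) +
          1 / (n : ℝ) ^ 10 * (direction b lam x r ⬝ᵥ direction b lam x r) := by linarith
      _ = _ := by ring
  rw [le_div_iff₀ (by positivity)]
  refine le_trans ?_ (Finset.sum_le_sum fun ρ _ => hstep ρ)
  rw [Finset.sum_add_distrib, Finset.sum_add_distrib, ← Finset.mul_sum, sum_sign,
    ← Finset.mul_sum, Finset.sum_comm]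
  simp only [sum_sign_sq, hnorm]
  have h3 : (1 : ℝ) / n ^ 10 * (n - frozenCount x - tightCount b lam x) ≤ 1 / n ^ 10 * d :=
    mul_le_mul_of_nonneg_left (by linarith) (by positivity)
  have h4 : (0 : ℝ) < 2 ^ n := by positivity
  simp
  simp at h3
  nlinarith

/-! ## The walk on average -/

theorem walk_congr (b : Fin m → Fin n → ℝ) (lam : Fin m → ℝ) {ω ω' : ℕ → Bool} {s : ℕ}
    (h : ∀ k < s * n, ω k = ω' k) : walk b lam ω s = walk b lam ω' s := by
  induction s with
  | zero => rfl
  | succ s ih =>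
    have h1 : s * n + n = (s + 1) * n := (Nat.succ_mul s n).symm
    simp only [walk]
    rw [ih fun k hk => h k (by omega)]
    congr 1
    ext i
    rw [h (s * n + i) (by omega)]

theorem mean_walk_succ {N s : ℕ} (hN : (s + 1) * n ≤ N) (b : Fin m → Fin n → ℝ)
    (lam : Fin m → ℝ) (f : (Fin n → ℝ) → ℝ) :
    mean N (fun ω => f (walk b lam ω (s + 1))) = mean N (fun ω =>
      (∑ ρ : Fin n → Bool, f (walkStep b lam (walk b lam ω s) fun i => bitSign (ρ i))) / 2 ^ n) :=
  mean_block hN (fun ω ρ => f (walkStep b lam (walk b lam ω s) fun i => bitSign (ρ i)))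
    fun ω ω' h => by rw [walk_congr b lam h]

/-- The exponential moment grows by at most `exp (‖v‖² / (2 n^10))` per step, whatever the current
point is. -/
theorem mean_exp_walk_le {N s : ℕ} (hN : s * n ≤ N) (b : Fin m → Fin n → ℝ)
    (lam : Fin m → ℝ) (v : Fin n → ℝ) :
    mean N (fun ω => Real.exp (v ⬝ᵥ walk b lam ω s)) ≤
      Real.exp (s / (n : ℝ) ^ 10 * (v ⬝ᵥ v / 2)) := by
  induction s with
  | zero => simp [walk, mean_const]
  | succ s ih =>
    have h1 : s * n + n = (s + 1) * n := (Nat.succ_mul s n).symm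
    rw [mean_walk_succ hN b lam (fun x => Real.exp (v ⬝ᵥ x))]
    refine (mean_mono fun ω => sum_exp_walkStep_le b lam (walk b lam ω s) v).trans ?_
    rw [mean_mul_left]
    refine (mul_le_mul_of_nonneg_left (ih (by omega)) (Real.exp_nonneg _)).trans (le_of_eq ?_)
    rw [← Real.exp_add]
    congr 1
    push_cast
    ring

/-- A Chernoff bound at time at most 4: the threshold contributes `exp (-λ²/4)`, the moment at most
`exp (λ²/8)`, and the two signs of the deviation the factor 2. -/
theorem mean_tight_le {N s : ℕ} (hn : 0 < n) (hs : s ≤ 4 * n ^ 10) (hN : s * n ≤ N)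
    (b : Fin m → Fin n → ℝ) (lam : Fin m → ℝ) (hlam : ∀ j, 0 ≤ lam j) (j : Fin m) :
    mean N (fun ω => if lam j ^ 2 * (b j ⬝ᵥ b j) < (b j ⬝ᵥ walk b lam ω s) ^ 2 then 1 else 0) ≤
      2 * Real.exp (-(lam j) ^ 2 / 8) := by
  have hn' : (0 : ℝ) < n := by exact_mod_cast hn
  have hb0 := dotProduct_self_nonneg' (b j)
  set β := √(b j ⬝ᵥ b j) with hβ
  have hββ : b j ⬝ᵥ b j = β ^ 2 := (Real.sq_sqrt hb0).symm
  have hβ0 : 0 ≤ β := Real.sqrt_nonneg _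
  -- This choice minimizes the Chernoff exponent `-θ λ β + 2 θ² β²`. For `β = 0` the quotient is 0
  -- by convention, and the row is never tight.
  set θ := lam j / (4 * β) with hθ
  have hθ0 : 0 ≤ θ := div_nonneg (hlam j) (by positivity)
  have hpt : ∀ ω, (if lam j ^ 2 * (b j ⬝ᵥ b j) < (b j ⬝ᵥ walk b lam ω s) ^ 2 then (1 : ℝ) else 0) ≤
      Real.exp (-(lam j) ^ 2 / 4) * (Real.exp ((θ • b j) ⬝ᵥ walk b lam ω s) +
        Real.exp ((-θ • b j) ⬝ᵥ walk b lam ω s)) := by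
    intro ω
    split_ifs with h
    · set z := b j ⬝ᵥ walk b lam ω s with hz
      have hβpos : 0 < β := by
        refine hβ0.lt_of_ne fun h0 => ?_
        have := dotProduct_sq_le (b j) (walk b lam ω s)
        rw [hββ, ← h0] at this h
        simp at this h
        exact absurd h (by simp [hz, this])
      have habs : lam j * β < |z| := by
        refine abs_lt_of_sq_lt_sq' ?_ (abs_nonneg _) |>.2
        rw [sq_abs, mul_pow, ← hββ]; exact h
      have hcrit : lam j ^ 2 / 4 ≤ θ * |z| := by
        calc lam j ^ 2 / 4 = θ * (lam j * β) := by rw [hθ]; field_simp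
          _ ≤ _ := mul_le_mul_of_nonneg_left habs.le hθ0
      rw [smul_dotProduct, smul_dotProduct, smul_eq_mul, smul_eq_mul, ← hz, mul_add,
        ← Real.exp_add, ← Real.exp_add]
      rcases le_total 0 z with h0 | h0
      · rw [abs_of_nonneg h0] at hcrit
        have := Real.one_le_exp (by linarith : 0 ≤ -(lam j) ^ 2 / 4 + θ * z)
        have := Real.exp_nonneg (-(lam j) ^ 2 / 4 + -θ * z)
        linarith
      · rw [abs_of_nonpos h0] at hcrit
        have := Real.one_le_exp (by linarith : 0 ≤ -(lam j) ^ 2 / 4 + -θ * z)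
        have := Real.exp_nonneg (-(lam j) ^ 2 / 4 + θ * z)
        linarith
    · positivity
  have hbound : ∀ τ : ℝ, τ ^ 2 = θ ^ 2 →
      mean N (fun ω => Real.exp ((τ • b j) ⬝ᵥ walk b lam ω s)) ≤ Real.exp (lam j ^ 2 / 8) := by
    intro τ hτ
    refine (mean_exp_walk_le hN b lam _).trans (Real.exp_le_exp.mpr ?_)
    rw [smul_dotProduct, dotProduct_smul, smul_eq_mul, smul_eq_mul, ← mul_assoc, ← sq, hτ, hββ]
    have h1 : (s : ℝ) / n ^ 10 ≤ 4 := by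
      rw [div_le_iff₀ (by positivity)]; exact_mod_cast hs
    have h2 : θ ^ 2 * β ^ 2 ≤ lam j ^ 2 / 16 := by
      rw [← mul_pow, hθ]
      rcases hβ0.eq_or_lt with h | h
      · rw [← h]; simp; positivity
      · have : lam j / (4 * β) * β = lam j / 4 := by field_simp
        rw [this]; exact le_of_eq (by ring)
    calc _ ≤ 4 * (lam j ^ 2 / 16 / 2) := by gcongr
      _ = _ := by ring
  refine (mean_mono hpt).trans ?_
  rw [mean_mul_left, mean_add]
  calc _ ≤ Real.exp (-(lam j) ^ 2 / 4) * (Real.exp (lam j ^ 2 / 8) + Real.exp (lam j ^ 2 / 8)) := by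
        gcongr
        · exact hbound θ rfl
        · exact hbound (-θ) (by ring)
    _ = _ := by
        rw [← two_mul, mul_left_comm, ← Real.exp_add]
        ring_nf

/-- A step does not change frozen coordinates at all. -/
theorem frozenCount_walk_le (b : Fin m → Fin n → ℝ) (lam : Fin m → ℝ) (ω : ℕ → Bool) {s t : ℕ}
    (hst : s ≤ t) : frozenCount (walk b lam ω s) ≤ frozenCount (walk b lam ω t) := by
  induction hst with
  | refl => exact le_rfl
  | @step t _ ih =>
    refine ih.trans (Finset.sum_le_sum fun i _ => ?_)
    rcases free_eq_or (walk b lam ω t) i with h | h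
    · have h1 := walkStep_apply_of_not_free b lam (walk b lam ω t)
        (fun i => bitSign (ω (t * n + i))) h
      have h2 : free (walk b lam ω (t + 1)) i = free (walk b lam ω t) i := by
        unfold free
        rw [walk, h1]
      rw [h2]
    · rw [h]
      rcases free_eq_or (walk b lam ω (t + 1)) i with h' | h' <;> rw [h']; norm_num

theorem half_le_mean_frozen {N : ℕ} (hn : 0 < n) (hN : 4 * n ^ 10 * n ≤ N)
    (b : Fin m → Fin n → ℝ) (lam : Fin m → ℝ) (hlam : ∀ j, 0 ≤ lam j)
    (hsum : ∑ j, Real.exp (-(lam j) ^ 2 / 8) ≤ (n : ℝ) / 16) :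
    1 / 2 ≤ coinProb N fun ω => (n : ℝ) / 4 ≤ frozenCount (walk b lam ω (4 * n ^ 10)) := by
  classical
  have hn' : (0 : ℝ) < n := by exact_mod_cast hn
  set T := 4 * n ^ 10 with hT
  set e := mean N fun ω => frozenCount (walk b lam ω T) with he
  have htight : ∀ s ≤ T, mean N (fun ω => tightCount b lam (walk b lam ω s)) ≤ n / 8 := by
    intro s hs
    -- The `n/16` of the hypothesis doubles to `n/8` by the two-sided tail bound.
    unfold tightCount
    rw [mean_sum]
    have hsN : s * n ≤ N := (Nat.mul_le_mul_right n hs).trans hN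
    calc _ ≤ ∑ j, 2 * Real.exp (-(lam j) ^ 2 / 8) :=
          Finset.sum_le_sum fun j _ => mean_tight_le hn hs hsN b lam hlam j
      _ ≤ _ := by rw [← Finset.mul_sum]; linarith
  have hgrow : ∀ s ≤ T, s / (n : ℝ) ^ 10 * (7 / 8 * n - e) ≤
      mean N (fun ω => walk b lam ω s ⬝ᵥ walk b lam ω s) := by
    intro s
    induction s with
    | zero => intro _; simp [walk, mean_const]
    | succ s ih =>
      intro hs
      have h1 := ih (by omega)
      have hsN : (s + 1) * n ≤ N := (Nat.mul_le_mul_right n hs).trans hN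
      rw [mean_walk_succ hsN b lam (fun x => x ⬝ᵥ x)]
      have h2 := mean_mono (N := N) fun ω => norm_walkStep_average hn b lam (walk b lam ω s)
      refine le_trans ?_ h2
      rw [mean_add, mean_mul_left]
      have h3 : mean N (fun ω => (n : ℝ) - frozenCount (walk b lam ω s) -
          tightCount b lam (walk b lam ω s)) = n - mean N (fun ω => frozenCount (walk b lam ω s)) -
          mean N (fun ω => tightCount b lam (walk b lam ω s)) := by
        have := mean_add N (fun ω => (n : ℝ) - frozenCount (walk b lam ω s) -
          tightCount b lam (walk b lam ω s)) (fun ω => frozenCount (walk b lam ω s) +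
          tightCount b lam (walk b lam ω s))
        rw [mean_add N (fun ω => frozenCount (walk b lam ω s)), show (fun ω => (n : ℝ) - frozenCount (walk b lam ω s) -
          tightCount b lam (walk b lam ω s) + (frozenCount (walk b lam ω s) +
          tightCount b lam (walk b lam ω s))) = fun _ => (n : ℝ) by ext ω; ring,
          mean_const] at this
        linarith
      rw [h3]
      have h4 := htight s (by omega)
      -- Monotonicity lets the final expectation `e` stand in for all earlier ones, so the growth
      -- rate is constant in time.
      have h5 : mean N (fun ω => frozenCount (walk b lam ω s)) ≤ e :=
        mean_mono fun ω => frozenCount_walk_le b lam ω (by omega)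
      have h6 : 1 / (n : ℝ) ^ 10 * (7 / 8 * n - e) ≤ 1 / (n : ℝ) ^ 10 *
          (n - mean N (fun ω => frozenCount (walk b lam ω s)) -
          mean N (fun ω => tightCount b lam (walk b lam ω s))) :=
        mul_le_mul_of_nonneg_left (by linarith) (by positivity)
      calc _ = s / (n : ℝ) ^ 10 * (7 / 8 * n - e) + 1 / (n : ℝ) ^ 10 * (7 / 8 * n - e) := by
            push_cast; ring
        _ ≤ _ := add_le_add h1 h6
  have hT4 : (T : ℝ) / (n : ℝ) ^ 10 = 4 := by rw [hT]; push_cast; field_simp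
  have hend := hgrow T le_rfl
  rw [hT4] at hend
  have hmax : mean N (fun ω => walk b lam ω T ⬝ᵥ walk b lam ω T) ≤ n := by
    rw [← mean_const N (n : ℝ)]
    refine mean_mono fun ω => ?_
    calc _ ≤ ∑ _i : Fin n, (1 : ℝ) := Finset.sum_le_sum fun i _ => by
          have := abs_le.mp (abs_walk_le b lam ω T i)
          nlinarith
      _ = n := by simp
  have hup : e ≤ n / 4 + 3 / 4 * n * coinProb N fun ω =>
      (n : ℝ) / 4 ≤ frozenCount (walk b lam ω T) := by
    rw [coinProb_eq_mean]
    calc e ≤ mean N (fun ω => (n : ℝ) / 4 + 3 / 4 * n *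
          if (n : ℝ) / 4 ≤ frozenCount (walk b lam ω T) then 1 else 0) := mean_mono fun ω => ?_
      _ = _ := by rw [mean_add, mean_const, mean_mul_left]
    split_ifs with h
    · have : frozenCount (walk b lam ω T) ≤ ∑ _i : Fin n, (1 : ℝ) :=
        Finset.sum_le_sum fun i _ => by
          rcases free_eq_or (walk b lam ω T) i with h | h <;> rw [h] <;> norm_num
      simp at this
      linarith
    · linarith
  -- Energy gives `4 (7n/8 - e) ≤ n`, so `e ≥ 5n/8`; with `e ≤ n/4 + (3n/4) p` this yields `p ≥
  -- 1/2`.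
  nlinarith

end

/-! ## Bit lengths along the walk -/

/-- The rational number `q` is an integer multiple of `1 / D`. -/
def OnGrid (D : ℕ) (q : ℚ) : Prop := ∃ z : ℤ, q * D = z

namespace OnGrid

variable {D E : ℕ} {p q : ℚ}

theorem natCast (D : ℕ) (k : ℕ) : OnGrid D k := ⟨k * D, by push_cast; ring⟩

theorem zero (D : ℕ) : OnGrid D 0 := ⟨0, by simp⟩

theorem one (D : ℕ) : OnGrid D 1 := ⟨D, by simp⟩

theorem add (hp : OnGrid D p) (hq : OnGrid D q) : OnGrid D (p + q) := by
  obtain ⟨y, hy⟩ := hp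
  obtain ⟨z, hz⟩ := hq
  exact ⟨y + z, by push_cast; rw [add_mul, hy, hz]⟩

theorem neg (hp : OnGrid D p) : OnGrid D (-p) := by
  obtain ⟨y, hy⟩ := hp
  exact ⟨-y, by push_cast; rw [neg_mul, hy]⟩

theorem sub (hp : OnGrid D p) (hq : OnGrid D q) : OnGrid D (p - q) := by
  rw [sub_eq_add_neg]; exact hp.add hq.neg

theorem mul (hp : OnGrid D p) (hq : OnGrid E q) : OnGrid (D * E) (p * q) := by
  obtain ⟨y, hy⟩ := hp
  obtain ⟨z, hz⟩ := hq
  exact ⟨y * z, by push_cast; rw [← hy, ← hz]; ring⟩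

theorem of_dvd (hp : OnGrid D p) (h : D ∣ E) : OnGrid E p := by
  obtain ⟨y, hy⟩ := hp
  obtain ⟨k, rfl⟩ := h
  exact ⟨y * k, by push_cast; rw [← hy]; ring⟩

theorem sum {ι : Type*} (s : Finset ι) (f : ι → ℚ) (h : ∀ i ∈ s, OnGrid D (f i)) :
    OnGrid D (∑ i ∈ s, f i) :=
  Finset.sum_induction f (OnGrid D) (fun _ _ => add) (zero D) h

/-- A common denominator and an absolute bound suffice to bound bit lengths. Following these two
data replaces the naive count, which would double lengths with every operation. -/
theorem bitLength_le (hD : 0 < D) (hq : OnGrid D q) {e f : ℕ} (he : D ≤ 2 ^ e)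
    (hf : |q| ≤ 2 ^ f) : bitLength q ≤ 2 * e + f + 3 := by
  obtain ⟨z, hz⟩ := hq
  have hD' : (D : ℚ) ≠ 0 := by exact_mod_cast hD.ne'
  have hqz : q = (z : ℚ) / ((D : ℤ) : ℚ) := by
    rw [← hz]; push_cast; field_simp
  have h1 : z.natAbs ≤ 2 ^ (e + f) := by
    have : (z.natAbs : ℚ) = |q| * D := by
      rw [Nat.cast_natAbs, Int.cast_abs, ← hz, abs_mul, Nat.abs_cast]
    have h2 : (z.natAbs : ℚ) ≤ ((2 ^ (e + f) : ℕ) : ℚ) := by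
      rw [this]
      push_cast
      rw [pow_add, mul_comm]
      have : (D : ℚ) ≤ 2 ^ e := by exact_mod_cast he
      exact mul_le_mul this hf (abs_nonneg _) (by positivity)
    exact_mod_cast h2
  have h3 : z.natAbs.size ≤ e + f + 1 :=
    Nat.size_le.mpr (h1.trans_lt (Nat.pow_lt_pow_right (by norm_num) (Nat.lt_succ_self _)))
  have h4 : D.size ≤ e + 1 :=
    Nat.size_le.mpr (he.trans_lt (Nat.pow_lt_pow_right (by norm_num) (Nat.lt_succ_self _)))
  rw [hqz]
  refine (bitLength_divInt_le _ _ (by exact_mod_cast hD.ne')).trans ?_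
  rw [Int.natAbs_natCast]
  omega

end OnGrid

theorem onGrid_den (q : ℚ) : OnGrid q.den q := ⟨q.num, Rat.mul_den_eq_num q⟩

theorem den_le (q : ℚ) : q.den ≤ 2 ^ bitLength q :=
  (Nat.lt_size_self _).le.trans
    (Nat.pow_le_pow_right two_pos (by unfold bitLength; omega))

theorem abs_le_two_pow (q : ℚ) : |q| ≤ 2 ^ bitLength q := by
  have h1 : q.num.natAbs ≤ 2 ^ bitLength q := (Nat.lt_size_self _).le.trans
    (Nat.pow_le_pow_right two_pos (by unfold bitLength; omega))
  have h2 : |q| * q.den = q.num.natAbs := by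
    rw [Nat.cast_natAbs, Int.cast_abs, ← Rat.mul_den_eq_num q, abs_mul, Nat.abs_cast]
  have h3 : (1 : ℚ) ≤ q.den := by exact_mod_cast q.den_pos
  calc |q| ≤ |q| * q.den := le_mul_of_one_le_right (abs_nonneg _) h3
    _ ≤ _ := by rw [h2]; exact_mod_cast h1

theorem abs_sum_le_card_mul {ι : Type*} [Fintype ι] (S : Finset ι) (f : ι → ℚ) {V : ℚ}
    (h : ∀ i, |f i| ≤ V) : |∑ i ∈ S, f i| ≤ Fintype.card ι * V := by
  calc _ ≤ ∑ i ∈ S, |f i| := Finset.abs_sum_le_sum_abs _ _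
    _ ≤ ∑ i, |f i| := Finset.sum_le_sum_of_subset_of_nonneg (Finset.subset_univ _)
        fun _ _ _ => abs_nonneg _
    _ ≤ ∑ _i : ι, V := Finset.sum_le_sum fun i _ => h i
    _ = _ := by simp

/-! ### Common denominators for a fixed instance -/

section Instance

variable {n m : ℕ} (y : Fin n → ℚ) (a : Fin m → Fin n → ℚ) (lam : Fin m → ℚ)

theorem add_two_le_inputSize : n + m + 2 ≤ inputSize y a lam := by
  have h1 : n ≤ ∑ i, bitLength (y i) := by
    calc n = ∑ _i : Fin n, 1 := by simp
      _ ≤ _ := Finset.sum_le_sum fun i _ => bitLength_pos _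
  have h2 : m ≤ ∑ j, bitLength (lam j) := by
    calc m = ∑ _j : Fin m, 1 := by simp
      _ ≤ _ := Finset.sum_le_sum fun i _ => bitLength_pos _
  have := bitLength_pos n
  have := bitLength_pos m
  unfold inputSize
  omega

theorem bitLength_y_le (i : Fin n) : bitLength (y i) ≤ inputSize y a lam := by
  have := Finset.single_le_sum (f := fun i => bitLength (y i)) (fun _ _ => Nat.zero_le _)
    (Finset.mem_univ i)
  unfold inputSize
  omega

theorem bitLength_a_le (j : Fin m) (i : Fin n) : bitLength (a j i) ≤ inputSize y a lam := by
  have h1 := Finset.single_le_sum (f := fun i => bitLength (a j i)) (fun _ _ => Nat.zero_le _)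
    (Finset.mem_univ i)
  have h2 := Finset.single_le_sum (f := fun j => ∑ i, bitLength (a j i))
    (fun _ _ => Nat.zero_le _) (Finset.mem_univ j)
  unfold inputSize
  omega

theorem bitLength_lam_le (j : Fin m) : bitLength (lam j) ≤ inputSize y a lam := by
  have := Finset.single_le_sum (f := fun j => bitLength (lam j)) (fun _ _ => Nat.zero_le _)
    (Finset.mem_univ j)
  unfold inputSize
  omega

/-- A common denominator of the entries of `y` and `a`. -/
def commonDen : ℕ := (∏ i, (y i).den) * ∏ j, ∏ i, (a j i).den

theorem commonDen_pos : 0 < commonDen y a :=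
  Nat.mul_pos (Finset.prod_pos fun i _ => (y i).den_pos)
    (Finset.prod_pos fun j _ => Finset.prod_pos fun i _ => (a j i).den_pos)

theorem commonDen_le : commonDen y a ≤ 2 ^ inputSize y a lam := by
  calc commonDen y a ≤ (∏ i, 2 ^ bitLength (y i)) * ∏ j, ∏ i, 2 ^ bitLength (a j i) :=
        Nat.mul_le_mul (Finset.prod_le_prod' fun i _ => den_le _)
          (Finset.prod_le_prod' fun j _ => Finset.prod_le_prod' fun i _ => den_le _)
    _ = 2 ^ (∑ i, bitLength (y i) + ∑ j, ∑ i, bitLength (a j i)) := by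
        simp only [Finset.prod_pow_eq_pow_sum, pow_add]
    _ ≤ _ := Nat.pow_le_pow_right two_pos (by unfold inputSize; omega)

theorem onGrid_y (i : Fin n) : OnGrid (commonDen y a) (y i) :=
  (onGrid_den _).of_dvd ((Finset.dvd_prod_of_mem _ (Finset.mem_univ i)).mul_right _)

theorem onGrid_a (j : Fin m) (i : Fin n) : OnGrid (commonDen y a) (a j i) :=
  (onGrid_den _).of_dvd (((Finset.dvd_prod_of_mem (fun i => (a j i).den) (Finset.mem_univ i)).trans
    (Finset.dvd_prod_of_mem (fun j => ∏ i, (a j i).den) (Finset.mem_univ j))).mul_left _)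

theorem onGrid_offset (i : Fin n) : OnGrid (commonDen y a) (offset (y i)) := by
  unfold offset
  split_ifs
  · exact onGrid_y y a i
  · exact (onGrid_y y a i).sub (OnGrid.one _)

theorem onGrid_scaled (j : Fin m) (i : Fin n) :
    OnGrid (commonDen y a ^ 2) (scaled y a j i) := by
  rw [sq]; exact (onGrid_a y a j i).mul (onGrid_offset y a i)

theorem onGrid_scaled_mul (j : Fin m) (i : Fin n) :
    OnGrid (commonDen y a ^ 4) (scaled y a j i * scaled y a j i) := by
  rw [show commonDen y a ^ 4 = commonDen y a ^ 2 * commonDen y a ^ 2 by ring]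
  exact (onGrid_scaled y a j i).mul (onGrid_scaled y a j i)

theorem abs_offset_le {y : ℚ} (hy : y ∈ Set.Icc (0 : ℚ) 1) : |offset y| ≤ 1 := by
  obtain ⟨h0, h1⟩ := hy
  unfold offset
  split_ifs <;> rw [abs_le] <;> constructor <;> linarith

theorem abs_scaled_le (hy : ∀ i, y i ∈ Set.Icc (0 : ℚ) 1) (j : Fin m) (i : Fin n) :
    |scaled y a j i| ≤ 2 ^ inputSize y a lam := by
  unfold scaled
  rw [abs_mul]
  refine (mul_le_of_le_one_right (abs_nonneg _) (abs_offset_le (hy i))).trans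
    ((abs_le_two_pow _).trans ?_)
  exact pow_le_pow_right₀ (by norm_num) (bitLength_a_le y a lam j i)

/-- The numerator of `‖bⱼ‖²` with respect to a common denominator. -/
noncomputable def rowNum (j : Fin m) : ℕ :=
  ⌊(scaled y a j ⬝ᵥ scaled y a j) * (commonDen y a : ℚ) ^ 4⌋₊

theorem rowNum_eq (j : Fin m) :
    (rowNum y a j : ℚ) = (scaled y a j ⬝ᵥ scaled y a j) * (commonDen y a : ℚ) ^ 4 := by
  obtain ⟨z, hz⟩ := OnGrid.sum Finset.univ (fun i => scaled y a j i * scaled y a j i)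
    fun i _ => onGrid_scaled_mul y a j i
  have hz' : (scaled y a j ⬝ᵥ scaled y a j) * (commonDen y a : ℚ) ^ 4 = z := by
    rw [← hz]; push_cast; rfl
  have h0 : (0 : ℚ) ≤ z := by
    rw [← hz']
    have := dotProduct_self_nonneg' (scaled y a j)
    positivity
  lift z to ℕ using by exact_mod_cast h0
  unfold rowNum
  rw [hz']
  simp

/-- A common denominator of the coefficients. -/
noncomputable def coefDen : ℕ := (m + 1) * ∏ j, max 1 (rowNum y a j)

theorem coefDen_pos : 0 < coefDen y a :=
  Nat.mul_pos (Nat.succ_pos _) (Finset.prod_pos fun _ _ => by omega)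

/-- Each `rowNum` is at most `n · 4^L · (2^L)^4 ≤ 2^(7L)`, and there are at most `L` rows. -/
theorem coefDen_le (hy : ∀ i, y i ∈ Set.Icc (0 : ℚ) 1) :
    coefDen y a ≤ 2 ^ (inputSize y a lam + 7 * inputSize y a lam ^ 2) := by
  set L := inputSize y a lam with hL
  have hnm := add_two_le_inputSize y a lam
  have hLL : L ≤ 2 ^ L := Nat.lt_two_pow_self.le
  have hrow : ∀ j, max 1 (rowNum y a j) ≤ 2 ^ (7 * L) := by
    intro j
    refine max_le Nat.one_le_two_pow ?_
    have h1 : scaled y a j ⬝ᵥ scaled y a j ≤ n * (2 ^ L * 2 ^ L) := by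
      have := abs_sum_le_card_mul Finset.univ (fun i => scaled y a j i * scaled y a j i)
        (V := 2 ^ L * 2 ^ L) fun i => by
          rw [abs_mul]
          exact mul_le_mul (abs_scaled_le y a lam hy j i) (abs_scaled_le y a lam hy j i)
            (abs_nonneg _) (by positivity)
      rw [Fintype.card_fin] at this
      exact (le_abs_self _).trans this
    have h2 : (n : ℚ) ≤ 2 ^ L := by exact_mod_cast (show n ≤ 2 ^ L by omega)
    have h3 : (commonDen y a : ℚ) ≤ 2 ^ L := by exact_mod_cast commonDen_le y a lam
    have h4 : (rowNum y a j : ℚ) ≤ 2 ^ (7 * L) := by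
      rw [rowNum_eq]
      calc _ ≤ 2 ^ L * (2 ^ L * 2 ^ L) * ((2 : ℚ) ^ L) ^ 4 := by
            gcongr
            exact h1.trans (by gcongr)
        _ = _ := by ring
    exact_mod_cast h4
  calc coefDen y a ≤ 2 ^ L * ∏ _j : Fin m, 2 ^ (7 * L) :=
        Nat.mul_le_mul (by omega) (Finset.prod_le_prod' fun j _ => hrow j)
    _ = 2 ^ (L + 7 * L * m) := by simp [pow_add, pow_mul]
    _ ≤ _ := Nat.pow_le_pow_right two_pos (by
        have : 7 * L * m ≤ 7 * L * L := Nat.mul_le_mul_left _ (by omega)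
        nlinarith)

/-- The point `x` decides only whether the coefficient is switched on, not its value. Zero rows fall
under the first case, also through `1 / 0 = 0`. -/
theorem coef_cases (x : Fin n → ℚ) (j : Fin m) : coef (scaled y a) lam x j = 0 ∨
    rowNum y a j ≠ 0 ∧
      coef (scaled y a) lam x j = (commonDen y a : ℚ) ^ 4 / ((m + 1) * rowNum y a j) := by
  have hD : (commonDen y a : ℚ) ≠ 0 := by exact_mod_cast (commonDen_pos y a).ne'
  rcases eq_or_ne (rowNum y a j) 0 with h | h
  · left
    have h1 := rowNum_eq y a j
    rw [h, Nat.cast_zero, eq_comm, mul_eq_zero] at h1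
    have h2 : scaled y a j ⬝ᵥ scaled y a j = 0 := h1.resolve_right (by positivity)
    simp [coef, h2]
  · unfold coef
    split_ifs
    · right
      refine ⟨h, ?_⟩
      have h0 : (rowNum y a j : ℚ) ≠ 0 := by exact_mod_cast h
      rw [rowNum_eq] at h0 ⊢
      have h1 : scaled y a j ⬝ᵥ scaled y a j ≠ 0 := left_ne_zero_of_mul h0
      field_simp
    · exact Or.inl rfl

theorem onGrid_coef (x : Fin n → ℚ) (j : Fin m) :
    OnGrid (coefDen y a) (coef (scaled y a) lam x j) := by
  rcases coef_cases y a lam x j with h | ⟨h0, h⟩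
  · rw [h]; exact OnGrid.zero _
  · rw [h]
    obtain ⟨k, hk⟩ := Finset.dvd_prod_of_mem (fun j => max 1 (rowNum y a j)) (Finset.mem_univ j)
    have h1 : max 1 (rowNum y a j) = rowNum y a j := by omega
    rw [h1] at hk
    have h0' : (rowNum y a j : ℚ) ≠ 0 := by exact_mod_cast h0
    refine ⟨commonDen y a ^ 4 * k, ?_⟩
    unfold coefDen
    rw [hk]
    push_cast
    field_simp

theorem abs_coef_le (x : Fin n → ℚ) (j : Fin m) :
    |coef (scaled y a) lam x j| ≤ 2 ^ (4 * inputSize y a lam) := by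
  rcases coef_cases y a lam x j with h | ⟨h0, h⟩
  · rw [h, abs_zero]; positivity
  · rw [h, abs_of_nonneg (by positivity)]
    have h1 : (1 : ℚ) ≤ rowNum y a j := by exact_mod_cast Nat.one_le_iff_ne_zero.mpr h0
    have h2 : (commonDen y a : ℚ) ≤ 2 ^ inputSize y a lam := by
      exact_mod_cast commonDen_le y a lam
    have h3 : (1 : ℚ) ≤ (m + 1) * rowNum y a j := by
      have : (1 : ℚ) ≤ m + 1 := by simp
      nlinarith
    calc _ ≤ (commonDen y a : ℚ) ^ 4 := div_le_self (by positivity) h3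
      _ ≤ (2 ^ inputSize y a lam) ^ 4 := by gcongr
      _ = _ := by rw [← pow_mul, mul_comm]

theorem onGrid_free (D : ℕ) (x : Fin n → ℚ) (i : Fin n) : OnGrid D (free x i) := by
  rcases free_eq_or x i with h | h <;> rw [h]
  · exact OnGrid.zero D
  · exact OnGrid.one D

theorem abs_free_le (x : Fin n → ℚ) (i : Fin n) : |free x i| ≤ 1 := by
  rcases free_eq_or x i with h | h <;> rw [h] <;> norm_num

theorem onGrid_freeRows (x : Fin n → ℚ) (j : Fin m) (i : Fin n) :
    OnGrid (commonDen y a ^ 2) (freeRows (scaled y a) x j i) := by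
  have := (onGrid_free 1 x i).mul (onGrid_scaled y a j i)
  rwa [one_mul] at this

theorem abs_freeRows_le (hy : ∀ i, y i ∈ Set.Icc (0 : ℚ) 1) (x : Fin n → ℚ) (j : Fin m)
    (i : Fin n) : |freeRows (scaled y a) x j i| ≤ 2 ^ inputSize y a lam := by
  unfold freeRows
  rw [abs_mul]
  exact (mul_le_of_le_one_left (abs_nonneg _) (abs_free_le x i)).trans
    (abs_scaled_le y a lam hy j i)

/-- The factor by which a gradient step refines the grid. -/
noncomputable def stepDen : ℕ := coefDen y a * commonDen y a ^ 4

theorem stepDen_pos : 0 < stepDen y a :=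
  Nat.mul_pos (coefDen_pos y a) (pow_pos (commonDen_pos y a) 4)

/-- The `l`-th iterate in the computation of the direction. -/
def dirIter (b : Fin m → Fin n → ℚ) (lam : Fin m → ℚ) (x r : Fin n → ℚ) (l : ℕ) : Fin n → ℚ :=
  (descend (coef b lam x) (freeRows b x))^[l] fun i => free x i * r i

theorem dirIter_succ (b : Fin m → Fin n → ℚ) (x r : Fin n → ℚ) (l : ℕ) (i : Fin n) :
    dirIter b lam x r (l + 1) i = dirIter b lam x r l i - ∑ j, coef b lam x j *
      (freeRows b x j ⬝ᵥ dirIter b lam x r l) * freeRows b x j i := by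
  rw [dirIter, Function.iterate_succ_apply']; rfl

theorem abs_dirIter_le (b : Fin m → Fin n → ℚ) (x : Fin n → ℚ) {r : Fin n → ℚ}
    (hr : ∀ i, r i ^ 2 = 1) (l : ℕ) (i : Fin n) : |dirIter b lam x r l i| ≤ n := by
  have hn : (1 : ℚ) ≤ n := by exact_mod_cast i.pos
  refine abs_le_of_sq_le_sq ?_ (by positivity)
  have h1 := iterate_dotProduct_self_le b lam x (fun i => free x i * r i) l
  have h2 := (free_mul_dotProduct_le x r).trans (sign_dotProduct_self hr).le
  have h3 := sq_le_dotProduct_self (dirIter b lam x r l) i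
  unfold dirIter at h3 ⊢
  nlinarith

variable {x r : Fin n → ℚ}

theorem onGrid_rowDot {E : ℕ} {u : Fin n → ℚ} (hu : ∀ i, OnGrid E (u i)) (x : Fin n → ℚ)
    (j : Fin m) (S : Finset (Fin n)) :
    OnGrid (commonDen y a ^ 2 * E) (∑ i ∈ S, freeRows (scaled y a) x j i * u i) :=
  OnGrid.sum _ _ fun i _ => (onGrid_freeRows y a x j i).mul (hu i)

theorem onGrid_rowCoef {E : ℕ} {u : Fin n → ℚ} (hu : ∀ i, OnGrid E (u i)) (x : Fin n → ℚ)
    (j : Fin m) : OnGrid (coefDen y a * (commonDen y a ^ 2 * E))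
      (coef (scaled y a) lam x j * (freeRows (scaled y a) x j ⬝ᵥ u)) :=
  (onGrid_coef y a lam x j).mul (onGrid_rowDot y a hu x j Finset.univ)

theorem onGrid_gradient {E : ℕ} {u : Fin n → ℚ} (hu : ∀ i, OnGrid E (u i)) (x : Fin n → ℚ)
    (i : Fin n) (S : Finset (Fin m)) : OnGrid (stepDen y a * E) (∑ j ∈ S,
      coef (scaled y a) lam x j * (freeRows (scaled y a) x j ⬝ᵥ u) *
        freeRows (scaled y a) x j i) := by
  rw [show stepDen y a * E =
    coefDen y a * (commonDen y a ^ 2 * E) * commonDen y a ^ 2 by unfold stepDen; ring]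
  exact OnGrid.sum _ _ fun j _ => (onGrid_rowCoef y a lam hu x j).mul (onGrid_freeRows y a x j i)

theorem onGrid_bitSign (D : ℕ) (t : Bool) : OnGrid D (bitSign t) := by
  cases t
  · exact (OnGrid.one D).neg
  · exact OnGrid.one D

/-- Each gradient step refines the grid by the fixed factor `stepDen`, whatever `x` is, so the
exponent is the number of steps. -/
theorem onGrid_dirIter (hr : ∀ i, OnGrid 1 (r i)) (l : ℕ) (i : Fin n) :
    OnGrid (stepDen y a ^ l) (dirIter (scaled y a) lam x r l i) := by
  induction l generalizing i with
  | zero => exact (onGrid_free 1 x i).mul (hr i)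
  | succ l ih =>
    rw [dirIter_succ, pow_succ, mul_comm]
    exact ((ih i).of_dvd (dvd_mul_left _ _)).sub
      (onGrid_gradient y a lam ih x i Finset.univ)

/-- A common denominator of the points of the walk. -/
noncomputable def walkDen : ℕ := n ^ 5 * stepDen y a ^ ((m + 1) * n ^ 17)

/-- Every increment lies on the same grid, because the direction sees `x` only through `free` and
`coef`. Hence the denominator is independent of `s`. -/
theorem onGrid_walk (ω : ℕ → Bool) (s : ℕ) (i : Fin n) :
    OnGrid (walkDen y a) (walk (scaled y a) lam ω s i) := by
  induction s with
  | zero => exact OnGrid.zero _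
  | succ s ih =>
    refine ih.add (OnGrid.mul ⟨1, ?_⟩ (onGrid_dirIter y a lam (fun i => onGrid_bitSign 1 _) _ i))
    have : (n : ℚ) ≠ 0 := by exact_mod_cast i.pos.ne'
    push_cast
    field_simp

/-- A common denominator of all numbers in the computation. -/
noncomputable def totalDen : ℕ := n ^ 5 * stepDen y a ^ ((m + 1) * n ^ 17 + 1)

/-- The bound for the bit lengths of all numbers in the computation on an input of size `L`. -/
def bitBudget (L : ℕ) : ℕ := 2 * (5 * L + (5 * L + 7 * L ^ 2) * (L ^ 18 + 1)) + 20 * L + 3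

/-- The one spare factor `stepDen` in `totalDen` accommodates products of points of the walk with
matrix entries, and in `stepDen_pow_dvd` the intermediate results within a gradient step. -/
theorem walkDen_dvd : walkDen y a * commonDen y a ^ 4 ∣ totalDen y a := by
  unfold walkDen totalDen
  rw [pow_succ, mul_assoc]
  exact mul_dvd_mul_left _ (mul_dvd_mul_left _ (Dvd.intro_left _ rfl))

theorem stepDen_pow_dvd {l : ℕ} (hl : l ≤ (m + 1) * n ^ 17) :
    stepDen y a * stepDen y a ^ l ∣ totalDen y a := by
  rw [← pow_succ']
  exact (pow_dvd_pow _ (by omega)).mul_left _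

theorem iterations_le : (m + 1) * n ^ 17 ≤ inputSize y a lam ^ 18 := by
  have := add_two_le_inputSize y a lam
  calc _ ≤ inputSize y a lam * inputSize y a lam ^ 17 :=
        Nat.mul_le_mul (by omega) (Nat.pow_le_pow_left (by omega) _)
    _ = _ := by ring

theorem bitLength_le_budget (hn : 0 < n) (hy : ∀ i, y i ∈ Set.Icc (0 : ℚ) 1) {q : ℚ}
    (hq : OnGrid (totalDen y a) q) (hq' : |q| ≤ 2 ^ (20 * inputSize y a lam)) :
    bitLength q ≤ bitBudget (inputSize y a lam) := by
  have hnm := add_two_le_inputSize y a lam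
  have hK := iterations_le y a lam
  have hc := coefDen_le y a lam hy
  have hD := commonDen_le y a lam
  set L := inputSize y a lam with hL
  have hLL : L ≤ 2 ^ L := Nat.lt_two_pow_self.le
  refine hq.bitLength_le (Nat.mul_pos (pow_pos hn 5) (pow_pos (stepDen_pos y a) _)) ?_ hq'
  -- The exponent of the denominator bound enters `bitBudget` twice and `20 L` is the exponent of
  -- the size bound, as in `OnGrid.bitLength_le`.
  have hs : stepDen y a ≤ 2 ^ (5 * L + 7 * L ^ 2) := by
    calc stepDen y a ≤ 2 ^ (L + 7 * L ^ 2) * (2 ^ L) ^ 4 :=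
          Nat.mul_le_mul hc (Nat.pow_le_pow_left hD 4)
      _ = _ := by rw [← pow_mul, ← pow_add]; congr 1; ring
  calc totalDen y a ≤ (2 ^ L) ^ 5 * (2 ^ (5 * L + 7 * L ^ 2)) ^ ((m + 1) * n ^ 17 + 1) :=
        Nat.mul_le_mul (Nat.pow_le_pow_left (by omega) 5) (Nat.pow_le_pow_left hs _)
    _ = 2 ^ (5 * L + (5 * L + 7 * L ^ 2) * ((m + 1) * n ^ 17 + 1)) := by
        rw [← pow_mul, ← pow_mul, ← pow_add, mul_comm L 5]
    _ ≤ _ := by gcongr; norm_num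

end Instance

/-! ### All intermediate results fit into the bit budget -/

section Budget

variable {n m : ℕ} {y : Fin n → ℚ} {a : Fin m → Fin n → ℚ} {lam : Fin m → ℚ}

theorem bitLength_le_budget_of_dvd (hn : 0 < n) (hy : ∀ i, y i ∈ Set.Icc (0 : ℚ) 1) {q : ℚ}
    {D e : ℕ} (hq : OnGrid D q) (hD : D ∣ totalDen y a) (hq' : |q| ≤ 2 ^ e)
    (he : e ≤ 20 * inputSize y a lam) : bitLength q ≤ bitBudget (inputSize y a lam) :=
  bitLength_le_budget y a lam hn hy (hq.of_dvd hD)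
    (hq'.trans (pow_le_pow_right₀ (by norm_num) he))

theorem two_pow_bounds (y : Fin n → ℚ) (a : Fin m → Fin n → ℚ) (lam : Fin m → ℚ) :
    (n : ℚ) ≤ 2 ^ inputSize y a lam ∧ (m : ℚ) + 1 ≤ 2 ^ inputSize y a lam := by
  have h := add_two_le_inputSize y a lam
  have hLL : inputSize y a lam ≤ 2 ^ inputSize y a lam := Nat.lt_two_pow_self.le
  constructor
  · exact_mod_cast (by omega : n ≤ 2 ^ inputSize y a lam)
  · exact_mod_cast (by omega : m + 1 ≤ 2 ^ inputSize y a lam)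

/-- The three alternatives are the counters of the array loops, of the walk and of the gradient
iteration. -/
theorem bitLength_natCast_le (hn : 0 < n) (hy : ∀ i, y i ∈ Set.Icc (0 : ℚ) 1) {k : ℕ}
    (hk : k ≤ n + m + 2 ∨ k ≤ 4 * n ^ 10 ∨ k ≤ (m + 1) * n ^ 17) :
    bitLength (k : ℚ) ≤ bitBudget (inputSize y a lam) := by
  refine bitLength_le_budget_of_dvd (a := a) hn hy (OnGrid.natCast 1 k) (one_dvd _)
    (e := 20 * inputSize y a lam) ?_ le_rfl
  obtain ⟨h1, h2⟩ := two_pow_bounds y a lam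
  have hnm := add_two_le_inputSize y a lam
  set L := inputSize y a lam
  have h1' : n ≤ 2 ^ L := by exact_mod_cast h1
  have h2' : m + 1 ≤ 2 ^ L := by exact_mod_cast h2
  have hk' : k ≤ 2 ^ (20 * L) := by
    rcases hk with hk | hk | hk
    · refine hk.trans (hnm.trans (Nat.lt_two_pow_self.le.trans ?_))
      exact Nat.pow_le_pow_right two_pos (by omega)
    · calc k ≤ 2 ^ 2 * (2 ^ L) ^ 10 :=
            hk.trans (Nat.mul_le_mul le_rfl (Nat.pow_le_pow_left h1' _))
        _ = 2 ^ (2 + 10 * L) := by rw [← pow_mul, ← pow_add, mul_comm L 10]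
        _ ≤ _ := Nat.pow_le_pow_right two_pos (by omega)
    · calc k ≤ 2 ^ L * (2 ^ L) ^ 17 :=
            hk.trans (Nat.mul_le_mul h2' (Nat.pow_le_pow_left h1' _))
        _ = 2 ^ (L + 17 * L) := by rw [← pow_mul, ← pow_add, mul_comm L 17]
        _ ≤ _ := Nat.pow_le_pow_right two_pos (by omega)
  rw [Nat.abs_cast]
  exact_mod_cast hk'

theorem commonDen_pow_dvd {k : ℕ} (hk : k ≤ 4) : commonDen y a ^ k ∣ totalDen y a :=
  ((pow_dvd_pow _ hk).trans (dvd_mul_left _ _)).trans (walkDen_dvd y a)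

theorem bitLength_offset_le (hn : 0 < n) (hy : ∀ i, y i ∈ Set.Icc (0 : ℚ) 1) (i : Fin n) :
    bitLength (offset (y i)) ≤ bitBudget (inputSize y a lam) :=
  bitLength_le_budget_of_dvd hn hy ((onGrid_offset y a i).of_dvd (dvd_of_eq (pow_one _).symm))
    (commonDen_pow_dvd (k := 1) (by norm_num)) (e := 0)
    (by simpa using abs_offset_le (hy i)) (Nat.zero_le _)

theorem bitLength_sum_sq_le (hn : 0 < n) (hy : ∀ i, y i ∈ Set.Icc (0 : ℚ) 1) (j : Fin m)
    (S : Finset (Fin n)) :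
    bitLength (∑ i ∈ S, scaled y a j i * scaled y a j i) ≤ bitBudget (inputSize y a lam) := by
  have hb := abs_scaled_le y a lam hy j
  have h1 := (two_pow_bounds y a lam).1
  refine bitLength_le_budget_of_dvd hn hy (OnGrid.sum S _ fun i _ => onGrid_scaled_mul y a j i)
    (commonDen_pow_dvd le_rfl) (e := 3 * inputSize y a lam) ?_ (by omega)
  set L := inputSize y a lam
  refine (abs_sum_le_card_mul S _ (V := 2 ^ L * 2 ^ L) fun i => ?_).trans ?_
  · rw [abs_mul]
    exact mul_le_mul (hb i) (hb i) (abs_nonneg _) (by positivity)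
  · rw [Fintype.card_fin]
    calc _ ≤ (2 : ℚ) ^ L * (2 ^ L * 2 ^ L) := by gcongr
      _ = _ := by ring

theorem bitLength_sum_mul_walk_le (hn : 0 < n) (hy : ∀ i, y i ∈ Set.Icc (0 : ℚ) 1)
    (ω : ℕ → Bool) (s : ℕ) (j : Fin m) (S : Finset (Fin n)) :
    bitLength (∑ i ∈ S, scaled y a j i * walk (scaled y a) lam ω s i) ≤
      bitBudget (inputSize y a lam) := by
  have hb := abs_scaled_le y a lam hy j
  have h1 := (two_pow_bounds y a lam).1
  refine bitLength_le_budget_of_dvd hn hy (OnGrid.sum S _ fun i _ =>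
    (onGrid_scaled y a j i).mul (onGrid_walk y a lam ω s i)) (?_ : _ ∣ totalDen y a)
    (e := 2 * inputSize y a lam) ?_ (by omega)
  · refine dvd_trans ?_ (walkDen_dvd y a)
    rw [mul_comm]
    exact mul_dvd_mul_left _ (pow_dvd_pow _ (by norm_num))
  set L := inputSize y a lam
  refine (abs_sum_le_card_mul S _ (V := 2 ^ L) fun i => ?_).trans ?_
  · rw [abs_mul]
    exact (mul_le_of_le_one_right (abs_nonneg _) (abs_walk_le _ _ _ _ _)).trans (hb i)
  · rw [Fintype.card_fin]
    calc _ ≤ (2 : ℚ) ^ L * 2 ^ L := by gcongr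
      _ = _ := by ring

theorem bitLength_coef_le (hn : 0 < n) (hy : ∀ i, y i ∈ Set.Icc (0 : ℚ) 1) (x : Fin n → ℚ)
    (j : Fin m) : bitLength (coef (scaled y a) lam x j) ≤ bitBudget (inputSize y a lam) := by
  refine bitLength_le_budget_of_dvd hn hy (onGrid_coef y a lam x j) (?_ : _ ∣ totalDen y a)
    (abs_coef_le y a lam x j) (by omega)
  refine dvd_trans ?_ (stepDen_pow_dvd y a (Nat.zero_le _))
  rw [pow_zero, mul_one]
  exact dvd_mul_right _ _

theorem bitLength_dirIter_le (hn : 0 < n) (hy : ∀ i, y i ∈ Set.Icc (0 : ℚ) 1) (x : Fin n → ℚ)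
    (ρ : Fin n → Bool) {l : ℕ} (hl : l ≤ (m + 1) * n ^ 17) (i : Fin n) :
    bitLength (dirIter (scaled y a) lam x (fun i => bitSign (ρ i)) l i) ≤
      bitBudget (inputSize y a lam) :=
  bitLength_le_budget_of_dvd hn hy (onGrid_dirIter y a lam (fun i => onGrid_bitSign 1 _) l i)
    ((dvd_mul_left _ _).trans (stepDen_pow_dvd y a hl))
    ((abs_dirIter_le lam _ x (fun _ => bitSign_sq _) l i).trans (two_pow_bounds y a lam).1)
    (by omega)

theorem abs_rowDot_le (hy : ∀ i, y i ∈ Set.Icc (0 : ℚ) 1) (x : Fin n → ℚ)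
    (ρ : Fin n → Bool) (l : ℕ) (j : Fin m) (S : Finset (Fin n)) :
    |∑ i ∈ S, freeRows (scaled y a) x j i *
      dirIter (scaled y a) lam x (fun i => bitSign (ρ i)) l i| ≤ 2 ^ (3 * inputSize y a lam) := by
  have h1 := (two_pow_bounds y a lam).1
  set L := inputSize y a lam
  refine (abs_sum_le_card_mul S _ (V := 2 ^ L * 2 ^ L) fun i => ?_).trans ?_
  · rw [abs_mul]
    exact mul_le_mul (abs_freeRows_le y a lam hy x j i)
      ((abs_dirIter_le lam _ x (fun _ => bitSign_sq _) l i).trans h1) (abs_nonneg _)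
      (by positivity)
  · rw [Fintype.card_fin]
    calc _ ≤ (2 : ℚ) ^ L * (2 ^ L * 2 ^ L) := by gcongr
      _ = _ := by ring

theorem bitLength_rowDot_le (hn : 0 < n) (hy : ∀ i, y i ∈ Set.Icc (0 : ℚ) 1) (x : Fin n → ℚ)
    (ρ : Fin n → Bool) {l : ℕ} (hl : l ≤ (m + 1) * n ^ 17) (j : Fin m) (S : Finset (Fin n)) :
    bitLength (∑ i ∈ S, freeRows (scaled y a) x j i *
      dirIter (scaled y a) lam x (fun i => bitSign (ρ i)) l i) ≤
      bitBudget (inputSize y a lam) := by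
  refine bitLength_le_budget_of_dvd hn hy (onGrid_rowDot y a
    (onGrid_dirIter y a lam (fun i => onGrid_bitSign 1 _) l) x j S) (?_ : _ ∣ totalDen y a)
    (abs_rowDot_le hy x ρ l j S) (by omega)
  refine dvd_trans (mul_dvd_mul_right ?_ _) (stepDen_pow_dvd y a hl)
  exact (pow_dvd_pow _ (by norm_num)).mul_left _

theorem abs_rowCoef_le (hy : ∀ i, y i ∈ Set.Icc (0 : ℚ) 1) (x : Fin n → ℚ)
    (ρ : Fin n → Bool) (l : ℕ) (j : Fin m) :
    |coef (scaled y a) lam x j * (freeRows (scaled y a) x j ⬝ᵥ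
      dirIter (scaled y a) lam x (fun i => bitSign (ρ i)) l)| ≤
        2 ^ (7 * inputSize y a lam) := by
  rw [abs_mul]
  calc _ ≤ (2 : ℚ) ^ (4 * inputSize y a lam) * 2 ^ (3 * inputSize y a lam) :=
        mul_le_mul (abs_coef_le y a lam x j) (abs_rowDot_le hy x ρ l j Finset.univ)
          (abs_nonneg _) (by positivity)
    _ = _ := by ring

theorem bitLength_rowCoef_le (hn : 0 < n) (hy : ∀ i, y i ∈ Set.Icc (0 : ℚ) 1) (x : Fin n → ℚ)
    (ρ : Fin n → Bool) {l : ℕ} (hl : l ≤ (m + 1) * n ^ 17) (j : Fin m) :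
    bitLength (coef (scaled y a) lam x j * (freeRows (scaled y a) x j ⬝ᵥ
      dirIter (scaled y a) lam x (fun i => bitSign (ρ i)) l)) ≤
        bitBudget (inputSize y a lam) := by
  refine bitLength_le_budget_of_dvd hn hy (onGrid_rowCoef y a lam
    (onGrid_dirIter y a lam (fun i => onGrid_bitSign 1 _) l) x j) (?_ : _ ∣ totalDen y a)
    (abs_rowCoef_le hy x ρ l j) (by omega)
  refine dvd_trans ?_ (stepDen_pow_dvd y a hl)
  rw [← mul_assoc]
  exact mul_dvd_mul_right (mul_dvd_mul_left _ (pow_dvd_pow _ (by norm_num))) _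

theorem bitLength_gradient_le (hn : 0 < n) (hy : ∀ i, y i ∈ Set.Icc (0 : ℚ) 1) (x : Fin n → ℚ)
    (ρ : Fin n → Bool) {l : ℕ} (hl : l ≤ (m + 1) * n ^ 17) (i : Fin n) (S : Finset (Fin m)) :
    bitLength (∑ j ∈ S, coef (scaled y a) lam x j * (freeRows (scaled y a) x j ⬝ᵥ
      dirIter (scaled y a) lam x (fun i => bitSign (ρ i)) l) * freeRows (scaled y a) x j i) ≤
        bitBudget (inputSize y a lam) := by
  refine bitLength_le_budget_of_dvd hn hy (onGrid_gradient y a lam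
    (onGrid_dirIter y a lam (fun i => onGrid_bitSign 1 _) l) x i S) (stepDen_pow_dvd y a hl)
    (e := 9 * inputSize y a lam) ?_ (by omega)
  have h1 := (two_pow_bounds y a lam).2
  set L := inputSize y a lam
  refine (abs_sum_le_card_mul S _ (V := 2 ^ (7 * L) * 2 ^ L) fun j => ?_).trans ?_
  · rw [abs_mul]
    exact mul_le_mul (abs_rowCoef_le hy x ρ l j) (abs_freeRows_le y a lam hy x j i)
      (abs_nonneg _) (by positivity)
  · rw [Fintype.card_fin]
    calc _ ≤ (2 : ℚ) ^ L * (2 ^ (7 * L) * 2 ^ L) := by gcongr; linarith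
      _ = _ := by ring

theorem bitLength_walk_le (hn : 0 < n) (hy : ∀ i, y i ∈ Set.Icc (0 : ℚ) 1)
    (ω : ℕ → Bool) (s : ℕ) (i : Fin n) :
    bitLength (walk (scaled y a) lam ω s i) ≤ bitBudget (inputSize y a lam) :=
  bitLength_le_budget_of_dvd hn hy (onGrid_walk y a lam ω s i)
    ((dvd_mul_right _ _).trans (walkDen_dvd y a)) (e := 0)
    (by simpa using abs_walk_le _ _ _ _ _) (Nat.zero_le _)

theorem bitLength_sign_le (hn : 0 < n) (hy : ∀ i, y i ∈ Set.Icc (0 : ℚ) 1) {q : ℚ}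
    (hq : q = 0 ∨ q = 1 ∨ q = -1) : bitLength q ≤ bitBudget (inputSize y a lam) := by
  refine bitLength_le_budget_of_dvd (a := a) hn hy (D := 1) ?_ (one_dvd _) (e := 0) ?_
    (Nat.zero_le _)
  · rcases hq with rfl | rfl | rfl
    exacts [OnGrid.zero _, OnGrid.one _, (OnGrid.one _).neg]
  · rcases hq with rfl | rfl | rfl <;> norm_num

theorem bitLength_sum_sign_le (hn : 0 < n) (hy : ∀ i, y i ∈ Set.Icc (0 : ℚ) 1)
    (x : Fin n → ℚ) (S : Finset (Fin n)) :
    bitLength (∑ i ∈ S, (1 - free x i) * (if 0 ≤ x i then 1 else -1)) ≤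
      bitBudget (inputSize y a lam) := by
  have hterm : ∀ i, (1 - free x i) * (if 0 ≤ x i then 1 else -1) = 0 ∨
      (1 - free x i) * (if 0 ≤ x i then 1 else -1) = 1 ∨
      (1 - free x i) * (if 0 ≤ x i then 1 else -1) = -1 := by
    intro i
    rcases free_eq_or x i with h | h <;> rw [h] <;> split_ifs <;> norm_num
  refine bitLength_le_budget_of_dvd (a := a) hn hy (OnGrid.sum S _ fun i _ => ?_) (one_dvd _)
    (e := inputSize y a lam) ?_ (by omega)
  · rcases hterm i with h | h | h <;> rw [h]
    exacts [OnGrid.zero _, OnGrid.one _, (OnGrid.one _).neg]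
  · refine (abs_sum_le_card_mul S _ (V := 1) fun i => ?_).trans ?_
    · rcases hterm i with h | h | h <;> rw [h] <;> norm_num
    · rw [Fintype.card_fin, mul_one]
      exact (two_pow_bounds y a lam).1

theorem bitLength_roundedPoint_le (hn : 0 < n) (hy : ∀ i, y i ∈ Set.Icc (0 : ℚ) 1)
    (ω : ℕ → Bool) (s : ℕ) (i : Fin n) :
    bitLength (roundedPoint y (walk (scaled y a) lam ω s) i) ≤
      bitBudget (inputSize y a lam) := by
  set x := walk (scaled y a) lam ω s with hx
  have hgs : ∀ D, OnGrid D (if 0 ≤ x i then (1 : ℚ) else -1) := by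
    intro D
    split_ifs
    exacts [OnGrid.one _, (OnGrid.one _).neg]
  have hgo : OnGrid 1 (orientation x) := by
    unfold orientation
    split_ifs
    exacts [OnGrid.one _, (OnGrid.one _).neg]
  have hsnap : OnGrid (walkDen y a) (snap x i) := by
    have h1 := (onGrid_free 1 x i).mul (onGrid_walk y a lam ω s i)
    have h2 := ((OnGrid.one 1).sub (onGrid_free 1 x i)).mul (hgs (walkDen y a))
    rw [one_mul] at h1 h2
    exact h1.add h2
  have hd : commonDen y a * walkDen y a ∣ totalDen y a := by
    refine dvd_trans ?_ (walkDen_dvd y a)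
    rw [mul_comm]
    exact mul_dvd_mul_left _ (dvd_pow_self _ (by norm_num))
  have hg : OnGrid (totalDen y a) (roundedPoint y x i) := by
    have h1 := (hgo.mul (onGrid_offset y a i)).mul hsnap
    rw [one_mul] at h1
    exact ((onGrid_y y a i).of_dvd ((dvd_mul_right _ _).trans hd)).sub (h1.of_dvd hd)
  refine bitLength_le_budget_of_dvd hn hy hg dvd_rfl (e := 1) ?_ ?_
  · have h1 : |snap x i| ≤ 1 := by
      unfold snap
      rcases free_eq_or x i with h | h <;> rw [h]
      · split_ifs <;> simp
      · simpa using abs_walk_le _ _ _ _ _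
    have h2 : |orientation x| ≤ 1 := by unfold orientation; split_ifs <;> simp
    have h3 := abs_offset_le (hy i)
    have h4 : |orientation x * offset (y i) * snap x i| ≤ 1 := by
      rw [abs_mul, abs_mul]
      exact mul_le_one₀ (mul_le_one₀ h2 (abs_nonneg _) h3) (abs_nonneg _) h1
    have h5 : |y i| ≤ 1 := by rw [abs_le]; constructor <;> linarith [(hy i).1, (hy i).2]
    unfold roundedPoint
    have := abs_sub (y i) (orientation x * offset (y i) * snap x i)
    rw [pow_one]
    linarith
  · have := add_two_le_inputSize y a lam
    omega

end Budget

/-! ## The program -/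

theorem exec_mapSum_fin {ω : ℕ → Bool} {out : ℕ} {bN bM e f : Expr} {s : State} {B N M R : ℕ}
    (v : Fin N → Fin M → ℚ) (w : Fin N → ℚ) (h20 : out ≠ 20) (h21 : out ≠ 21) (h22 : out ≠ 22)
    (hB : BitBounded B s.mem)
    (hN : ∀ μ, Agree out s.mem μ → bN.eval μ = N)
    (hM : ∀ μ, Agree out s.mem μ → bM.eval μ = M)
    (he : ∀ μ, Agree out s.mem μ → ∀ (j : Fin N) (i : Fin M), μ 22 0 = (j : ℕ) →
      μ 20 0 = (i : ℕ) → e.eval μ = v j i)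
    (hf : ∀ μ, Agree out s.mem μ → ∀ j : Fin N, μ 22 0 = (j : ℕ) →
      μ 21 0 = ∑ i, v j i → μ out j = s.mem out j → f.eval μ = w j)
    (hNR : N < R) (hMR : M < R) (hR : ∀ k < R, bitLength (k : ℚ) ≤ B)
    (hvB : ∀ j (S : Finset (Fin M)), bitLength (∑ i ∈ S, v j i) ≤ B)
    (hwB : ∀ j, bitLength (w j) ≤ B) :
    ∃ s' t, Exec ω (mapSum out bN bM e f) s s' t ∧
      t ≤ mapSumWeight bN bM e f * (2 * R ^ 2 * B ^ 2) ∧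
      s'.used = s.used ∧ BitBounded B s'.mem ∧ Agree out s.mem s'.mem ∧
      ∀ j : Fin N, s'.mem out j = w j := by
  -- Partial sums become sums over subsets of `Fin M`, which is why `hvB` speaks of arbitrary finite
  -- sets.
  have hpart : ∀ (j : ℕ) (hj : j < N) (k : ℕ), k ≤ M →
      ∑ i ∈ Finset.range k, (if h : j < N ∧ i < M then v ⟨j, h.1⟩ ⟨i, h.2⟩ else 0) =
        ∑ i ∈ Finset.univ.filter fun i : Fin M => (i : ℕ) < k, v ⟨j, hj⟩ i := by
    intro j hj k hk
    rw [Finset.sum_filter]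
    have h1 := Fin.sum_univ_eq_sum_range
      (fun i => if i < k then (if h : j < N ∧ i < M then v ⟨j, h.1⟩ ⟨i, h.2⟩ else 0) else 0) M
    have h2 : ∑ i ∈ Finset.range k, (if h : j < N ∧ i < M then v ⟨j, h.1⟩ ⟨i, h.2⟩ else 0) =
        ∑ i ∈ Finset.range M, (if i < k then
          (if h : j < N ∧ i < M then v ⟨j, h.1⟩ ⟨i, h.2⟩ else 0) else 0) := by
      rw [← Finset.sum_filter]
      congr 1
      ext i
      simp only [Finset.mem_range, Finset.mem_filter]
      omega
    rw [h2, ← h1]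
    refine Finset.sum_congr rfl fun i _ => ?_
    simp [hj]
  obtain ⟨s', t, h1, h2, h3, h4, h5, h6⟩ := exec_mapSum (ω := ω) (out := out) (bN := bN)
    (bM := bM) (e := e) (f := f) (s := s) (B := B) (N := N) (M := M)
    (fun j i => if h : j < N ∧ i < M then v ⟨j, h.1⟩ ⟨i, h.2⟩ else 0)
    (fun j => if h : j < N then w ⟨j, h⟩ else 0) h20 h21 h22 hB hN hM
    (fun μ hμ j hj i hi hjμ hiμ => by
      simpa [hj, hi] using he μ hμ ⟨j, hj⟩ ⟨i, hi⟩ hjμ hiμ)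
    (fun μ hμ j hj hjμ hsum hout => by
      rw [hpart j hj M le_rfl] at hsum
      have := hf μ hμ ⟨j, hj⟩ hjμ (by rw [hsum]; exact Finset.sum_congr (by simp) fun _ _ => rfl)
        hout
      simpa [hj] using this)
    (fun i hi => hR i (by omega)) (fun i hi => hR i (by omega))
    (fun j hj k hk => by rw [hpart j hj k hk]; exact hvB _ _)
    (fun j hj => by simpa [hj] using hwB ⟨j, hj⟩)
  refine ⟨s', t, h1, h2.trans ?_, h3, h4, h5, fun j => ?_⟩
  · have : (N + 1) * (M + 1) ≤ R ^ 2 := by rw [sq]; exact Nat.mul_le_mul hNR hMR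
    calc _ = (N + 1) * (M + 1) * (2 * (mapSumWeight bN bM e f * B ^ 2)) := by ring
      _ ≤ R ^ 2 * (2 * (mapSumWeight bN bM e f * B ^ 2)) := Nat.mul_le_mul_right _ this
      _ = _ := by ring
  · rw [h6]; simp

/-! ### Notation and evaluation of expressions -/

instance : Add Expr := ⟨.op .add⟩
instance : Sub Expr := ⟨.op .sub⟩
instance : Mul Expr := ⟨.op .mul⟩
instance : Div Expr := ⟨.op .div⟩

@[simp] theorem eval_add (e f : Expr) (μ : Memory) :
    (e + f).eval μ = e.eval μ + f.eval μ := rfl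

@[simp] theorem eval_sub (e f : Expr) (μ : Memory) :
    (e - f).eval μ = e.eval μ - f.eval μ := rfl

@[simp] theorem eval_mul (e f : Expr) (μ : Memory) :
    (e * f).eval μ = e.eval μ * f.eval μ := rfl

@[simp] theorem eval_div (e f : Expr) (μ : Memory) :
    (e / f).eval μ = e.eval μ / f.eval μ := rfl

@[simp] theorem eval_const (q : ℚ) (μ : Memory) : (Expr.const q).eval μ = q := rfl

@[simp] theorem eval_read (b : ℕ) (e : Expr) (μ : Memory) :
    (Expr.read b e).eval μ = μ b ⌊e.eval μ⌋₊ := rfl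

@[simp] theorem eval_le (e f : Expr) (μ : Memory) :
    (Expr.op .le e f).eval μ = if e.eval μ ≤ f.eval μ then 1 else 0 := rfl

/-- The power of an expression. -/
def powExpr (e : Expr) : ℕ → Expr
  | 0 => .const 1
  | k + 1 => powExpr e k * e

@[simp] theorem eval_powExpr (e : Expr) (k : ℕ) (μ : Memory) :
    (powExpr e k).eval μ = e.eval μ ^ k := by
  induction k with
  | zero => simp [powExpr]
  | succ k ih => simp [powExpr, ih, pow_succ]

@[simp] theorem floor_index (i n j : ℕ) : ⌊(i : ℚ) + n * j⌋₊ = i + n * j := by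
  exact_mod_cast Nat.floor_natCast (R := ℚ) (i + n * j)

/-- The number of columns. -/
def colsExpr : Expr := cell 0

/-- The number of rows. -/
def rowsExpr : Expr := .read 0 (.const 1)

/-- The entry of the scaled matrix. -/
def entryExpr (j i : Expr) : Expr := .read 2 (i + colsExpr * j) * .read 5 i

/-- The sign of an expression. -/
def signExpr (e : Expr) : Expr := .const 2 * .op .le (.const 0) e - .const 1

@[simp] theorem eval_signExpr (e : Expr) (μ : Memory) :
    (signExpr e).eval μ = if 0 ≤ e.eval μ then 1 else -1 := by
  unfold signExpr
  simp only [eval_sub, eval_mul, eval_const, eval_le]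
  split_ifs with h <;> simp only [h, if_true, if_false] <;> norm_num

/-- Array `5` receives the signed distances of `y` to the integers. -/
def offsetProgram : Program :=
  mapSum 5 colsExpr (.const 0) (.const 0)
    (.read 1 (cell 22) - .const 1 + .op .le (.read 1 (cell 22)) (.const (1 / 2)))

/-- Array `7` receives the squared norms of the scaled rows. -/
def squaresProgram : Program :=
  mapSum 7 rowsExpr colsExpr
    (entryExpr (cell 22) (cell 20) * entryExpr (cell 22) (cell 20)) (cell 21)

/-- Array `13` receives fresh random bits. -/
def flipProgram : Program := forLoop 20 colsExpr (.flip 13 (cell 20))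

/-- Array `9` receives the indicator of the free coordinates of array `8`. -/
def freeProgram : Program :=
  mapSum 9 colsExpr (.const 0) (.const 0)
    (.op .le (.read 8 (cell 22)) (.const 1 - .const 1 / powExpr colsExpr 4) *
      .op .le (.const 1 / powExpr colsExpr 4 - .const 1) (.read 8 (cell 22)))

/-- Array `6` receives the coefficients of the tight rows. -/
def coefProgram : Program :=
  mapSum 6 rowsExpr colsExpr (entryExpr (cell 22) (cell 20) * .read 8 (cell 20))
    ((.const 1 - .op .le (cell 21 * cell 21)
        (.read 3 (cell 22) * .read 3 (cell 22) * .read 7 (cell 22))) *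
      (.const 1 / ((rowsExpr + .const 1) * .read 7 (cell 22))))

/-- Array `10` receives the random signs of the free coordinates. -/
def startProgram : Program :=
  mapSum 10 colsExpr (.const 0) (.const 0)
    (.read 9 (cell 22) * (.const 2 * .read 13 (cell 22) - .const 1))

/-- Array `12` receives the coefficients of the gradient at array `10`. -/
def rowCoefProgram : Program :=
  mapSum 12 rowsExpr colsExpr
    (.read 9 (cell 20) * entryExpr (cell 22) (cell 20) * .read 10 (cell 20))
    (.read 6 (cell 22) * cell 21)

/-- The gradient is subtracted from array `10`. -/
def subtractProgram : Program :=
  mapSum 10 colsExpr rowsExpr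
    (.read 12 (cell 20) * (.read 9 (cell 22) * entryExpr (cell 20) (cell 22)))
    (.read 10 (cell 22) - cell 21)

/-- The number of gradient steps. -/
def iterationsExpr : Expr := (rowsExpr + .const 1) * powExpr colsExpr 17

/-- Array `10` receives the direction of the next step of the walk. -/
def directionProgram : Program :=
  forLoop 23 iterationsExpr (.seq rowCoefProgram subtractProgram)

/-- Array `8` is moved in direction of array `10`. -/
def moveProgram : Program :=
  mapSum 8 colsExpr (.const 0) (.const 0)
    (.read 8 (cell 22) + .const 1 / powExpr colsExpr 5 * .read 10 (cell 22))

/-- A step of the walk. -/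
def stepProgram : Program :=
  .seq flipProgram (.seq freeProgram (.seq coefProgram (.seq startProgram
    (.seq directionProgram moveProgram))))

/-- The walk. -/
def walkProgram : Program := forLoop 24 (.const 4 * powExpr colsExpr 10) stepProgram

/-- Cell `0` of array `14` receives the majority sign. -/
def orientationProgram : Program :=
  mapSum 14 (.const 1) colsExpr
    ((.const 1 - .read 9 (cell 20)) * signExpr (.read 8 (cell 20))) (signExpr (cell 21))

/-- Array `4` receives the rounded point. -/
def outputProgram : Program :=
  mapSum 4 colsExpr (.const 0) (.const 0)
    (.read 1 (cell 22) - cell 14 * .read 5 (cell 22) *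
      (.read 9 (cell 22) * .read 8 (cell 22) +
        (.const 1 - .read 9 (cell 22)) * signExpr (.read 8 (cell 22))))

/-- The partial rounding algorithm. -/
def roundingProgram : Program :=
  .seq offsetProgram (.seq squaresProgram (.seq walkProgram (.seq freeProgram
    (.seq orientationProgram outputProgram))))

/-! ### Invariants of the memory -/

section Correctness

variable {n m : ℕ} {y : Fin n → ℚ} {a : Fin m → Fin n → ℚ} {lam : Fin m → ℚ}

/-- The memory holds the input. -/
structure Holds (y : Fin n → ℚ) (a : Fin m → Fin n → ℚ) (lam : Fin m → ℚ) (μ : Memory) :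
    Prop where
  cols : μ 0 0 = n
  rows : μ 0 1 = m
  point : ∀ i : Fin n, μ 1 i = y i
  matrix : ∀ (j : Fin m) (i : Fin n), μ 2 (i + n * j) = a j i
  slack : ∀ j : Fin m, μ 3 j = lam j

/-- The memory holds the input and the data that are computed from it once. -/
structure Prepared (y : Fin n → ℚ) (a : Fin m → Fin n → ℚ) (lam : Fin m → ℚ) (μ : Memory) :
    Prop extends Holds y a lam μ where
  offset : ∀ i : Fin n, μ 5 i = offset (y i)
  squares : ∀ j : Fin m, μ 7 j = scaled y a j ⬝ᵥ scaled y a j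

theorem holds_inputMemory : Holds y a lam (inputMemory y a lam) where
  cols := by simp [inputMemory]
  rows := by simp [inputMemory]
  point i := by simp [inputMemory]
  matrix j i := by
    have h : (i : ℕ) + n * j < m * n := by
      have := (finProdFinEquiv (j, i)).isLt
      simpa using this
    have h2 : (⟨i + n * j, h⟩ : Fin (m * n)) = finProdFinEquiv (j, i) := by
      ext; simp
    simp only [inputMemory, h, dif_pos, h2, Equiv.symm_apply_apply]
  slack j := by simp [inputMemory]

theorem bitBounded_inputMemory : BitBounded (inputSize y a lam) (inputMemory y a lam) := by
  have hL := add_two_le_inputSize y a lam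
  have h0 : bitLength 0 ≤ inputSize y a lam := by
    have : bitLength 0 = 2 := by simp [bitLength]
    omega
  intro b k
  unfold inputMemory
  split
  · unfold inputSize; omega
  · unfold inputSize; omega
  · split_ifs
    · exact bitLength_y_le y a lam _
    · exact h0
  · split_ifs
    · exact bitLength_a_le y a lam _ _
    · exact h0
  · split_ifs
    · exact bitLength_lam_le y a lam _
    · exact h0
  · exact h0

theorem Holds.agree {μ μ' : Memory} {out : ℕ} (h : Holds y a lam μ) (hag : Agree out μ μ')
    (ho : 4 ≤ out) : Holds y a lam μ' := by
  have hb : ∀ b ≤ 3, μ' b = μ b := fun b hb =>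
    hag b (by omega) (by omega) (by omega) (by omega)
  obtain ⟨h1, h2, h3, h4, h5⟩ := h
  refine ⟨?_, ?_, ?_, ?_, ?_⟩
  · rw [hb 0 (by omega), h1]
  · rw [hb 0 (by omega), h2]
  · intro i; rw [hb 1 (by omega), h3]
  · intro j i; rw [hb 2 (by omega), h4]
  · intro j; rw [hb 3 (by omega), h5]

theorem Prepared.agree {μ μ' : Memory} {out : ℕ} (h : Prepared y a lam μ)
    (hag : Agree out μ μ') (ho : 4 ≤ out) (h5 : out ≠ 5) (h7 : out ≠ 7) :
    Prepared y a lam μ' := by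
  refine ⟨h.toHolds.agree hag ho, fun i => ?_, fun j => ?_⟩
  · rw [hag 5 (by omega) (by omega) (by omega) (by omega), h.offset]
  · rw [hag 7 (by omega) (by omega) (by omega) (by omega), h.squares]

theorem eval_colsExpr {μ : Memory} (h : Holds y a lam μ) : colsExpr.eval μ = n := by
  simp [colsExpr, h.cols]

theorem eval_rowsExpr {μ : Memory} (h : Holds y a lam μ) : rowsExpr.eval μ = m := by
  simp [rowsExpr, h.rows]

theorem eval_entryExpr {μ : Memory} (h : Holds y a lam μ)
    (ho : ∀ i : Fin n, μ 5 i = offset (y i)) {e f : Expr} {j : Fin m} {i : Fin n}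
    (he : e.eval μ = (j : ℕ)) (hf : f.eval μ = (i : ℕ)) :
    (entryExpr e f).eval μ = scaled y a j i := by
  simp [entryExpr, eval_colsExpr h, he, hf, h.matrix, ho, scaled]

/-- The unit in which the times of the parts of the program are measured. -/
def timeUnit (L : ℕ) : ℕ := 2 * (L + 1) ^ 2 * bitBudget L ^ 2

theorem loop_le_timeUnit (L N w : ℕ) : (N + 1) * (w * bitBudget L ^ 2) ≤
    (N + 1) * (w * timeUnit L) := by
  refine Nat.mul_le_mul_left _ (Nat.mul_le_mul_left _ ?_)
  unfold timeUnit
  exact Nat.le_mul_of_pos_left _ (by positivity)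

/-- All memory cells of the state respect the bit budget of the input. -/
abbrev Fits (y : Fin n → ℚ) (a : Fin m → Fin n → ℚ) (lam : Fin m → ℚ) (s : State) : Prop :=
  BitBounded (bitBudget (inputSize y a lam)) s.mem

/-- `exec_mapSum_fin` with the bounds for an input. -/
theorem exec_fill (hn : 0 < n) (hy : ∀ i, y i ∈ Set.Icc (0 : ℚ) 1) {ω : ℕ → Bool} {out : ℕ}
    {bN bM e f : Expr} {s : State} {N M : ℕ}
    (v : Fin N → Fin M → ℚ) (w : Fin N → ℚ) (ho : 4 ≤ out ∧ out < 20)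
    (hB : Fits y a lam s) (hs : Holds y a lam s.mem)
    (hN : ∀ μ, Holds y a lam μ → bN.eval μ = N)
    (hM : ∀ μ, Holds y a lam μ → bM.eval μ = M)
    (he : ∀ μ, Agree out s.mem μ → Holds y a lam μ → ∀ (j : Fin N) (i : Fin M),
      μ 22 0 = (j : ℕ) → μ 20 0 = (i : ℕ) → e.eval μ = v j i)
    (hf : ∀ μ, Agree out s.mem μ → Holds y a lam μ → ∀ j : Fin N, μ 22 0 = (j : ℕ) →
      μ 21 0 = ∑ i, v j i → μ out j = s.mem out j → f.eval μ = w j)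
    (hNM : N ≤ n + m + 1 ∧ M ≤ n + m + 1)
    (hvB : ∀ j (S : Finset (Fin M)), bitLength (∑ i ∈ S, v j i) ≤ bitBudget (inputSize y a lam))
    (hwB : ∀ j, bitLength (w j) ≤ bitBudget (inputSize y a lam)) :
    ∃ s' t, Exec ω (mapSum out bN bM e f) s s' t ∧
      t ≤ mapSumWeight bN bM e f * timeUnit (inputSize y a lam) ∧
      s'.used = s.used ∧ Fits y a lam s' ∧ Agree out s.mem s'.mem ∧
      ∀ j : Fin N, s'.mem out j = w j := by
  have hL := add_two_le_inputSize y a lam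
  obtain ⟨s', t, h1, h2, h3⟩ := exec_mapSum_fin (ω := ω) (bN := bN) (bM := bM) (e := e) (f := f)
    (R := n + m + 2) v w (by omega) (by omega) (by omega) hB
    (fun μ hμ => hN μ (hs.agree hμ ho.1)) (fun μ hμ => hM μ (hs.agree hμ ho.1))
    (fun μ hμ => he μ hμ (hs.agree hμ ho.1)) (fun μ hμ => hf μ hμ (hs.agree hμ ho.1))
    (by omega) (by omega) (fun k hk => bitLength_natCast_le hn hy (Or.inl hk.le)) hvB hwB
  refine ⟨s', t, h1, h2.trans (Nat.mul_le_mul_left _ ?_), h3⟩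
  unfold timeUnit
  exact Nat.mul_le_mul_right _ (Nat.mul_le_mul_left _ (Nat.pow_le_pow_left (by omega) 2))

theorem bitLength_empty_sum_le (hn : 0 < n) (hy : ∀ i, y i ∈ Set.Icc (0 : ℚ) 1) {N : ℕ}
    (v : Fin N → Fin 0 → ℚ) (j : Fin N) (S : Finset (Fin 0)) :
    bitLength (∑ i ∈ S, v j i) ≤ bitBudget (inputSize y a lam) := by
  rw [Finset.eq_empty_of_isEmpty S, Finset.sum_empty]
  exact bitLength_sign_le hn hy (Or.inl rfl)

end Correctness

/-! ## Correctness of the parts of the program -/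

theorem Agree.read {out : ℕ} {μ μ' : Memory} (h : Agree out μ μ') {b : ℕ} (hb : b < 20 ∨ 22 < b)
    (ho : b ≠ out) : μ' b = μ b := h b (by omega) (by omega) (by omega) ho

/-- Here and below `C` is chosen before the instance, since it depends only on the program text. All
dependence on the input is in `timeUnit` and in loop lengths. -/
theorem exec_offsetProgram : ∃ C : ℕ, ∀ {n m : ℕ} {y : Fin n → ℚ} {a : Fin m → Fin n → ℚ}
    {lam : Fin m → ℚ} (_ : 0 < n) (_ : ∀ i, y i ∈ Set.Icc (0 : ℚ) 1) (ω : ℕ → Bool) {s : State},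
    Fits y a lam s → Holds y a lam s.mem →
    ∃ s' t, Exec ω offsetProgram s s' t ∧ t ≤ C * timeUnit (inputSize y a lam) ∧
      s'.used = s.used ∧ Fits y a lam s' ∧ Agree 5 s.mem s'.mem ∧
      ∀ i : Fin n, s'.mem 5 i = offset (y i) := by
  refine ⟨_, fun {n m y a lam} hn hy ω s hB hs => exec_fill hn hy (N := n) (M := 0)
    (fun _ _ => 0) (fun i => offset (y i)) (by norm_num) hB hs (fun μ h => eval_colsExpr h)
    (fun μ h => by simp) (fun μ hμ h j i => i.elim0) (fun μ hμ h j hj _ _ => ?_) (by omega)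
    (bitLength_empty_sum_le hn hy _) (fun i => bitLength_offset_le hn hy i)⟩
  simp only [eval_add, eval_sub, eval_le, eval_const, eval_read, eval_cell, hj,
    Nat.floor_natCast, h.point, offset]
  -- The program computes the offset as `y - 1 + [y ≤ 1/2]`.
  split_ifs <;> ring

theorem exec_squaresProgram : ∃ C : ℕ, ∀ {n m : ℕ} {y : Fin n → ℚ} {a : Fin m → Fin n → ℚ}
    {lam : Fin m → ℚ} (_ : 0 < n) (_ : ∀ i, y i ∈ Set.Icc (0 : ℚ) 1) (ω : ℕ → Bool) {s : State},
    Fits y a lam s → Holds y a lam s.mem → (∀ i : Fin n, s.mem 5 i = offset (y i)) →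
    ∃ s' t, Exec ω squaresProgram s s' t ∧ t ≤ C * timeUnit (inputSize y a lam) ∧
      s'.used = s.used ∧ Fits y a lam s' ∧ Agree 7 s.mem s'.mem ∧
      ∀ j : Fin m, s'.mem 7 j = scaled y a j ⬝ᵥ scaled y a j := by
  refine ⟨_, fun {n m y a lam} hn hy ω s hB hs ho => exec_fill hn hy (N := m) (M := n)
    (fun j i => scaled y a j i * scaled y a j i) (fun j => scaled y a j ⬝ᵥ scaled y a j)
    (by norm_num) hB hs (fun μ h => eval_rowsExpr h)
    (fun μ h => eval_colsExpr h) (fun μ hμ h j i hj hi => ?_) (fun μ hμ h j hj hsum _ => ?_)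
    (by omega) (fun j S => bitLength_sum_sq_le hn hy j S)
    (fun j => bitLength_sum_sq_le hn hy j Finset.univ)⟩
  · rw [eval_mul, eval_entryExpr h (j := j) (i := i) (fun i => by
      rw [hμ.read (by norm_num) (by norm_num), ho]) (by rw [eval_cell, hj]) (by rw [eval_cell, hi])]
  · rw [eval_cell, hsum]; rfl

theorem exec_freeProgram : ∃ C : ℕ, ∀ {n m : ℕ} {y : Fin n → ℚ} {a : Fin m → Fin n → ℚ}
    {lam : Fin m → ℚ} (_ : 0 < n) (_ : ∀ i, y i ∈ Set.Icc (0 : ℚ) 1) (ω : ℕ → Bool) {s : State}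
    {x : Fin n → ℚ}, Fits y a lam s → Holds y a lam s.mem → (∀ i : Fin n, s.mem 8 i = x i) →
    ∃ s' t, Exec ω freeProgram s s' t ∧ t ≤ C * timeUnit (inputSize y a lam) ∧
      s'.used = s.used ∧ Fits y a lam s' ∧ Agree 9 s.mem s'.mem ∧
      ∀ i : Fin n, s'.mem 9 i = free x i := by
  refine ⟨_, fun {n m y a lam} hn hy ω s x hB hs hx => exec_fill hn hy (N := n) (M := 0)
    (fun _ _ => 0) (fun i => free x i) (by norm_num) hB hs (fun μ h => eval_colsExpr h)
    (fun μ h => by simp) (fun μ hμ h j i => i.elim0) (fun μ hμ h j hj _ _ => ?_) (by omega)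
    (bitLength_empty_sum_le hn hy _) (fun i => bitLength_sign_le hn hy (by
      rcases free_eq_or x i with h | h <;> simp [h]))⟩
  simp only [eval_mul, eval_sub, eval_div, eval_le, eval_const, eval_read, eval_cell,
    eval_powExpr, eval_colsExpr h, hj, Nat.floor_natCast,
    hμ.read (b := 8) (by norm_num) (by norm_num), hx, free, abs_le, neg_sub]
  -- The test on the absolute value is a product of two comparisons.
  by_cases h₁ : x j ≤ 1 - 1 / (n : ℚ) ^ 4 <;> by_cases h₂ : 1 / (n : ℚ) ^ 4 - 1 ≤ x j <;>
    simp only [h₁, h₂, and_true, and_false, if_true, if_false, mul_one, mul_zero]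

/-- Unlike for `freeProgram`, the point must come from the walk: partial sums of `⟨bⱼ, x⟩` are
stored, and their lengths are bounded only on the grid of the walk. -/
theorem exec_coefProgram : ∃ C : ℕ, ∀ {n m : ℕ} {y : Fin n → ℚ} {a : Fin m → Fin n → ℚ}
    {lam : Fin m → ℚ} (_ : 0 < n) (_ : ∀ i, y i ∈ Set.Icc (0 : ℚ) 1) (ω : ℕ → Bool) {s : State}
    (k : ℕ), Fits y a lam s → Prepared y a lam s.mem →
    (∀ i : Fin n, s.mem 8 i = walk (scaled y a) lam ω k i) →
    ∃ s' t, Exec ω coefProgram s s' t ∧ t ≤ C * timeUnit (inputSize y a lam) ∧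
      s'.used = s.used ∧ Fits y a lam s' ∧ Agree 6 s.mem s'.mem ∧
      ∀ j : Fin m, s'.mem 6 j = coef (scaled y a) lam (walk (scaled y a) lam ω k) j := by
  refine ⟨_, fun {n m y a lam} hn hy ω s k hB hs hx => exec_fill hn hy (N := m) (M := n)
    (fun j i => scaled y a j i * walk (scaled y a) lam ω k i)
    (fun j => coef (scaled y a) lam (walk (scaled y a) lam ω k) j)
    (by norm_num) hB hs.toHolds (fun μ h => eval_rowsExpr h)
    (fun μ h => eval_colsExpr h) (fun μ hμ h j i hj hi => ?_) (fun μ hμ h j hj hsum _ => ?_)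
    (by omega) (fun j S => bitLength_sum_mul_walk_le hn hy ω k j S)
    (fun j => bitLength_coef_le hn hy _ j)⟩
  · rw [eval_mul, eval_entryExpr h (j := j) (i := i) (fun i => by
      rw [hμ.read (by norm_num) (by norm_num), hs.offset]) (by rw [eval_cell, hj])
      (by rw [eval_cell, hi])]
    simp only [eval_read, eval_cell, hi, Nat.floor_natCast,
      hμ.read (b := 8) (by norm_num) (by norm_num), hx]
  · simp only [eval_mul, eval_sub, eval_div, eval_add, eval_le, eval_const, eval_read, eval_cell,
      eval_rowsExpr h, hj, Nat.floor_natCast, hsum,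
      hμ.read (b := 7) (by norm_num) (by norm_num), hs.squares, h.slack, coef]
    change (1 - if (scaled y a j ⬝ᵥ walk (scaled y a) lam ω k) *
      (scaled y a j ⬝ᵥ walk (scaled y a) lam ω k) ≤
        lam j * lam j * (scaled y a j ⬝ᵥ scaled y a j) then (1 : ℚ) else 0) * _ = _
    rw [← sq, ← sq]
    -- The strict inequality is obtained as one minus the reversed comparison.
    by_cases hlt : lam j ^ 2 * (scaled y a j ⬝ᵥ scaled y a j) <
      (scaled y a j ⬝ᵥ walk (scaled y a) lam ω k) ^ 2
    · rw [if_pos hlt, if_neg (not_le.mpr hlt), sub_zero, one_mul]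
    · rw [if_neg hlt, if_pos (not_lt.mp hlt), sub_self, zero_mul]

theorem exec_startProgram : ∃ C : ℕ, ∀ {n m : ℕ} {y : Fin n → ℚ} {a : Fin m → Fin n → ℚ}
    {lam : Fin m → ℚ} (_ : 0 < n) (_ : ∀ i, y i ∈ Set.Icc (0 : ℚ) 1) (ω : ℕ → Bool) {s : State}
    {x : Fin n → ℚ} {ρ : Fin n → Bool}, Fits y a lam s → Holds y a lam s.mem →
    (∀ i : Fin n, s.mem 9 i = free x i) →
    (∀ i : Fin n, s.mem 13 i = if ρ i then 1 else 0) →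
    ∃ s' t, Exec ω startProgram s s' t ∧ t ≤ C * timeUnit (inputSize y a lam) ∧
      s'.used = s.used ∧ Fits y a lam s' ∧ Agree 10 s.mem s'.mem ∧
      ∀ i : Fin n, s'.mem 10 i = dirIter (scaled y a) lam x (fun i => bitSign (ρ i)) 0 i := by
  refine ⟨_, fun {n m y a lam} hn hy ω s x ρ hB hs hx hρ => exec_fill hn hy (N := n) (M := 0)
    (fun _ _ => 0) (fun i => dirIter (scaled y a) lam x (fun i => bitSign (ρ i)) 0 i)
    (by norm_num) hB hs (fun μ h => eval_colsExpr h)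
    (fun μ h => by simp) (fun μ hμ h j i => i.elim0) (fun μ hμ h j hj _ _ => ?_) (by omega)
    (bitLength_empty_sum_le hn hy _)
    (fun i => bitLength_dirIter_le hn hy x ρ (Nat.zero_le _) i)⟩
  simp only [eval_mul, eval_sub, eval_const, eval_read, eval_cell, hj, Nat.floor_natCast,
    hμ.read (b := 9) (by norm_num) (by norm_num), hμ.read (b := 13) (by norm_num) (by norm_num),
    hx, hρ, dirIter, bitSign, Function.iterate_zero, id]
  congr 1
  split_ifs <;> norm_num

theorem exec_rowCoefProgram : ∃ C : ℕ, ∀ {n m : ℕ} {y : Fin n → ℚ} {a : Fin m → Fin n → ℚ}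
    {lam : Fin m → ℚ} (_ : 0 < n) (_ : ∀ i, y i ∈ Set.Icc (0 : ℚ) 1) (ω : ℕ → Bool) {s : State}
    {x : Fin n → ℚ} {ρ : Fin n → Bool} {l : ℕ}, l ≤ (m + 1) * n ^ 17 →
    Fits y a lam s → Prepared y a lam s.mem →
    (∀ i : Fin n, s.mem 9 i = free x i) → (∀ j : Fin m, s.mem 6 j = coef (scaled y a) lam x j) →
    (∀ i : Fin n, s.mem 10 i = dirIter (scaled y a) lam x (fun i => bitSign (ρ i)) l i) →
    ∃ s' t, Exec ω rowCoefProgram s s' t ∧ t ≤ C * timeUnit (inputSize y a lam) ∧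
      s'.used = s.used ∧ Fits y a lam s' ∧ Agree 12 s.mem s'.mem ∧
      ∀ j : Fin m, s'.mem 12 j = coef (scaled y a) lam x j * (freeRows (scaled y a) x j ⬝ᵥ
        dirIter (scaled y a) lam x (fun i => bitSign (ρ i)) l) := by
  refine ⟨_, fun {n m y a lam} hn hy ω s x ρ l hl hB hs hx hc hu => exec_fill hn hy
    (N := m) (M := n) (fun j i => freeRows (scaled y a) x j i *
      dirIter (scaled y a) lam x (fun i => bitSign (ρ i)) l i)
    (fun j => coef (scaled y a) lam x j * (freeRows (scaled y a) x j ⬝ᵥ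
        dirIter (scaled y a) lam x (fun i => bitSign (ρ i)) l))
    (by norm_num) hB hs.toHolds (fun μ h => eval_rowsExpr h)
    (fun μ h => eval_colsExpr h) (fun μ hμ h j i hj hi => ?_) (fun μ hμ h j hj hsum _ => ?_)
    (by omega) (fun j S => bitLength_rowDot_le hn hy x ρ hl j S)
    (fun j => bitLength_rowCoef_le hn hy x ρ hl j)⟩
  · rw [eval_mul, eval_mul, eval_entryExpr h (j := j) (i := i) (fun i => by
      rw [hμ.read (by norm_num) (by norm_num), hs.offset]) (by rw [eval_cell, hj])
      (by rw [eval_cell, hi])]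
    simp only [eval_read, eval_cell, hi, Nat.floor_natCast, freeRows,
      hμ.read (b := 9) (by norm_num) (by norm_num), hμ.read (b := 10) (by norm_num) (by norm_num),
      hx, hu]
  · simp only [eval_mul, eval_read, eval_cell, hj, Nat.floor_natCast, hsum,
      hμ.read (b := 6) (by norm_num) (by norm_num), hc]
    rfl

/-- Updating array `10` in place is sound because the gradient coefficients were saved in array `12`
beforehand. -/
theorem exec_subtractProgram : ∃ C : ℕ, ∀ {n m : ℕ} {y : Fin n → ℚ} {a : Fin m → Fin n → ℚ}
    {lam : Fin m → ℚ} (_ : 0 < n) (_ : ∀ i, y i ∈ Set.Icc (0 : ℚ) 1) (ω : ℕ → Bool) {s : State}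
    {x : Fin n → ℚ} {ρ : Fin n → Bool} {l : ℕ}, l + 1 ≤ (m + 1) * n ^ 17 →
    Fits y a lam s → Prepared y a lam s.mem →
    (∀ i : Fin n, s.mem 9 i = free x i) →
    (∀ i : Fin n, s.mem 10 i = dirIter (scaled y a) lam x (fun i => bitSign (ρ i)) l i) →
    (∀ j : Fin m, s.mem 12 j = coef (scaled y a) lam x j * (freeRows (scaled y a) x j ⬝ᵥ
        dirIter (scaled y a) lam x (fun i => bitSign (ρ i)) l)) →
    ∃ s' t, Exec ω subtractProgram s s' t ∧ t ≤ C * timeUnit (inputSize y a lam) ∧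
      s'.used = s.used ∧ Fits y a lam s' ∧ Agree 10 s.mem s'.mem ∧
      ∀ i : Fin n, s'.mem 10 i =
        dirIter (scaled y a) lam x (fun i => bitSign (ρ i)) (l + 1) i := by
  refine ⟨_, fun {n m y a lam} hn hy ω s x ρ l hl hB hs hx hu hd => exec_fill hn hy
    (N := n) (M := m) (fun i j => coef (scaled y a) lam x j * (freeRows (scaled y a) x j ⬝ᵥ
        dirIter (scaled y a) lam x (fun i => bitSign (ρ i)) l) * freeRows (scaled y a) x j i)
    (fun i => dirIter (scaled y a) lam x (fun i => bitSign (ρ i)) (l + 1) i)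
    (by norm_num) hB hs.toHolds (fun μ h => eval_colsExpr h)
    (fun μ h => eval_rowsExpr h) (fun μ hμ h i j hi hj => ?_) (fun μ hμ h i hi hsum ho => ?_)
    (by omega) (fun i S => bitLength_gradient_le hn hy x ρ (by omega) i S)
    (fun i => bitLength_dirIter_le hn hy x ρ hl i)⟩
  · rw [eval_mul, eval_mul, eval_entryExpr h (j := j) (i := i) (fun i => by
      rw [hμ.read (by norm_num) (by norm_num), hs.offset]) (by rw [eval_cell, hj])
      (by rw [eval_cell, hi])]
    simp only [eval_read, eval_cell, hi, hj, Nat.floor_natCast, freeRows,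
      hμ.read (b := 9) (by norm_num) (by norm_num), hμ.read (b := 12) (by norm_num) (by norm_num),
      hx, hd]
  · simp only [eval_sub, eval_read, eval_cell, hi, Nat.floor_natCast, hsum, ho, hu]
    rw [dirIter_succ]

theorem exec_moveProgram : ∃ C : ℕ, ∀ {n m : ℕ} {y : Fin n → ℚ} {a : Fin m → Fin n → ℚ}
    {lam : Fin m → ℚ} (_ : 0 < n) (_ : ∀ i, y i ∈ Set.Icc (0 : ℚ) 1) (ω : ℕ → Bool) {s : State}
    (k : ℕ), Fits y a lam s → Holds y a lam s.mem →
    (∀ i : Fin n, s.mem 8 i = walk (scaled y a) lam ω k i) →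
    (∀ i : Fin n, s.mem 10 i = direction (scaled y a) lam (walk (scaled y a) lam ω k)
      (fun i => bitSign (ω (k * n + i))) i) →
    ∃ s' t, Exec ω moveProgram s s' t ∧ t ≤ C * timeUnit (inputSize y a lam) ∧
      s'.used = s.used ∧ Fits y a lam s' ∧ Agree 8 s.mem s'.mem ∧
      ∀ i : Fin n, s'.mem 8 i = walk (scaled y a) lam ω (k + 1) i := by
  refine ⟨_, fun {n m y a lam} hn hy ω s k hB hs hx hu => exec_fill hn hy (N := n) (M := 0)
    (fun _ _ => 0) (fun i => walk (scaled y a) lam ω (k + 1) i) (by norm_num) hB hs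
    (fun μ h => eval_colsExpr h) (fun μ h => by simp) (fun μ hμ h j i => i.elim0)
    (fun μ hμ h j hj _ ho => ?_) (by omega)
    (bitLength_empty_sum_le hn hy _) (fun i => bitLength_walk_le hn hy ω (k + 1) i)⟩
  simp only [eval_add, eval_mul, eval_div, eval_const, eval_read, eval_cell,
    eval_powExpr, eval_colsExpr h, hj, Nat.floor_natCast, ho, hx,
    hμ.read (b := 10) (by norm_num) (by norm_num), hu, walk, walkStep]

theorem exec_orientationProgram : ∃ C : ℕ, ∀ {n m : ℕ} {y : Fin n → ℚ} {a : Fin m → Fin n → ℚ}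
    {lam : Fin m → ℚ} (_ : 0 < n) (_ : ∀ i, y i ∈ Set.Icc (0 : ℚ) 1) (ω : ℕ → Bool) {s : State}
    {x : Fin n → ℚ}, Fits y a lam s → Holds y a lam s.mem → (∀ i : Fin n, s.mem 8 i = x i) →
    (∀ i : Fin n, s.mem 9 i = free x i) →
    ∃ s' t, Exec ω orientationProgram s s' t ∧ t ≤ C * timeUnit (inputSize y a lam) ∧
      s'.used = s.used ∧ Fits y a lam s' ∧ Agree 14 s.mem s'.mem ∧
      ∀ i : Fin 1, s'.mem 14 i = orientation x := by
  refine ⟨_, fun {n m y a lam} hn hy ω s x hB hs hx hf => exec_fill hn hy (N := 1) (M := n)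
    (fun _ i => (1 - free x i) * (if 0 ≤ x i then 1 else -1)) (fun _ => orientation x)
    (by norm_num) hB hs (fun μ h => by simp)
    (fun μ h => eval_colsExpr h) (fun μ hμ h j i hj hi => ?_) (fun μ hμ h j hj hsum _ => ?_)
    (by omega) (fun _ S => bitLength_sum_sign_le hn hy x S) (fun i => bitLength_sign_le hn hy (by
      unfold orientation; split_ifs <;> simp))⟩
  · simp only [eval_mul, eval_sub, eval_const, eval_read, eval_cell, eval_signExpr, hi,
      Nat.floor_natCast, hμ.read (b := 8) (by norm_num) (by norm_num),
      hμ.read (b := 9) (by norm_num) (by norm_num), hx, hf]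
  · simp only [eval_signExpr, eval_cell, hsum, orientation]

theorem exec_outputProgram : ∃ C : ℕ, ∀ {n m : ℕ} {y : Fin n → ℚ} {a : Fin m → Fin n → ℚ}
    {lam : Fin m → ℚ} (_ : 0 < n) (_ : ∀ i, y i ∈ Set.Icc (0 : ℚ) 1) (ω : ℕ → Bool) {s : State}
    (k : ℕ), Fits y a lam s → Prepared y a lam s.mem →
    (∀ i : Fin n, s.mem 8 i = walk (scaled y a) lam ω k i) →
    (∀ i : Fin n, s.mem 9 i = free (walk (scaled y a) lam ω k) i) →
    (∀ i : Fin 1, s.mem 14 i = orientation (walk (scaled y a) lam ω k)) →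
    ∃ s' t, Exec ω outputProgram s s' t ∧ t ≤ C * timeUnit (inputSize y a lam) ∧
      s'.used = s.used ∧ Fits y a lam s' ∧ Agree 4 s.mem s'.mem ∧
      ∀ i : Fin n, s'.mem 4 i = roundedPoint y (walk (scaled y a) lam ω k) i := by
  refine ⟨_, fun {n m y a lam} hn hy ω s k hB hs hx hf ho => exec_fill hn hy (N := n) (M := 0)
    (fun _ _ => 0) (fun i => roundedPoint y (walk (scaled y a) lam ω k) i) (by norm_num) hB
    hs.toHolds (fun μ h => eval_colsExpr h) (fun μ h => by simp) (fun μ hμ h j i => i.elim0)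
    (fun μ hμ h j hj _ _ => ?_) (by omega)
    (bitLength_empty_sum_le hn hy _) (fun i => bitLength_roundedPoint_le hn hy ω k i)⟩
  have ho' : s.mem 14 0 = orientation (walk (scaled y a) lam ω k) := ho 0
  simp only [eval_add, eval_sub, eval_mul, eval_const, eval_read, eval_cell, eval_signExpr,
    hj, Nat.floor_natCast, h.point, hμ.read (b := 8) (by norm_num) (by norm_num),
    hμ.read (b := 9) (by norm_num) (by norm_num), hμ.read (b := 14) (by norm_num) (by norm_num),
    hμ.read (b := 5) (by norm_num) (by norm_num), hs.offset, hx, hf, ho', roundedPoint, snap]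

/-- Random bits are written to array `13`. -/
theorem exec_flipProgram : ∃ C : ℕ, ∀ {n m : ℕ} {y : Fin n → ℚ} {a : Fin m → Fin n → ℚ}
    {lam : Fin m → ℚ} (_ : 0 < n) (_ : ∀ i, y i ∈ Set.Icc (0 : ℚ) 1) (ω : ℕ → Bool) {s : State},
    Fits y a lam s → Holds y a lam s.mem →
    ∃ s' t, Exec ω flipProgram s s' t ∧
      t ≤ (n + 1) * (C * timeUnit (inputSize y a lam)) ∧
      s'.used = s.used + n ∧ Fits y a lam s' ∧ Agree 13 s.mem s'.mem ∧
      ∀ i : Fin n, s'.mem 13 i = if ω (s.used + i) then 1 else 0 := by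
  refine ⟨2 * (cell 20).weight + 1 + loopWeight colsExpr, fun {n m y a lam} hn hy ω s hB hs => ?_⟩
  set B := bitBudget (inputSize y a lam) with hBdef
  have hB1 : 1 ≤ B := hB.pos
  have hB2 : B ≤ B ^ 2 := Nat.le_self_pow two_ne_zero B
  obtain ⟨s', t, h1, h2, h3, h4, h5, h6⟩ : ∃ s' t, Exec ω flipProgram s s' t ∧
      t ≤ (n + 1) * ((2 * (cell 20).weight + 1) * B ^ 2 + loopWeight colsExpr * B ^ 2) ∧
      s'.used = s.used + n ∧ Fits y a lam s' ∧ Agree 13 s.mem s'.mem ∧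
      ∀ k < n, s'.mem 13 k = if ω (s.used + k) then 1 else 0 := by
    refine exec_forLoop (fun i s' => s'.used = s.used + i ∧ Fits y a lam s' ∧
      Agree 13 s.mem s'.mem ∧ ∀ k < i, s'.mem 13 k = if ω (s.used + k) then 1 else 0)
      (fun _ _ h => h.2.1) (fun _ _ h => eval_colsExpr (hs.agree h.2.2.1 (by norm_num)))
      (fun i hi => bitLength_natCast_le hn hy (Or.inl (by omega))) ?_ ?_
      ⟨rfl, hB, Agree.refl _ _, fun k hk => absurd hk (Nat.not_lt_zero _)⟩
    · rintro i s' v hv ⟨g1, g2, g3, g4⟩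
      refine ⟨g1, g2.write hv _ _, g3.write (by simp) _ _, fun k hk => ?_⟩
      rw [State.write_mem_of_ne _ (by norm_num), g4 k hk]
    · rintro i hi s' ⟨g1, g2, g3, g4⟩ hc
      have hx := Exec.flip (ω := ω) 13 (cell 20) s'
      have hi' : (cell 20).eval s'.mem = i := by rw [eval_cell, hc]
      rw [hi', Nat.floor_natCast] at hx
      refine ⟨_, _, hx, ?_, ?_, ?_, ?_, ?_, ?_⟩
      · have e1 := (cell 20).cost_le g2
        have e2 := (cell 20).bitLength_eval_le g2
        rw [hi'] at e2
        have e3 : (cell 20).weight * B ≤ (cell 20).weight * B ^ 2 := Nat.mul_le_mul_left _ hB2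
        rw [← hBdef] at e1 e2
        nlinarith
      · change (s'.write 13 i (if ω s'.used then 1 else 0)).mem 20 0 = i
        rw [State.write_mem_of_ne _ (by norm_num), hc]
      · change s'.used + 1 = _
        rw [g1, add_assoc]
      · exact BitBounded.write g2 (bitLength_sign_le hn hy (by split_ifs <;> simp)) _ _
      · exact Agree.write g3 (by simp) _ _
      · intro k hk
        change (s'.write 13 i (if ω s'.used then 1 else 0)).mem 13 k = _
        rw [State.write_mem_self]
        rcases eq_or_ne k i with rfl | hne
        · rw [Function.update_self, g1]
        · rw [Function.update_of_ne hne, g4 k (by omega)]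
  refine ⟨s', t, h1, h2.trans ?_, h3, h4, h5, fun i => h6 i i.isLt⟩
  rw [← add_mul]
  exact loop_le_timeUnit _ _ _

/-! ## Correctness of the program -/

theorem eval_iterationsExpr {n m : ℕ} {y : Fin n → ℚ} {a : Fin m → Fin n → ℚ} {lam : Fin m → ℚ}
    {μ : Memory} (h : Holds y a lam μ) :
    iterationsExpr.eval μ = ((m + 1) * n ^ 17 : ℕ) := by
  simp [iterationsExpr, eval_colsExpr h, eval_rowsExpr h]

/-- The invariant also preserves array `24`, the counter of the enclosing walk loop, and the arrays
`6` and `9`, which define the quadratic form and stay fixed during the iteration. -/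
theorem exec_directionProgram : ∃ C : ℕ, ∀ {n m : ℕ} {y : Fin n → ℚ} {a : Fin m → Fin n → ℚ}
    {lam : Fin m → ℚ} (_ : 0 < n) (_ : ∀ i, y i ∈ Set.Icc (0 : ℚ) 1) (ω : ℕ → Bool) {s : State}
    {x : Fin n → ℚ} {ρ : Fin n → Bool}, Fits y a lam s → Prepared y a lam s.mem →
    (∀ i : Fin n, s.mem 9 i = free x i) → (∀ j : Fin m, s.mem 6 j = coef (scaled y a) lam x j) →
    (∀ i : Fin n, s.mem 10 i = dirIter (scaled y a) lam x (fun i => bitSign (ρ i)) 0 i) →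
    ∃ s' t, Exec ω directionProgram s s' t ∧
      t ≤ ((m + 1) * n ^ 17 + 1) * (C * timeUnit (inputSize y a lam)) ∧
      s'.used = s.used ∧ Fits y a lam s' ∧ Prepared y a lam s'.mem ∧ s'.mem 8 = s.mem 8 ∧
      s'.mem 24 = s.mem 24 ∧
      ∀ i : Fin n, s'.mem 10 i = direction (scaled y a) lam x (fun i => bitSign (ρ i)) i := by
  obtain ⟨C₁, hC₁⟩ := exec_rowCoefProgram
  obtain ⟨C₂, hC₂⟩ := exec_subtractProgram
  refine ⟨C₁ + C₂ + loopWeight iterationsExpr, fun {n m y a lam} hn hy ω s x ρ hB hs hx hc hu => ?_⟩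
  obtain ⟨s', t, h1, h2, h3, h4, h5, h6, h7, -, -, h8⟩ : ∃ s' t, Exec ω directionProgram s s' t ∧
      t ≤ ((m + 1) * n ^ 17 + 1) * ((C₁ + C₂) * timeUnit (inputSize y a lam) +
        loopWeight iterationsExpr * bitBudget (inputSize y a lam) ^ 2) ∧
      s'.used = s.used ∧ Fits y a lam s' ∧ Prepared y a lam s'.mem ∧ s'.mem 8 = s.mem 8 ∧
      s'.mem 24 = s.mem 24 ∧ s'.mem 9 = s.mem 9 ∧ s'.mem 6 = s.mem 6 ∧
      ∀ i : Fin n, s'.mem 10 i = dirIter (scaled y a) lam x (fun i => bitSign (ρ i))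
        ((m + 1) * n ^ 17) i := by
    refine exec_forLoop (fun l s' => s'.used = s.used ∧ Fits y a lam s' ∧
      Prepared y a lam s'.mem ∧ s'.mem 8 = s.mem 8 ∧ s'.mem 24 = s.mem 24 ∧
      s'.mem 9 = s.mem 9 ∧ s'.mem 6 = s.mem 6 ∧
      ∀ i : Fin n, s'.mem 10 i = dirIter (scaled y a) lam x (fun i => bitSign (ρ i)) l i)
      (fun _ _ h => h.2.1) (fun _ _ h => eval_iterationsExpr h.2.2.1.toHolds)
      (fun i hi => bitLength_natCast_le hn hy (Or.inr (Or.inr hi))) ?_ ?_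
      ⟨rfl, hB, hs, rfl, rfl, rfl, rfl, hu⟩
    · rintro l s' v hv ⟨g1, g2, g3, g4, g5, g6, g7, g8⟩
      refine ⟨g1, g2.write hv _ _, g3.agree (Agree.write (out := 23) (Agree.refl _ _) (by simp) _ _)
        (by norm_num) (by norm_num) (by norm_num), ?_, ?_, ?_, ?_, fun i => ?_⟩
      · rw [State.write_mem_of_ne _ (by norm_num), g4]
      · rw [State.write_mem_of_ne _ (by norm_num), g5]
      · rw [State.write_mem_of_ne _ (by norm_num), g6]
      · rw [State.write_mem_of_ne _ (by norm_num), g7]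
      · rw [State.write_mem_of_ne _ (by norm_num), g8]
    · rintro l hl s' ⟨g1, g2, g3, g4, g5, g6, g7, g8⟩ hcount
      obtain ⟨s₁, t₁, e1, e2, e3, e4, e5, e6⟩ := hC₁ hn hy ω (s := s') (x := x) (ρ := ρ) (l := l)
        hl.le g2 g3 (fun i => by rw [g6, hx]) (fun j => by rw [g7, hc]) g8
      have p1 := g3.agree e5 (by norm_num) (by norm_num) (by norm_num)
      obtain ⟨s₂, t₂, f1, f2, f3, f4, f5, f6⟩ := hC₂ hn hy ω (s := s₁) (x := x) (ρ := ρ) (l := l)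
        hl e4 p1 (fun i => by rw [e5.read (by norm_num) (by norm_num), g6, hx])
        (fun i => by rw [e5.read (by norm_num) (by norm_num), g8]) e6
      have hsame : ∀ b, b < 20 ∨ 22 < b → b ≠ 10 → b ≠ 12 → s₂.mem b = s'.mem b :=
        fun b hb h10 h12 => by rw [f5.read hb h10, e5.read hb h12]
      refine ⟨s₂, _, Exec.seq e1 f1, by linarith, ?_, by rw [f3, e3, g1], f4,
        p1.agree f5 (by norm_num) (by norm_num) (by norm_num), ?_, ?_, ?_, ?_, f6⟩
      · rw [hsame 23 (by norm_num) (by norm_num) (by norm_num), hcount]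
      · rw [hsame 8 (by norm_num) (by norm_num) (by norm_num), g4]
      · rw [hsame 24 (by norm_num) (by norm_num) (by norm_num), g5]
      · rw [hsame 9 (by norm_num) (by norm_num) (by norm_num), g6]
      · rw [hsame 6 (by norm_num) (by norm_num) (by norm_num), g7]
  refine ⟨s', t, h1, h2.trans ?_, h3, h4, h5, h6, h7, h8⟩
  have := loop_le_timeUnit (inputSize y a lam) ((m + 1) * n ^ 17) (loopWeight iterationsExpr)
  calc _ = ((m + 1) * n ^ 17 + 1) * ((C₁ + C₂) * timeUnit (inputSize y a lam)) +
        ((m + 1) * n ^ 17 + 1) *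
          (loopWeight iterationsExpr * bitBudget (inputSize y a lam) ^ 2) := by ring
    _ ≤ _ := Nat.add_le_add_left this _
    _ = _ := by ring

/-- The condition `s.used = k * n` aligns the bits consumed by the machine with the block of `ω`
that drives step `k` of `walk`. -/
theorem exec_stepProgram : ∃ C : ℕ, ∀ {n m : ℕ} {y : Fin n → ℚ} {a : Fin m → Fin n → ℚ}
    {lam : Fin m → ℚ} (_ : 0 < n) (_ : ∀ i, y i ∈ Set.Icc (0 : ℚ) 1) (ω : ℕ → Bool) {s : State}
    (k : ℕ), Fits y a lam s → Prepared y a lam s.mem → s.used = k * n →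
    (∀ i : Fin n, s.mem 8 i = walk (scaled y a) lam ω k i) →
    ∃ s' t, Exec ω stepProgram s s' t ∧
      t ≤ C * ((m + 1) * n ^ 17 + 1) * timeUnit (inputSize y a lam) ∧
      s'.used = (k + 1) * n ∧ Fits y a lam s' ∧ Prepared y a lam s'.mem ∧
      s'.mem 24 = s.mem 24 ∧
      ∀ i : Fin n, s'.mem 8 i = walk (scaled y a) lam ω (k + 1) i := by
  obtain ⟨C₁, hC₁⟩ := exec_flipProgram
  obtain ⟨C₂, hC₂⟩ := exec_freeProgram
  obtain ⟨C₃, hC₃⟩ := exec_coefProgram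
  obtain ⟨C₄, hC₄⟩ := exec_startProgram
  obtain ⟨C₅, hC₅⟩ := exec_directionProgram
  obtain ⟨C₆, hC₆⟩ := exec_moveProgram
  refine ⟨C₁ + C₂ + C₃ + C₄ + C₅ + C₆, fun {n m y a lam} hn hy ω s k hB hs hused hx => ?_⟩
  obtain ⟨s₁, t₁, x1, b1, u1, f1, g1, v1⟩ := hC₁ hn hy ω hB hs.toHolds
  have p1 := hs.agree g1 (by norm_num) (by norm_num) (by norm_num)
  have w1 : ∀ i : Fin n, s₁.mem 8 i = walk (scaled y a) lam ω k i := fun i => by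
    rw [g1.read (by norm_num) (by norm_num), hx]
  obtain ⟨s₂, t₂, x2, b2, u2, f2, g2, v2⟩ := hC₂ hn hy ω f1 p1.toHolds w1
  have p2 := p1.agree g2 (by norm_num) (by norm_num) (by norm_num)
  have w2 : ∀ i : Fin n, s₂.mem 8 i = walk (scaled y a) lam ω k i := fun i => by
    rw [g2.read (by norm_num) (by norm_num), w1]
  obtain ⟨s₃, t₃, x3, b3, u3, f3, g3, v3⟩ := hC₃ hn hy ω k f2 p2 w2
  have p3 := p2.agree g3 (by norm_num) (by norm_num) (by norm_num)
  have w3 : ∀ i : Fin n, s₃.mem 8 i = walk (scaled y a) lam ω k i := fun i => by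
    rw [g3.read (by norm_num) (by norm_num), w2]
  obtain ⟨s₄, t₄, x4, b4, u4, f4, g4, v4⟩ := hC₄ hn hy ω
    (x := walk (scaled y a) lam ω k) (ρ := fun i => ω (k * n + i)) f3 p3.toHolds
    (fun i => by rw [g3.read (by norm_num) (by norm_num), v2])
    (fun i => by rw [g3.read (by norm_num) (by norm_num), g2.read (by norm_num) (by norm_num),
      v1, hused])
  have p4 := p3.agree g4 (by norm_num) (by norm_num) (by norm_num)
  have w4 : ∀ i : Fin n, s₄.mem 8 i = walk (scaled y a) lam ω k i := fun i => by
    rw [g4.read (by norm_num) (by norm_num), w3]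
  obtain ⟨s₅, t₅, x5, b5, u5, f5, p5, q5, r5, v5⟩ := hC₅ hn hy ω
    (x := walk (scaled y a) lam ω k) (ρ := fun i => ω (k * n + i)) f4 p4
    (fun i => by rw [g4.read (by norm_num) (by norm_num), g3.read (by norm_num) (by norm_num), v2])
    (fun j => by rw [g4.read (by norm_num) (by norm_num), v3]) v4
  obtain ⟨s₆, t₆, x6, b6, u6, f6, g6, v6⟩ := hC₆ hn hy ω k f5 p5.toHolds
    (fun i => by rw [q5, w4]) v5
  refine ⟨s₆, _, Exec.seq x1 (Exec.seq x2 (Exec.seq x3 (Exec.seq x4 (Exec.seq x5 x6)))), ?_, ?_, f6,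
    p5.agree g6 (by norm_num) (by norm_num) (by norm_num), ?_, v6⟩
  · set U := timeUnit (inputSize y a lam)
    set K := (m + 1) * n ^ 17 + 1 with hK
    have hK1 : 1 ≤ K := by omega
    have hnK : n + 1 ≤ K := by
      have h17 : n ≤ n ^ 17 := Nat.le_self_pow (by norm_num) n
      have : n ^ 17 ≤ (m + 1) * n ^ 17 := Nat.le_mul_of_pos_left _ (Nat.succ_pos m)
      omega
    have e1 : (n + 1) * (C₁ * U) ≤ K * (C₁ * U) := Nat.mul_le_mul_right _ hnK
    have e2 : C₂ * U ≤ K * (C₂ * U) := Nat.le_mul_of_pos_left _ hK1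
    have e3 : C₃ * U ≤ K * (C₃ * U) := Nat.le_mul_of_pos_left _ hK1
    have e4 : C₄ * U ≤ K * (C₄ * U) := Nat.le_mul_of_pos_left _ hK1
    have e6 : C₆ * U ≤ K * (C₆ * U) := Nat.le_mul_of_pos_left _ hK1
    calc _ ≤ K * (C₁ * U) + (K * (C₂ * U) + (K * (C₃ * U) + (K * (C₄ * U) +
          (K * (C₅ * U) + K * (C₆ * U))))) := by
          gcongr <;> omega
      _ = _ := by ring
  · rw [u6, u5, u4, u3, u2, u1, hused, Nat.succ_mul]
  · rw [g6.read (by norm_num) (by norm_num), r5, g4.read (by norm_num) (by norm_num),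
      g3.read (by norm_num) (by norm_num), g2.read (by norm_num) (by norm_num),
      g1.read (by norm_num) (by norm_num)]

theorem exec_walkProgram : ∃ C : ℕ, ∀ {n m : ℕ} {y : Fin n → ℚ} {a : Fin m → Fin n → ℚ}
    {lam : Fin m → ℚ} (_ : 0 < n) (_ : ∀ i, y i ∈ Set.Icc (0 : ℚ) 1) (ω : ℕ → Bool) {s : State},
    Fits y a lam s → Prepared y a lam s.mem → s.used = 0 → (∀ i : Fin n, s.mem 8 i = 0) →
    ∃ s' t, Exec ω walkProgram s s' t ∧
      t ≤ (4 * n ^ 10 + 1) * (C * ((m + 1) * n ^ 17 + 1) * timeUnit (inputSize y a lam)) ∧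
      Fits y a lam s' ∧ Prepared y a lam s'.mem ∧
      ∀ i : Fin n, s'.mem 8 i = walk (scaled y a) lam ω (4 * n ^ 10) i := by
  obtain ⟨C, hC⟩ := exec_stepProgram
  set bound : Expr := .const 4 * powExpr colsExpr 10 with hbound
  refine ⟨C + loopWeight bound, fun {n m y a lam} hn hy ω s hB hs hused hx => ?_⟩
  obtain ⟨s', t, h1, h2, -, h3, h4, h5⟩ : ∃ s' t, Exec ω walkProgram s s' t ∧
      t ≤ (4 * n ^ 10 + 1) * (C * ((m + 1) * n ^ 17 + 1) * timeUnit (inputSize y a lam) +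
        loopWeight bound * bitBudget (inputSize y a lam) ^ 2) ∧
      s'.used = (4 * n ^ 10) * n ∧ Fits y a lam s' ∧ Prepared y a lam s'.mem ∧
      ∀ i : Fin n, s'.mem 8 i = walk (scaled y a) lam ω (4 * n ^ 10) i := by
    refine exec_forLoop (fun k s' => s'.used = k * n ∧ Fits y a lam s' ∧
      Prepared y a lam s'.mem ∧ ∀ i : Fin n, s'.mem 8 i = walk (scaled y a) lam ω k i)
      (fun _ _ h => h.2.1) (fun _ _ h => ?_)
      (fun i hi => bitLength_natCast_le hn hy (Or.inr (Or.inl hi))) ?_ ?_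
      ⟨by rw [hused, zero_mul], hB, hs, fun i => by rw [hx]; rfl⟩
    · simp [eval_colsExpr h.2.2.1.toHolds]
    · rintro k s' v hv ⟨g1, g2, g3, g4⟩
      refine ⟨g1, g2.write hv _ _, g3.agree (Agree.write (out := 24) (Agree.refl _ _) (by simp) _ _)
        (by norm_num) (by norm_num) (by norm_num), fun i => ?_⟩
      rw [State.write_mem_of_ne _ (by norm_num), g4]
    · rintro k hk s' ⟨g1, g2, g3, g4⟩ hcount
      obtain ⟨s₁, t₁, e1, e2, e3, e4, e5, e6, e7⟩ := hC hn hy ω k g2 g3 g1 g4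
      exact ⟨s₁, t₁, e1, e2, by rw [e6, hcount], e3, e4, e5, e7⟩
  refine ⟨s', t, h1, h2.trans ?_, h3, h4, h5⟩
  refine Nat.mul_le_mul_left _ ?_
  set K := (m + 1) * n ^ 17 + 1 with hK
  have hK1 : 1 ≤ K := by omega
  have hU : bitBudget (inputSize y a lam) ^ 2 ≤ timeUnit (inputSize y a lam) := by
    unfold timeUnit
    exact Nat.le_mul_of_pos_left _ (by positivity)
  calc _ ≤ C * K * timeUnit (inputSize y a lam) +
        loopWeight bound * K * timeUnit (inputSize y a lam) := by
        gcongr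
        exact Nat.le_mul_of_pos_right _ hK1
    _ = _ := by ring

theorem exec_roundingProgram : ∃ C : ℕ, ∀ {n m : ℕ} (y : Fin n → ℚ) (a : Fin m → Fin n → ℚ)
    (lam : Fin m → ℚ) (_ : 0 < n) (_ : ∀ i, y i ∈ Set.Icc (0 : ℚ) 1) (ω : ℕ → Bool),
    ∃ s' t, Exec ω roundingProgram ⟨inputMemory y a lam, 0⟩ s' t ∧
      t ≤ (4 * n ^ 10 + 1) * (C * ((m + 1) * n ^ 17 + 1) * timeUnit (inputSize y a lam)) ∧
      ∀ i : Fin n, s'.mem 4 i = roundedPoint y (walk (scaled y a) lam ω (4 * n ^ 10)) i := by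
  obtain ⟨C₁, hC₁⟩ := exec_offsetProgram
  obtain ⟨C₂, hC₂⟩ := exec_squaresProgram
  obtain ⟨C₃, hC₃⟩ := exec_walkProgram
  obtain ⟨C₄, hC₄⟩ := exec_freeProgram
  obtain ⟨C₅, hC₅⟩ := exec_orientationProgram
  obtain ⟨C₆, hC₆⟩ := exec_outputProgram
  refine ⟨C₁ + C₂ + C₃ + C₄ + C₅ + C₆, fun {n m} y a lam hn hy ω => ?_⟩
  have hfit : Fits y a lam ⟨inputMemory y a lam, 0⟩ := fun b k =>
    (bitBounded_inputMemory b k).trans (by unfold bitBudget; omega)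
  obtain ⟨s₁, t₁, x1, b1, u1, f1, g1, v1⟩ := hC₁ hn hy ω hfit holds_inputMemory
  have h1 := (holds_inputMemory (y := y) (a := a) (lam := lam)).agree g1 (by norm_num)
  obtain ⟨s₂, t₂, x2, b2, u2, f2, g2, v2⟩ := hC₂ hn hy ω f1 h1 v1
  have p2 : Prepared y a lam s₂.mem := ⟨h1.agree g2 (by norm_num), fun i => by
    rw [g2.read (by norm_num) (by norm_num), v1], v2⟩
  -- Array `8` needs no initialization: untouched cells hold 0, the starting point of the walk.
  obtain ⟨s₃, t₃, x3, b3, f3, p3, v3⟩ := hC₃ hn hy ω f2 p2 (by rw [u2, u1]) (fun i => by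
    rw [g2.read (by norm_num) (by norm_num), g1.read (by norm_num) (by norm_num)]
    rfl)
  -- Within a step the free coordinates are determined before the move, so array `9` has to be
  -- recomputed for the final point.
  obtain ⟨s₄, t₄, x4, b4, u4, f4, g4, v4⟩ := hC₄ hn hy ω f3 p3.toHolds v3
  have p4 := p3.agree g4 (by norm_num) (by norm_num) (by norm_num)
  have w4 : ∀ i : Fin n, s₄.mem 8 i = walk (scaled y a) lam ω (4 * n ^ 10) i := fun i => by
    rw [g4.read (by norm_num) (by norm_num), v3]
  obtain ⟨s₅, t₅, x5, b5, u5, f5, g5, v5⟩ := hC₅ hn hy ω f4 p4.toHolds w4 v4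
  have p5 := p4.agree g5 (by norm_num) (by norm_num) (by norm_num)
  obtain ⟨s₆, t₆, x6, b6, u6, f6, g6, v6⟩ := hC₆ hn hy ω (4 * n ^ 10) f5 p5
    (fun i => by rw [g5.read (by norm_num) (by norm_num), w4])
    (fun i => by rw [g5.read (by norm_num) (by norm_num), v4]) v5
  refine ⟨s₆, _, Exec.seq x1 (Exec.seq x2 (Exec.seq x3 (Exec.seq x4 (Exec.seq x5 x6)))), ?_, v6⟩
  set U := timeUnit (inputSize y a lam)
  set K := (m + 1) * n ^ 17 + 1
  set T := 4 * n ^ 10 + 1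
  have hTK : 1 ≤ T * K := Nat.mul_pos (Nat.succ_pos _) (Nat.succ_pos _)
  have e : ∀ c, c * U ≤ T * K * (c * U) := fun c => Nat.le_mul_of_pos_left _ hTK
  calc _ ≤ T * K * (C₁ * U) + (T * K * (C₂ * U) + (T * (C₃ * K * U) + (T * K * (C₄ * U) +
        (T * K * (C₅ * U) + T * K * (C₆ * U))))) := by
        gcongr
        exacts [b1.trans (e _), b2.trans (e _), b4.trans (e _), b5.trans (e _), b6.trans (e _)]
    _ = _ := by ring

/-! ## Rational and real data -/

section Cast

variable {n m : ℕ}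

theorem cast_dotProduct (u v : Fin n → ℚ) :
    ((u ⬝ᵥ v : ℚ) : ℝ) = (fun i => (u i : ℝ)) ⬝ᵥ fun i => (v i : ℝ) := by
  simp [dotProduct]

theorem cast_offset (y : ℚ) : ((offset y : ℚ) : ℝ) = offset (y : ℝ) := by
  have h : (y : ℝ) ≤ 1 / 2 ↔ y ≤ 1 / 2 := by
    rw [← Rat.cast_le (K := ℝ)]; norm_num
  unfold offset
  simp only [h]
  split_ifs <;> norm_num

theorem cast_scaled (y : Fin n → ℚ) (a : Fin m → Fin n → ℚ) (j : Fin m) (i : Fin n) :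
    ((scaled y a j i : ℚ) : ℝ) = scaled (fun i => (y i : ℝ)) (fun j i => (a j i : ℝ)) j i := by
  simp [scaled, cast_offset]

theorem cast_free (x : Fin n → ℚ) (i : Fin n) :
    ((free x i : ℚ) : ℝ) = free (fun i => (x i : ℝ)) i := by
  have h : |(x i : ℝ)| ≤ 1 - 1 / (n : ℝ) ^ 4 ↔ |x i| ≤ 1 - 1 / (n : ℚ) ^ 4 := by
    rw [← Rat.cast_le (K := ℝ)]; norm_num
  unfold free
  simp only [h]
  split_ifs <;> norm_num

theorem cast_coef (b : Fin m → Fin n → ℚ) (lam : Fin m → ℚ) (x : Fin n → ℚ) (j : Fin m) :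
    ((coef b lam x j : ℚ) : ℝ) = coef (fun j i => (b j i : ℝ)) (fun j => (lam j : ℝ))
      (fun i => (x i : ℝ)) j := by
  have h : (lam j : ℝ) ^ 2 * ((b j ⬝ᵥ b j : ℚ) : ℝ) < ((b j ⬝ᵥ x : ℚ) : ℝ) ^ 2 ↔
      lam j ^ 2 * (b j ⬝ᵥ b j) < (b j ⬝ᵥ x) ^ 2 := by
    norm_cast
  unfold coef
  simp only [← cast_dotProduct, h]
  split_ifs <;> push_cast <;> rfl

theorem cast_descend (c : Fin m → ℚ) (d : Fin m → Fin n → ℚ) (u : Fin n → ℚ) :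
    (fun i => ((descend c d u i : ℚ) : ℝ)) = descend (fun j => (c j : ℝ))
      (fun j i => (d j i : ℝ)) (fun i => (u i : ℝ)) := by
  ext i
  simp [descend, ← cast_dotProduct]

theorem cast_direction (b : Fin m → Fin n → ℚ) (lam : Fin m → ℚ) (x r : Fin n → ℚ) :
    (fun i => ((direction b lam x r i : ℚ) : ℝ)) = direction (fun j i => (b j i : ℝ))
      (fun j => (lam j : ℝ)) (fun i => (x i : ℝ)) (fun i => (r i : ℝ)) := by
  unfold direction
  have h0 : (fun i => ((free x i * r i : ℚ) : ℝ)) =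
      fun i => free (fun i => (x i : ℝ)) i * (r i : ℝ) := by
    ext i; push_cast; rw [cast_free]
  have key : ∀ (k : ℕ) (u : Fin n → ℚ),
      (fun i => (((descend (coef b lam x) (freeRows b x))^[k] u i : ℚ) : ℝ)) =
      (descend (coef (fun j i => (b j i : ℝ)) (fun j => (lam j : ℝ)) fun i => (x i : ℝ))
        (freeRows (fun j i => (b j i : ℝ)) fun i => (x i : ℝ)))^[k] fun i => (u i : ℝ) := by
    intro k
    induction k with
    | zero => intro u; rfl
    | succ k ih =>
      intro u
      rw [Function.iterate_succ_apply, Function.iterate_succ_apply, ih, cast_descend]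
      congr 2
      · ext j; exact cast_coef b lam x j
      · ext j i; simp [freeRows, cast_free]
  rw [key, h0]

/-- The walk uses only field operations and comparisons, all respected by `ℚ → ℝ`. So the machine's
rational run is an instance of the walk analysed over the reals. -/
theorem cast_walk (b : Fin m → Fin n → ℚ) (lam : Fin m → ℚ) (ω : ℕ → Bool) (s : ℕ) :
    (fun i => ((walk b lam ω s i : ℚ) : ℝ)) =
      walk (fun j i => (b j i : ℝ)) (fun j => (lam j : ℝ)) ω s := by
  induction s with
  | zero => ext i; simp [walk]
  | succ s ih =>
    have hr : (fun i : Fin n => ((bitSign (ω (s * n + i)) : ℚ) : ℝ)) =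
        fun i : Fin n => bitSign (ω (s * n + i)) := by
      ext i; unfold bitSign; split_ifs <;> norm_num
    have hd := cast_direction b lam (walk b lam ω s) (fun i => bitSign (ω (s * n + i)))
    rw [hr, ih] at hd
    ext i
    have hdi := congrFun hd i
    have hi := congrFun ih i
    simp only [walk, walkStep]
    push_cast
    rw [hdi, hi]

theorem cast_sign (x : ℚ) : ((if 0 ≤ x then 1 else -1 : ℚ) : ℝ) = if 0 ≤ (x : ℝ) then 1 else -1 := by
  simp only [Rat.cast_nonneg]
  split_ifs <;> norm_num

theorem cast_roundedPoint (y x : Fin n → ℚ) (i : Fin n) :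
    ((roundedPoint y x i : ℚ) : ℝ) =
      roundedPoint (fun i => (y i : ℝ)) (fun i => (x i : ℝ)) i := by
  have ho : ((orientation x : ℚ) : ℝ) = orientation (fun i => (x i : ℝ)) := by
    unfold orientation
    rw [cast_sign]
    simp only [Rat.cast_sum, Rat.cast_mul, Rat.cast_sub, Rat.cast_one, cast_sign, cast_free]
  have hs : ((snap x i : ℚ) : ℝ) = snap (fun i => (x i : ℝ)) i := by
    unfold snap
    simp only [Rat.cast_add, Rat.cast_mul, Rat.cast_sub, Rat.cast_one, cast_sign, cast_free]
  unfold roundedPoint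
  push_cast
  rw [ho, hs, cast_offset]

end Cast

/-! ## The main theorem -/

theorem coinProb_mono {N : ℕ} {A A' : (ℕ → Bool) → Prop} (h : ∀ ω, A ω → A' ω) :
    coinProb N A ≤ coinProb N A' := by
  classical
  rw [coinProb_eq_mean, coinProb_eq_mean]
  refine mean_mono fun ω => ?_
  by_cases hA : A ω
  · rw [if_pos hA, if_pos (h ω hA)]
  · rw [if_neg hA]; split_ifs <;> norm_num

theorem exists_of_coinProb_pos {N : ℕ} {A : (ℕ → Bool) → Prop} (h : 0 < coinProb N A) :
    ∃ ω, A ω := by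
  by_contra! hA
  have h1 := coinProb_mono (N := N) (A' := fun _ => False) fun ω hω => hA ω hω
  simp [coinProb] at h1
  exact absurd h (not_lt.mpr h1)

section Final

variable {n m : ℕ}

/-- The constant 100 is generous: the tail bound needs only `exp (-λ²/8)`, and the error estimate
only `n ≥ 4`. -/
theorem half_le_coinProb_walk {y : Fin n → ℝ} {a : Fin m → Fin n → ℝ} {lam : Fin m → ℝ}
    (h : Admissible 100 y a lam) {N : ℕ} (hN : 4 * n ^ 10 * n ≤ N) :
    1 / 2 ≤ coinProb N fun ω => IsPartialRounding (1 / 8) y a lam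
      (roundedPoint y (walk (scaled y a) lam ω (4 * n ^ 10))) := by
  have hn : 100 < n := by exact_mod_cast h.dim_large
  refine (half_le_mean_frozen (by omega) hN (scaled y a) lam h.lam_nonneg ?_).trans
    (coinProb_mono fun ω hω =>
      isPartialRounding_roundedPoint (by omega) h.mem_cube h.lam_nonneg ω hω)
  refine le_trans (Finset.sum_le_sum fun j _ => Real.exp_le_exp.mpr ?_) h.sum_lt.le
  have := sq_nonneg (lam j)
  linarith

/-- A bound for the running time of `roundingProgram` on inputs of size `L`, up to the constant
`C`; it is at least the number of random bits. -/
noncomputable def timePolynomial (C : ℕ) : Polynomial ℕ :=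
  (4 * .X ^ 10 + 1) * (.C C * (.X * .X ^ 17 + 1) * (2 * (.X + 1) ^ 2 *
    (2 * (5 * .X + (5 * .X + 7 * .X ^ 2) * (.X ^ 18 + 1)) + 20 * .X + 3) ^ 2)) +
    4 * .X ^ 10 * .X

theorem eval_timePolynomial (C L : ℕ) : (timePolynomial C).eval L =
    (4 * L ^ 10 + 1) * (C * (L * L ^ 17 + 1) * timeUnit L) + 4 * L ^ 10 * L := by
  simp [timePolynomial, timeUnit, bitBudget]

theorem exists_roundingProgram_spec : ∃ p : Polynomial ℕ,
    ∀ (n m : ℕ) (y : Fin n → ℚ) (a : Fin m → Fin n → ℚ) (lam : Fin m → ℚ),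
      Admissible 100 (fun i => (y i : ℝ)) (fun j i => (a j i : ℝ)) (fun j => (lam j : ℝ)) →
      (∀ ω : ℕ → Bool, HaltsWithin roundingProgram ω (p.eval (inputSize y a lam)) y a lam) ∧
      1 / 2 ≤ coinProb (p.eval (inputSize y a lam))
        (fun ω => FindsRounding (1 / 8) roundingProgram ω y a lam) := by
  obtain ⟨C, hC⟩ := exec_roundingProgram
  refine ⟨timePolynomial C, fun n m y a lam h => ?_⟩
  have hn : 100 < n := by exact_mod_cast h.dim_large
  have hy : ∀ i, y i ∈ Set.Icc (0 : ℚ) 1 := fun i => by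
    have := h.mem_cube i
    exact ⟨by exact_mod_cast this.1, by exact_mod_cast this.2⟩
  have hL := add_two_le_inputSize y a lam
  rw [eval_timePolynomial]
  have hnL : n ≤ inputSize y a lam := by omega
  have hmL : m + 1 ≤ inputSize y a lam := by omega
  constructor
  · intro ω
    obtain ⟨s, t, h1, h2, -⟩ := hC y a lam (by omega) hy ω
    refine ⟨s, t, h1, h2.trans (le_trans ?_ (Nat.le_add_right _ _))⟩
    gcongr
  -- The last summand of the polynomial guarantees enough genuinely random bits for the whole walk.
  · have hN : 4 * n ^ 10 * n ≤ (4 * inputSize y a lam ^ 10 + 1) * (C * (inputSize y a lam *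
        inputSize y a lam ^ 17 + 1) * timeUnit (inputSize y a lam)) +
        4 * inputSize y a lam ^ 10 * inputSize y a lam :=
      le_trans (by gcongr) (Nat.le_add_left _ _)
    refine (half_le_coinProb_walk h hN).trans (coinProb_mono fun ω hω => ?_)
    obtain ⟨s, t, h1, -, h3⟩ := hC y a lam (by omega) hy ω
    refine ⟨s, t, h1, ?_⟩
    have hb : (fun j i => ((scaled y a j i : ℚ) : ℝ)) =
        scaled (fun i => (y i : ℝ)) (fun j i => (a j i : ℝ)) := by
      ext j i; exact cast_scaled y a j i
    have heq : (fun i : Fin n => (s.mem 4 i : ℝ)) = roundedPoint (fun i => (y i : ℝ))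
        (walk (scaled (fun i => (y i : ℝ)) fun j i => (a j i : ℝ)) (fun j => (lam j : ℝ)) ω
          (4 * n ^ 10)) := by
      ext i
      rw [h3, cast_roundedPoint, cast_walk, hb]
    rw [heq]
    exact hω

end Final

/-- The probabilistic method: the analysis of the walk never used rationality. -/
theorem exists_isPartialRounding {n m : ℕ} {y : Fin n → ℝ} {a : Fin m → Fin n → ℝ}
    {lam : Fin m → ℝ} (h : Admissible 100 y a lam) :
    ∃ y' : Fin n → ℝ, IsPartialRounding (1 / 8) y a lam y' := by
  obtain ⟨ω, hω⟩ := exists_of_coinProb_pos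
    (lt_of_lt_of_le (by norm_num) (half_le_coinProb_walk h le_rfl))
  exact ⟨_, hω⟩

end PartialRounding

theorem mainTheorem2 :
    ∃ K₀ : ℝ, 0 < K₀ ∧ ∃ c : ℝ, 0 < c ∧
      (∃ (P : PartialRounding.Program) (p : Polynomial ℕ),
        ∀ (n m : ℕ) (y : Fin n → ℚ) (a : Fin m → Fin n → ℚ) (lam : Fin m → ℚ),
          PartialRounding.Admissible K₀ (fun i => (y i : ℝ)) (fun j i => (a j i : ℝ))
            (fun j => (lam j : ℝ)) →
          (∀ ω : ℕ → Bool, PartialRounding.HaltsWithin P ω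
            (p.eval (PartialRounding.inputSize y a lam)) y a lam) ∧
          1 / 2 ≤ PartialRounding.coinProb (p.eval (PartialRounding.inputSize y a lam))
            (fun ω => PartialRounding.FindsRounding c P ω y a lam)) ∧
      (∀ (n m : ℕ) (y : Fin n → ℝ) (a : Fin m → Fin n → ℝ) (lam : Fin m → ℝ),
        PartialRounding.Admissible K₀ y a lam →
        ∃ y' : Fin n → ℝ, PartialRounding.IsPartialRounding c y a lam y') :=
  ⟨100, by norm_num, 1 / 8, by norm_num,
    ⟨PartialRounding.roundingProgram, PartialRounding.exists_roundingProgram_spec⟩,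
    fun _ _ _ _ _ h => PartialRounding.exists_isPartialRounding h⟩
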